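/- Let $\mathcal S,\mathcal X,\mathcal Y,\widehat{\mathcal S}$ be finite alphabets, $P_S$ a source, $P_{Y|X}$ a memoryless channel, and let $$P_{SUXY\widehat S}=P_S\,P_{U|S}\,P_{X|US}\,P_{Y|X}\,P_{\widehat S|UY},\qquad U\in\{0,1\},\qquad I(U;S)\le I(U;Y).$$ The $(S,X,Y,\widehat S)$-marginal $P_{SXY\widehat S}$ of this law is the target. Then there are $\beta\in(0,1/2)$ and, for every $m\in\mathbb N$, an instance of the polar coding scheme below with chained block length $n=2^m$, such that, as $m\to\infty$, the number $k$ of chained blocks tends to infinity, the rate of common randomness $\log_2|\mathcal C|/N$ tends to $0$ ($N$ is the total number of channel uses, the common randomness $C$ is uniform on $\mathcal C$), and for every $\varepsilon>0$ $$\mathbb P\Big\{\sum_{s,x,y,\hat s}\big|T_{S^{1:N}X^{1:N}Y^{1:N}\widehat S^{1:N}}(s,x,y,\hat s)-P_{SXY\widehat S}(s,x,y,\hat s)\big|>\varepsilon\Big\}\longrightarrow 0,$$ where $T$ is the empirical distribution, $S^{1:N}$ is i.i.d. $P_S$, and $X^{1:N}$ and $\widehat S^{1:N}$ are the outputs of encoder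 and decoder. Moreover, for every $\varepsilon>0$ the same limit holds for deterministic codes $X^{1:N}=f(S^{1:N},C)$, $\widehat S^{1:N}=g(Y^{1:N},C)$ all of whose values are possible outputs of the scheme's encoder and decoder. Scheme. Let $G_n=\begin{bmatrix}1&0\\1&1\end{bmatrix}^{\otimes m}$ over $\mathbb F_2$, $V^{1:n}=U^{1:n}G_n$ for the i.i.d. law, $\delta_n=2^{-n^\beta}$, $\mathcal V_{V|S}=\{j:H(V^j|V^{1:j-1}S^{1:n})>1-\delta_n\}$, $\mathcal H_{V|Y}=\{j:H(V^j|V^{1:j-1}Y^{1:n})>\delta_n\}$, $A_1=\mathcal V_{V|S}\cap\mathcal H_{V|Y}$, $A_2=\mathcal V_{V|S}\cap\mathcal H_{V|Y}^c$, $A_3=\mathcal V_{V|S}^c\cap\mathcal H_{V|Y}$, $A_4=\mathcal V_{V|S}^c\cap\mathcal H_{V|Y}^c$. There are $k$ chained blocks and one extra block of length $n'=2^{m'}$. The set $A_3$ is partitioned into $R,E,D$. Encoder. In each chained block, Node 1 produces $\widetilde V^1,\widetilde V^2,\dots$ successively: on $A_1$ the shared uniform bits $C_1$ (the same in all blocks);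 on a set $A_3'\subset A_2$ in bijection with $R$, from the second block on, the bits of $R$ of the previous block, one-time padded with shared key bits (keys may be reused between blocks); on the other positions of $A_2$ local fair bits; on $D$ bits drawn from $P_{V^j|V^{1:j-1}}$, up to quantization, by means of shared uniform seeds that both nodes use; on the remaining positions bits drawn from $P_{V^j|V^{1:j-1}S^{1:n}}$. It then draws $X$ letter by letter from $P_{X|US}$ with $\widetilde U^{1:n}=\widetilde V^{1:n}G_n$. The extra block carries the padded bits of $R$ of the last block and of $E$ of all blocks by a Honda–Yamamoto polar code for a binary input $B$ with a letterwise law $P_{X|B}$: with $Z^{1:n'}=B^{1:n'}G_{n'}$, the message lies in $\mathcal V_Z\cap\mathcal H_{Z|Y}^c$, the rest of $\mathcal V_Z$ is filled with shared uniform bits, and the bits outside $\mathcal V_Z$ are drawn from $P_{Z^j|Z^{1:j-1}}$, up to quantization, by means of shared uniform seeds. Decoder. Node 2 decodes the extra block and then the chained blocks backwards by successive cancellation with maximum-likelihood decisions (for block bits, with respect to $P_{V^j|V^{1:j-1}Y^{1:n}}$); the bits on $A_1$ and $D$ are computed from the common randomness, those on $R$ are read, unpadded, in the next block (for the last block, in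 the extra block), and those on $E$ in the extra block. It then draws $\widehat S$ letter by letter from $P_{\widehat S|UY}$, and outputs a fixed letter during the extra block. If $I(U;S)<I(U;Y)$, one has $R=A_3$, $E=D=\emptyset$ and $n'=n$ for all large $m$; in every case $|E\cup D|/n\to0$. -/

import Mathlib

noncomputable section

namespace PolarCoord

open scoped Classical Kronecker

/-! ### Finite probability: events, conditional entropy, mutual information -/

section Information

variable {Ω α β : Type*} [Fintype Ω]

/-- Probability of the event `E` under the weights `μ`. -/
def prob (μ : Ω → ℝ) (E : Ω → Prop) : ℝ := ∑ ω with E ω, μ ω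

/-- Conditional Shannon entropy `H(A | B)` in bits. -/
def condEntropy (μ : Ω → ℝ) (A : Ω → α) (B : Ω → β) : ℝ :=
  ∑ ω, μ ω * Real.logb 2
    (prob μ (fun ω' => B ω' = B ω) / prob μ (fun ω' => A ω' = A ω ∧ B ω' = B ω))

/-- Mutual information `I(A ; B)` in bits. -/
def mutualInfo (μ : Ω → ℝ) (A : Ω → α) (B : Ω → β) : ℝ :=
  ∑ ω, μ ω * Real.logb 2
    (prob μ (fun ω' => A ω' = A ω ∧ B ω' = B ω) /
      (prob μ (fun ω' => A ω' = A ω) * prob μ (fun ω' => B ω' = B ω)))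

end Information

/-- Variational distance (the `ℓ¹` distance) of two weights on a finite set. -/
def varDist {α : Type*} [Fintype α] (P Q : α → ℝ) : ℝ := ∑ a, |P a - Q a|

/-- Empirical distribution (type) of a finite family of letters. -/
def empirical {ι α : Type*} [Fintype ι] (w : ι → α) (a : α) : ℝ :=
  (Finset.univ.filter (fun i => w i = a)).card / (Fintype.card ι : ℝ)

/-! ### Codes for the two-node network

The set `ι` indexes the channel uses, `C` is the set of values of the common randomness. -/

section Codes

variable {ι C S X Y T : Type*} [Fintype ι] [Fintype C] [Fintype S] [Fintype X] [Fintype Y]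
  [Fintype T]

/-- `P { 𝕍(T_{S X Y Ŝ}, P) > ε }` when the common randomness is uniform on `C`, the source is
i.i.d. `PS`, the encoder emits `x` with probability `enc s c x`, the channel is memoryless with
transition probabilities `W`, and the decoder emits `t` with probability `dec y c t`. -/
def failProb (PS : S → ℝ) (W : X → Y → ℝ) (P : S × X × Y × T → ℝ) (ε : ℝ)
    (enc : (ι → S) → C → (ι → X) → ℝ) (dec : (ι → Y) → C → (ι → T) → ℝ) : ℝ :=
  (∑ c : C, ∑ s : ι → S, ∑ x : ι → X, ∑ y : ι → Y, ∑ t : ι → T,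
    (∏ i, PS (s i)) * enc s c x * (∏ i, W (x i) (y i)) * dec y c t *
      (if ε < varDist (empirical fun i => (s i, x i, y i, t i)) P then 1 else 0)) /
    (Fintype.card C : ℝ)

/-- A deterministic map, as a transition probability. -/
def detKernel {A B : Type*} (f : A → C → B) (a : A) (c : C) (b : B) : ℝ :=
  if b = f a c then 1 else 0

end Codes

/-! ### The joint law of source, binary auxiliary variable, channel and reconstruction -/

/-- The factors of `P_S P_{U|S} P_{X|US} P_{Y|X} P_{Ŝ|UY}` with `U` binary. -/
structure AuxLaw (S X Y T : Type*) [Fintype S] [Fintype X] [Fintype Y] [Fintype T] where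
  /-- the source `P_S` -/
  PS : S → ℝ
  /-- `P_{U|S}` -/
  PU : S → ZMod 2 → ℝ
  /-- `P_{X|US}` -/
  PX : ZMod 2 → S → X → ℝ
  /-- the channel `P_{Y|X}` -/
  W : X → Y → ℝ
  /-- `P_{Ŝ|UY}` -/
  PT : ZMod 2 → Y → T → ℝ
  PS_mem : PS ∈ stdSimplex ℝ S
  PU_mem : ∀ s, PU s ∈ stdSimplex ℝ (ZMod 2)
  PX_mem : ∀ u s, PX u s ∈ stdSimplex ℝ X
  W_mem : ∀ x, W x ∈ stdSimplex ℝ Y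
  PT_mem : ∀ u y, PT u y ∈ stdSimplex ℝ T

namespace AuxLaw

variable {S X Y T : Type*} [Fintype S] [Fintype X] [Fintype Y] [Fintype T] (L : AuxLaw S X Y T)

/-- Joint law of `(S, U, X, Y, Ŝ)`. -/
def joint (a : S × ZMod 2 × X × Y × T) : ℝ :=
  L.PS a.1 * L.PU a.1 a.2.1 * L.PX a.2.1 a.1 a.2.2.1 * L.W a.2.2.1 a.2.2.2.1 *
    L.PT a.2.1 a.2.2.2.1 a.2.2.2.2

/-- The target distribution `P_{S X Y Ŝ}`. -/
def target (a : S × X × Y × T) : ℝ := ∑ u, L.joint (a.1, u, a.2)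

/-- `I(U ; S)` -/
def infoUS : ℝ := mutualInfo L.joint (fun a => a.2.1) (fun a => a.1)

/-- `I(U ; Y)` -/
def infoUY : ℝ := mutualInfo L.joint (fun a => a.2.1) (fun a => a.2.2.2.1)

/-- Law of `(U, S)`. -/
def lawUS (u : ZMod 2) (s : S) : ℝ := prob L.joint (fun a => a.2.1 = u ∧ a.1 = s)

/-- Law of `(U, Y)`. -/
def lawUY (u : ZMod 2) (y : Y) : ℝ := prob L.joint (fun a => a.2.1 = u ∧ a.2.2.2.1 = y)

/-- Law of `U`, with a trivial observation. -/
def lawU (u : ZMod 2) (_ : Unit) : ℝ := prob L.joint (fun a => a.2.1 = u)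

end AuxLaw

/-! ### Source polarization -/

/-- `G_n = [[1,0],[1,1]]^{⊗ m}`, `n = 2^m`, over the field with two elements. -/
def polarMatrix : (m : ℕ) → Matrix (Fin (2 ^ m)) (Fin (2 ^ m)) (ZMod 2)
  | 0 => 1
  | m + 1 => Matrix.reindex finProdFinEquiv finProdFinEquiv
      (polarMatrix m ⊗ₖ (!![1, 0; 1, 1] : Matrix (Fin 2) (Fin 2) (ZMod 2)))

/-- Binary words of length `2^m`. -/
abbrev Word (m : ℕ) : Type := Fin (2 ^ m) → ZMod 2

section Polarization

variable {O : Type*} [Fintype O]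

/-- For `(B, O)` with law `p`: the law of `(V^{1:n}, O^{1:n})`, `V^{1:n} = B^{1:n} G_n`, where
`(B, O)^{1:n}` is i.i.d.; note that `G_n` is its own inverse. -/
def polarLaw (p : ZMod 2 → O → ℝ) (m : ℕ) (w : Word m × (Fin (2 ^ m) → O)) : ℝ :=
  ∏ i, p (Matrix.vecMul w.1 (polarMatrix m) i) (w.2 i)

/-- The components of `v` strictly before position `j`. -/
def before {m : ℕ} (j : Fin (2 ^ m)) (v : Word m) : {i : Fin (2 ^ m) // i < j} → ZMod 2 :=
  fun i => v i

/-- `H(V^j | V^{1:j-1} O^{1:n})` -/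
def bitEntropy (p : ZMod 2 → O → ℝ) (m : ℕ) (j : Fin (2 ^ m)) : ℝ :=
  condEntropy (polarLaw p m) (fun w => w.1 j) (fun w => (before j w.1, w.2))

/-- `P(V^j = b | V^{1:j-1} = v^{1:j-1}, O^{1:n} = o)`; a fair bit when the condition has
probability zero. It depends on `v` only through the components before `j`. -/
def condBit (p : ZMod 2 → O → ℝ) (m : ℕ) (j : Fin (2 ^ m)) (b : ZMod 2) (v : Word m)
    (o : Fin (2 ^ m) → O) : ℝ :=
  if prob (polarLaw p m) (fun w => before j w.1 = before j v ∧ w.2 = o) = 0 then 1 / 2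
  else prob (polarLaw p m) (fun w => w.1 j = b ∧ before j w.1 = before j v ∧ w.2 = o) /
    prob (polarLaw p m) (fun w => before j w.1 = before j v ∧ w.2 = o)

/-- The successive cancellation decision: `0` if the likelihood ratio is at least one. -/
def decide01 (p : ZMod 2 → O → ℝ) (m : ℕ) (j : Fin (2 ^ m)) (v : Word m)
    (o : Fin (2 ^ m) → O) : ZMod 2 :=
  if condBit p m j 1 v o ≤ condBit p m j 0 v o then 0 else 1

/-- `δ_n = 2^{-n^β}`, `n = 2^m`. -/
def threshold (β : ℝ) (m : ℕ) : ℝ := (2 : ℝ) ^ (-(((2 : ℝ) ^ m) ^ β))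

/-- The very high entropy set `𝒱 = {j : H(V^j | V^{1:j-1} O^{1:n}) > 1 - δ_n}`. -/
def veryHigh (p : ZMod 2 → O → ℝ) (β : ℝ) (m : ℕ) : Finset (Fin (2 ^ m)) :=
  Finset.univ.filter fun j => 1 - threshold β m < bitEntropy p m j

/-- The high entropy set `ℋ = {j : H(V^j | V^{1:j-1} O^{1:n}) > δ_n}`. -/
def high (p : ZMod 2 → O → ℝ) (β : ℝ) (m : ℕ) : Finset (Fin (2 ^ m)) :=
  Finset.univ.filter fun j => threshold β m < bitEntropy p m j

end Polarization

/-- The word produced successively by `v^j = rule j v^{1:j-1}` (zeros are passed in the positions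
from `j` on). -/
def seqFill {n : ℕ} (rule : Fin n → (Fin n → ZMod 2) → ZMod 2) (j : Fin n) : ZMod 2 :=
  rule j fun i => if _h : i < j then seqFill rule i else 0
termination_by j.val
decreasing_by exact _h

/-- A bit equal to `1` with probability `p1` up to an error below `2^{-b}`, computed from a shared
uniform seed of `b` bits. -/
def seedBit (b : ℕ) (ρ : Fin (2 ^ b)) (p1 : ℝ) : ZMod 2 :=
  if ((ρ : ℕ) : ℝ) / 2 ^ b < p1 then 1 else 0

/-! ### The polar coding scheme -/

section Scheme

variable {S X Y T : Type*} [Fintype S] [Fintype X] [Fintype Y] [Fintype T]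

namespace AuxLaw

variable (L : AuxLaw S X Y T) (β : ℝ) (m : ℕ)

/-- `A₁ = 𝒱_{V|S} ∩ ℋ_{V|Y}` -/
def A1 : Finset (Fin (2 ^ m)) := veryHigh L.lawUS β m ∩ high L.lawUY β m

/-- `A₂ = 𝒱_{V|S} ∩ ℋ_{V|Y}ᶜ` -/
def A2 : Finset (Fin (2 ^ m)) := veryHigh L.lawUS β m \ high L.lawUY β m

/-- `A₃ = 𝒱_{V|S}ᶜ ∩ ℋ_{V|Y}`; the remaining positions form `A₄`. -/
def A3 : Finset (Fin (2 ^ m)) := high L.lawUY β m \ veryHigh L.lawUS β m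

end AuxLaw

/-- The choices left open by the scheme with chained blocks of length `n = 2^m`.

The bits in `A₃`, which the decoder cannot infer from its observation, are split in three parts:
`R` is relayed through the next block, `E` is sent in the extra block, and `D` is drawn by both
nodes from shared seeds. The chaining construction proper is `R = A₃`, `E = D = ∅`. -/
structure Choice (L : AuxLaw S X Y T) (β : ℝ) (m : ℕ) where
  /-- number of chained blocks -/
  k : ℕ
  k_pos : 0 < k
  /-- the extra block has length `2^mx` -/
  mx : ℕ
  /-- number of key bits for one-time pads -/
  q : ℕ
  /-- number of bits of a shared seed -/
  b : ℕ
  /-- bits of a block that are relayed by the next block -/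
  R : Finset (Fin (2 ^ m))
  /-- bits that are sent in the extra block for every chained block -/
  E : Finset (Fin (2 ^ m))
  /-- bits that both nodes draw from shared seeds -/
  D : Finset (Fin (2 ^ m))
  cover : R ∪ E ∪ D = L.A3 β m
  disjoint_RE : Disjoint R E
  disjoint_RD : Disjoint R D
  disjoint_ED : Disjoint E D
  /-- position, in the next block, of a relayed bit: the image of `R` is `A₃'` -/
  τ : Fin (2 ^ m) → Fin (2 ^ m)
  τ_maps : ∀ j ∈ R, τ j ∈ L.A2 β m
  τ_inj : Set.InjOn τ R
  /-- which key bit pads bit `j` of block `i` when it is relayed; keys may be reused -/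
  padR : Fin k → Fin (2 ^ m) → Fin q
  /-- which key bit pads bit `j` of block `i` when it is sent in the extra block -/
  padX : Fin k × Fin (2 ^ m) → Fin q
  /-- law of the binary input `B` of the channel code of the extra block -/
  QB : ZMod 2 → ℝ
  QB_mem : QB ∈ stdSimplex ℝ (ZMod 2)
  /-- the channel input `X` of the extra block is obtained letter by letter from `B`; when `X` is
  binary one can take `B = X` -/
  QX : ZMod 2 → X → ℝ
  QX_mem : ∀ u, QX u ∈ stdSimplex ℝ X
  /-- position of a message bit in the extra block -/
  place : Fin k × Fin (2 ^ m) → Fin (2 ^ mx)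
  /-- the message (all unrelayed bits: `R` of the last block, `E` of every block) is placed
  injectively in `𝒱_B ∩ ℋ_{B|Y}ᶜ` -/
  place_maps : ∀ i j, (j ∈ E ∨ (i.val + 1 = k ∧ j ∈ R)) →
    place (i, j) ∈ veryHigh (fun u (_ : Unit) => QB u) β mx \
      high (fun u y => QB u * ∑ x, QX u x * L.W x y) β mx
  place_inj : Set.InjOn place {p | p.2 ∈ E ∨ (p.1.val + 1 = k ∧ p.2 ∈ R)}
  /-- idle output of Node 2 during the extra block -/
  idle : T

namespace Choice

variable {L : AuxLaw S X Y T} {β : ℝ} {m : ℕ} (κ : Choice L β m)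

/-- The channel uses: `k` blocks of length `2^m` and one extra block. -/
abbrev Use : Type := (Fin κ.k × Fin (2 ^ m)) ⊕ Fin (2 ^ κ.mx)

/-- The chained blocks of a sequence. -/
def blocks {A : Type*} (w : κ.Use → A) (i : Fin κ.k) (j : Fin (2 ^ m)) : A := w (.inl (i, j))

/-- The extra block of a sequence. -/
def extra {A : Type*} (w : κ.Use → A) (t : Fin (2 ^ κ.mx)) : A := w (.inr t)

/-- The input law of the channel code. -/
def lawB (u : ZMod 2) (_ : Unit) : ℝ := κ.QB u

/-- The law of input and output of the channel code. -/
def lawBY (u : ZMod 2) (y : Y) : ℝ := κ.QB u * ∑ x, κ.QX u x * L.W x y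

/-- The bits, as pairs (block, position), that are sent in the extra block. -/
def msg : Finset (Fin κ.k × Fin (2 ^ m)) :=
  Finset.univ.filter fun p => p.2 ∈ κ.E ∨ (p.1.val + 1 = κ.k ∧ p.2 ∈ κ.R)

/-- The positions of the extra block that carry message bits. -/
def slots : Finset (Fin (2 ^ κ.mx)) := κ.msg.image κ.place

/-- The frozen positions of the extra block. -/
def frozen : Finset (Fin (2 ^ κ.mx)) := veryHigh κ.lawB β κ.mx \ κ.slots

/-- The positions of the extra block whose bits are drawn from shared seeds. -/
def drawn : Finset (Fin (2 ^ κ.mx)) := (veryHigh κ.lawB β κ.mx)ᶜ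

/-- The common randomness `𝒞`: the bits `C₁` in the positions `A₁` (reused in all blocks), the keys
of the one-time pads, the seeds for `D` (reused in all blocks), and the frozen bits and the seeds of
the channel code of the extra block. -/
abbrev Common : Type :=
  (L.A1 β m → ZMod 2) × (Fin κ.q → ZMod 2) × (κ.D → Fin (2 ^ κ.b)) ×
    (κ.frozen → ZMod 2) × (κ.drawn → Fin (2 ^ κ.b))

variable (c : κ.Common)

/-- The rule, known to both nodes, for a bit in `D`. -/
def sharedBit (j : Fin (2 ^ m)) (h : j ∈ κ.D) (v : Word m) : ZMod 2 :=
  seedBit κ.b (c.2.2.1 ⟨j, h⟩) (condBit L.lawU m j 1 v fun _ => ())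

/-- The polar code of the extra block, as used by both nodes: frozen bits are shared, the bits
outside `𝒱_B` follow shared random maps of the previous bits, and the message slots are filled
by `f`. -/
def channelWord (f : Fin (2 ^ κ.mx) → Word κ.mx → ZMod 2) : Word κ.mx :=
  seqFill fun t past =>
    if t ∈ κ.slots then f t past
    else if h : t ∈ κ.frozen then c.2.2.2.1 ⟨t, h⟩
    else if h : t ∈ κ.drawn then
      seedBit κ.b (c.2.2.2.2 ⟨t, h⟩) (condBit κ.lawB κ.mx t 1 past fun _ => ())
    else 0

/-! #### Encoder -/

/-- Probability with which the encoder selects the bit `v i j`, given the earlier bits. -/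
def encStep (s : Fin κ.k → Fin (2 ^ m) → S) (v : Fin κ.k → Word m) (i : Fin κ.k)
    (j : Fin (2 ^ m)) : ℝ :=
  if h : j ∈ L.A1 β m then (if v i j = c.1 ⟨j, h⟩ then 1 else 0)
  else if j ∈ L.A2 β m then
    if 0 < i.val ∧ j ∈ κ.R.image κ.τ then
      let i' : Fin κ.k := ⟨i.val - 1, lt_of_le_of_lt (Nat.sub_le _ _) i.isLt⟩
      -- the sum has exactly one term
      if v i j = ∑ l ∈ κ.R with κ.τ l = j, (v i' l + c.2.1 (κ.padR i' l)) then 1 else 0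
    else 1 / 2
  else if h : j ∈ κ.D then (if v i j = κ.sharedBit c j h (v i) then 1 else 0)
  else condBit L.lawUS m j (v i j) (v i) (s i)

/-- The polarized word of the extra block: the message bits, padded, in their slots. -/
def encExtra (v : Fin κ.k → Word m) : Word κ.mx :=
  κ.channelWord c fun t _ =>
    -- the sum has exactly one term
    ∑ p ∈ κ.msg with κ.place p = t, (v p.1 p.2 + c.2.1 (κ.padX p))

/-- The encoder: the probability of the channel input `x` given the source `s` and `c`. -/
def enc (s : κ.Use → S) (c : κ.Common) (x : κ.Use → X) : ℝ :=
  ∑ v : Fin κ.k → Word m,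
    (∏ i, ∏ j, κ.encStep c (κ.blocks s) v i j) *
    (∏ i, ∏ j, L.PX (Matrix.vecMul (v i) (polarMatrix m) j) (κ.blocks s i j) (κ.blocks x i j)) *
    (∏ t, κ.QX (Matrix.vecMul (κ.encExtra c v) (polarMatrix κ.mx) t) (κ.extra x t))

/-! #### Decoder -/

/-- Successive cancellation decoding of the extra block. -/
def decExtra (y : κ.Use → Y) : Word κ.mx :=
  κ.channelWord c fun t past => decide01 κ.lawBY κ.mx t past (κ.extra y)

/-- The estimate of a message bit obtained from the extra block. -/
def decMsg (y : κ.Use → Y) (p : Fin κ.k × Fin (2 ^ m)) : ZMod 2 :=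
  κ.decExtra c y (κ.place p) + c.2.1 (κ.padX p)

/-- Successive cancellation decoding of a chained block with output `y`, given the bits `a` in the
positions `R ∪ E`. -/
def decBlock (y : Fin (2 ^ m) → Y) (a : Word m) : Word m :=
  seqFill fun j past =>
    if h : j ∈ L.A1 β m then c.1 ⟨j, h⟩
    else if h : j ∈ κ.D then κ.sharedBit c j h past
    else if j ∈ L.A3 β m then a j
    else decide01 L.lawUY m j past y

/-- The decoder works backwards: the relayed bits of a block are read in the next block, those of
the last block in the extra block. -/
def decChain (y : κ.Use → Y) (i : Fin κ.k) : Word m :=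
  κ.decBlock c (κ.blocks y i) fun j =>
    if j ∈ κ.R then
      if h : i.val + 1 < κ.k then decChain y ⟨i.val + 1, h⟩ (κ.τ j) + c.2.1 (κ.padR i j)
      else κ.decMsg c y (i, j)
    else κ.decMsg c y (i, j)
termination_by κ.k - i.val

/-- The decoder: the probability of the action sequence `t` given `y` and `c`. -/
def dec (y : κ.Use → Y) (c : κ.Common) (t : κ.Use → T) : ℝ :=
  (∏ i, ∏ j, L.PT (Matrix.vecMul (κ.decChain c y i) (polarMatrix m) j) (κ.blocks y i j)
    (κ.blocks t i j)) *
  (if ∀ l, κ.extra t l = κ.idle then 1 else 0)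

/-- Rate of common randomness: `log₂ |𝒞|` over the number of channel uses. -/
def commonRate : ℝ := Real.logb 2 (Fintype.card κ.Common) / (Fintype.card κ.Use : ℝ)

end Choice

end Scheme

end PolarCoord

end

namespace PolarCoord
open scoped Classical
open Real

/-! ### The binary entropy term -/

/-! Polarization. Let x, y be the joint probabilities of an observation with the two values of a
bit. Two parameters of a bit channel are followed along the recursion: Z = Σ 2√(xy), with H ≤ 2Z,
and T = Σ |x − y|, with 1 − H ≤ T. One transform squares T and at most replaces Z by 2Z − Z²; the
other exchanges the roles; and Z² + T² ≤ 1. Hence the mean of √(ZT) over the nodes of a level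
contracts by 24/25 per level, so that one parameter becomes small at most nodes, and further
squarings make it tiny (`PolarTree.count_le`). Since the transform also preserves entropy
(`IsBitLaw.sum_bitEntropy`), both 𝒱 and ℋ have about n H(B|O) elements. Consequently |A₃| − |A₂| is
at most n (I(U;S) − I(U;Y)) up to o(n) (`AuxLaw.card_A3_le`), which is why A₂ can carry the bits of
A₃.

One block. Replacing a bit of 𝒱 by a fair one costs at most 2√δ_n in variational distance
(`IsBitLaw.sum_abs_sub_polarLaw_le`), so a generated block nearly has the i.i.d. law and its type is
near the target by the law of large numbers. Decisions outside ℋ fail with total probability at most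
n δ_n, and without such failures the backward decoder recovers every word (`Choice.decChain_eq`).

The chain. Blocks are dependent, and their randomness is reused to make its rate vanish. But the
type of a concatenation is a mixture of the types of its blocks and error probabilities add up, so
only the law of each single block matters. The bits C₁ and the seeds can be held fixed and averaged
at the end. The pads need care, since the state of the chain depends on keys already used: with p
cyclic keys and p fresh ones for p(p + 1) blocks, a fresh key resets the chain after each round and
every round repeats the first (`expect_stateLaw`). Thus each block has the ideal law on average.

The cases I(U;S) < I(U;Y), both informations zero, and equality with positive information require
different splits of A₃ (`exists_choice_seq`). Deterministic codes are obtained because the failure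
probability is linear in the encoder and in the decoder. -/

lemma negMulLog_le_sqrt {p : ℝ} (hp : 0 ≤ p) : negMulLog p ≤ 2 * (√p - p) := by
  rcases hp.eq_or_lt with rfl | hp
  · simp
  have hs : 0 < √p := Real.sqrt_pos.2 hp
  -- Multiplied by 2p, the tangent inequality log t ≤ t − 1 at t = 1/√p is the claim.
  have h1 : log ((√p)⁻¹) ≤ (√p)⁻¹ - 1 := log_le_sub_one_of_pos (inv_pos.2 hs)
  rw [log_inv, log_sqrt hp.le] at h1
  have h2 : p * (√p)⁻¹ = √p := by
    nth_rewrite 1 [← Real.mul_self_sqrt hp.le]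
    field_simp
  rw [negMulLog]
  nlinarith

/-- The bounds for p and 1 − p add up to 2(√p + √(1 − p) − 1), and (1 − √p)(1 − √(1 − p)) ≥ 0 turns
this into the geometric mean. -/
lemma binEntropy_le_two_sqrt {p : ℝ} (h0 : 0 ≤ p) (h1 : p ≤ 1) :
    binEntropy p ≤ 2 * (√p * √(1 - p)) := by
  rw [binEntropy_eq_negMulLog_add_negMulLog_one_sub]
  have h2 := negMulLog_le_sqrt h0
  have h3 := negMulLog_le_sqrt (sub_nonneg.2 h1)
  have h4 : √p ≤ 1 := Real.sqrt_le_one.2 h1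
  have h5 : √(1 - p) ≤ 1 := Real.sqrt_le_one.2 (by linarith)
  nlinarith [mul_nonneg (sub_nonneg.2 h4) (sub_nonneg.2 h5)]

/-- A concave function lies above its chord from 0 to 1/2. -/
lemma mul_log_two_le_binEntropy {p : ℝ} (h0 : 0 ≤ p) (h1 : p ≤ 1 / 2) :
    2 * p * log 2 ≤ binEntropy p := by
  have h := strictConcave_binEntropy.concaveOn.2
    (show (2⁻¹ : ℝ) ∈ Set.Icc 0 1 by constructor <;> norm_num)
    (show (0 : ℝ) ∈ Set.Icc 0 1 by simp) (show 0 ≤ 2 * p by linarith)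
    (show 0 ≤ 1 - 2 * p by linarith) (by ring)
  simp only [smul_eq_mul, mul_zero, add_zero, binEntropy_zero, binEntropy_two_inv] at h
  rwa [show 2 * p * 2⁻¹ = p by ring] at h

/-- A Pinsker inequality with a weaker constant: the divergence from the fair bit dominates 2 −
√2(√p + √(1 − p)), a squared Hellinger distance, which dominates the squared bias. -/
lemma sq_le_log_two_sub_binEntropy {p : ℝ} (h0 : 0 ≤ p) (h1 : p ≤ 1) :
    (1 - 2 * p) ^ 2 / 4 ≤ log 2 - binEntropy p := by
  have key : ∀ q : ℝ, 0 ≤ q → 2 * q - √2 * √q ≤ q * log 2 - negMulLog q := by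
    intro q hq
    rcases hq.eq_or_lt with rfl | hq
    · simp
    have h2q : 0 < 2 * q := by linarith
    have hs : 0 < √(2 * q) := Real.sqrt_pos.2 h2q
    have h1 : log ((√(2 * q))⁻¹) ≤ (√(2 * q))⁻¹ - 1 := log_le_sub_one_of_pos (inv_pos.2 hs)
    rw [log_inv, log_sqrt h2q.le, log_mul two_ne_zero hq.ne'] at h1
    have h2 : 2 * q * (√(2 * q))⁻¹ = √(2 * q) := by
      nth_rewrite 1 [← Real.mul_self_sqrt h2q.le]
      field_simp
    rw [negMulLog, ← Real.sqrt_mul two_pos.le]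
    nlinarith
  have ha := key p h0
  have hb := key (1 - p) (sub_nonneg.2 h1)
  rw [binEntropy_eq_negMulLog_add_negMulLog_one_sub]
  have hab : 0 ≤ √p * √(1 - p) := by positivity
  have hpa := Real.sq_sqrt h0
  have hpb := Real.sq_sqrt (sub_nonneg.2 h1)
  -- With w = √(p(1 − p)), the square of the left side is 2 + 4w and (1 − 2p)² = 1 − 4w², so a
  -- polynomial inequality in w remains.
  have h2 : √2 * (√p + √(1 - p)) ≤ 2 - (1 - 2 * p) ^ 2 / 4 := by
    refine (sq_le_sq₀ (by positivity) (by nlinarith)).1 ?_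
    have h2 := Real.sq_sqrt (zero_le_two (α := ℝ))
    have e : (√2 * (√p + √(1 - p))) ^ 2 = 2 + 4 * (√p * √(1 - p)) := by
      rw [mul_pow, h2]; nlinarith
    rw [e]
    have e2 : (1 - 2 * p) ^ 2 = 1 - 4 * (√p * √(1 - p)) ^ 2 := by
      rw [mul_pow, hpa, hpb]; ring
    rw [e2]
    nlinarith [sq_nonneg (1 - 2 * (√p * √(1 - p))),
      sq_nonneg ((1 - 4 * (√p * √(1 - p)) ^ 2))]
  nlinarith

/-- The contribution to `H(A | B)` (in bits) of a value of `B` that has joint probabilities `x`,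
`y` with the two values of the bit `A`. -/
noncomputable def entTerm (x y : ℝ) : ℝ := (negMulLog x + negMulLog y - negMulLog (x + y)) / log 2

lemma entTerm_zero : entTerm 0 0 = 0 := by simp [entTerm]

lemma entTerm_comm (x y : ℝ) : entTerm x y = entTerm y x := by
  simp [entTerm, add_comm]

lemma entTerm_eq {x y : ℝ} (hx : 0 ≤ x) (hy : 0 ≤ y) (hs : 0 < x + y) :
    entTerm x y = (x + y) * binEntropy (x / (x + y)) / log 2 := by
  have h1 : 1 - x / (x + y) = y / (x + y) := by field_simp; ring
  have key : ∀ z : ℝ, 0 ≤ z → (x + y) * negMulLog (z / (x + y)) =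
      negMulLog z + z * log (x + y) := by
    intro z hz
    rcases hz.eq_or_lt with rfl | hz
    · simp
    rw [negMulLog, negMulLog, log_div hz.ne' hs.ne']
    field_simp
    ring
  rw [entTerm, binEntropy_eq_negMulLog_add_negMulLog_one_sub, h1, mul_add, key x hx, key y hy]
  congr 1
  simp only [negMulLog]
  ring

section
variable {x y : ℝ} (hx : 0 ≤ x) (hy : 0 ≤ y)
include hx hy

lemma pos_or_zero : 0 < x + y ∨ (x = 0 ∧ y = 0) := by
  rcases hx.eq_or_lt with h | h
  · rcases hy.eq_or_lt with h' | h'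
    · exact Or.inr ⟨h.symm, h'.symm⟩
    · left; linarith
  · left; linarith

lemma entTerm_nonneg : 0 ≤ entTerm x y := by
  rcases pos_or_zero hx hy with hs | ⟨rfl, rfl⟩
  · rw [entTerm_eq hx hy hs]
    have := binEntropy_nonneg (p := x / (x + y)) (by positivity)
      (by rw [div_le_one hs]; linarith)
    have := log_pos one_lt_two
    positivity
  · simp [entTerm]

/-- Summed over the observations, this bounds the entropy by twice the Bhattacharyya parameter; the
factor comes from replacing `log 2` by 1/2. -/
lemma entTerm_le : entTerm x y ≤ 4 * √(x * y) := by
  rcases pos_or_zero hx hy with hs | ⟨rfl, rfl⟩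
  · rw [entTerm_eq hx hy hs, div_le_iff₀ (log_pos one_lt_two)]
    have h1 : 1 - x / (x + y) = y / (x + y) := by field_simp; ring
    have h := binEntropy_le_two_sqrt (p := x / (x + y)) (by positivity)
      (by rw [div_le_one hs]; linarith)
    rw [h1, ← Real.sqrt_mul (by positivity), div_mul_div_comm, ← sq,
      Real.sqrt_div (by positivity), Real.sqrt_sq hs.le] at h
    have h2 : (1 : ℝ) / 2 ≤ log 2 := by linarith [log_two_gt_d9]
    calc (x + y) * binEntropy (x / (x + y)) ≤ (x + y) * (2 * (√(x * y) / (x + y))) := by gcongr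
      _ = 4 * √(x * y) * (1 / 2) := by field_simp; ring
      _ ≤ _ := by gcongr
  · simp [entTerm]

/-- The chord bound on `binEntropy`, rescaled. The minimum is what the observation contributes to
the error probability of the maximum-likelihood decision. -/
lemma min_le_entTerm : min x y ≤ entTerm x y / 2 := by
  wlog hxy : x ≤ y generalizing x y
  · rw [min_comm, entTerm_comm]; exact this hy hx (le_of_not_ge hxy)
  rcases pos_or_zero hx hy with hs | ⟨rfl, rfl⟩
  · have h2 := log_pos one_lt_two
    rw [entTerm_eq hx hy hs, min_eq_left hxy, le_div_iff₀ two_pos, le_div_iff₀ h2]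
    have h := mul_log_two_le_binEntropy (p := x / (x + y)) (by positivity)
      (by rw [div_le_iff₀ hs]; linarith)
    calc x * 2 * log 2 = (x + y) * (2 * (x / (x + y)) * log 2) := by field_simp
      _ ≤ _ := by gcongr
  · simp [entTerm]

/-- Since x + y − |x − y| = 2 min(x, y), this is the bound of the minimum again, read for the
parameter T. -/
lemma add_sub_entTerm_le : x + y - entTerm x y ≤ |x - y| := by
  have h := min_le_entTerm hx hy
  rcases le_total x y with h' | h'
  · rw [abs_sub_comm, abs_of_nonneg (sub_nonneg.2 h')]; rw [min_eq_left h'] at h; linarith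
  · rw [abs_of_nonneg (sub_nonneg.2 h')]; rw [min_eq_right h'] at h; linarith

lemma entTerm_le_add : entTerm x y ≤ x + y := by
  rcases pos_or_zero hx hy with hs | ⟨rfl, rfl⟩
  · rw [entTerm_eq hx hy hs, div_le_iff₀ (log_pos one_lt_two)]
    have := binEntropy_le_log_two (p := x / (x + y))
    gcongr
  · simp [entTerm]

/-- The quadratic bound on log 2 − h, rescaled; the factor x + y prepares a Cauchy–Schwarz
inequality over the observations. -/
lemma sq_sub_le_entTerm : (x - y) ^ 2 ≤ 4 * ((x + y) * (x + y - entTerm x y)) := by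
  rcases pos_or_zero hx hy with hs | ⟨rfl, rfl⟩
  · have h2 := log_pos one_lt_two
    have h := sq_le_log_two_sub_binEntropy (p := x / (x + y)) (by positivity)
      (by rw [div_le_one hs]; linarith)
    have e : (1 - 2 * (x / (x + y))) ^ 2 = (x - y) ^ 2 / (x + y) ^ 2 := by
      field_simp; ring
    rw [e, div_div, div_le_iff₀ (by positivity)] at h
    have h3 : log 2 - binEntropy (x / (x + y)) ≤ (log 2 - binEntropy (x / (x + y))) / log 2 := by
      rw [le_div_iff₀ h2]
      have := binEntropy_le_log_two (p := x / (x + y))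
      nlinarith [log_two_lt_d9]
    have e2 : x + y - entTerm x y = (x + y) * ((log 2 - binEntropy (x / (x + y))) / log 2) := by
      rw [entTerm_eq hx hy hs]; field_simp
    rw [e2]
    calc (x - y) ^ 2 ≤ _ := h
      _ ≤ (log 2 - binEntropy (x / (x + y))) / log 2 * ((x + y) ^ 2 * 4) := by gcongr
      _ = _ := by ring
  · simp [entTerm]

end

/-- `entTerm` is the perspective of the concave function `binEntropy`, hence superadditive. It
yields that conditioning reduces entropy. -/
lemma sum_entTerm_le {ι : Type*} (s : Finset ι) (f g : ι → ℝ) (hf : ∀ i ∈ s, 0 ≤ f i)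
    (hg : ∀ i ∈ s, 0 ≤ g i) :
    ∑ i ∈ s, entTerm (f i) (g i) ≤ entTerm (∑ i ∈ s, f i) (∑ i ∈ s, g i) := by
  induction s using Finset.induction_on with
  | empty => simp [entTerm]
  | insert a s ha ih =>
    rw [Finset.sum_insert ha, Finset.sum_insert ha, Finset.sum_insert ha]
    have ih' := ih (fun i hi => hf i (Finset.mem_insert_of_mem hi))
      (fun i hi => hg i (Finset.mem_insert_of_mem hi))
    refine (add_le_add_right ih' _).trans ?_
    have hx := hf a (Finset.mem_insert_self a s)
    have hy := hg a (Finset.mem_insert_self a s)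
    have hx' : 0 ≤ ∑ i ∈ s, f i := Finset.sum_nonneg fun i hi => hf i (Finset.mem_insert_of_mem hi)
    have hy' : 0 ≤ ∑ i ∈ s, g i := Finset.sum_nonneg fun i hi => hg i (Finset.mem_insert_of_mem hi)
    generalize f a = x at *
    generalize g a = y at *
    generalize ∑ i ∈ s, f i = x' at *
    generalize ∑ i ∈ s, g i = y' at *
    rcases pos_or_zero hx hy with hs | ⟨rfl, rfl⟩
    · rcases pos_or_zero hx' hy' with hs' | ⟨rfl, rfl⟩
      · rw [entTerm_eq hx hy hs, entTerm_eq hx' hy' hs', entTerm_eq (by positivity)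
          (by positivity) (by linarith), ← add_div]
        have h2 := log_pos one_lt_two
        have hS : 0 < x + x' + (y + y') := by linarith
        gcongr
        have h := strictConcave_binEntropy.concaveOn.2
          (show x / (x + y) ∈ Set.Icc 0 1 from
            ⟨by positivity, by rw [div_le_one hs]; linarith⟩)
          (show x' / (x' + y') ∈ Set.Icc 0 1 from
            ⟨by positivity, by rw [div_le_one hs']; linarith⟩)
          (show 0 ≤ (x + y) / (x + x' + (y + y')) by positivity)
          (show 0 ≤ (x' + y') / (x + x' + (y + y')) by positivity)
          (by rw [← add_div, div_eq_one_iff_eq hS.ne']; ring)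
        simp only [smul_eq_mul] at h
        have e : (x + y) / (x + x' + (y + y')) * (x / (x + y)) +
            (x' + y') / (x + x' + (y + y')) * (x' / (x' + y')) =
            (x + x') / (x + x' + (y + y')) := by field_simp
        rw [e] at h
        have := mul_le_mul_of_nonneg_left h hS.le
        refine le_trans (le_of_eq ?_) this
        field_simp
      · simp [entTerm]
    · simp [entTerm]

end PolarCoord

namespace PolarCoord
open scoped Classical
open Real

/-! ### Polarization of an abstract pair of processes -/

lemma sum_range_mul {M : Type*} [AddCommMonoid M] (f : ℕ → M) (n k : ℕ) :
    ∑ j ∈ Finset.range (n * k), f j =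
      ∑ a ∈ Finset.range n, ∑ r ∈ Finset.range k, f (a * k + r) := by
  induction n with
  | zero => simp
  | succ n ih => rw [add_mul, one_mul, Finset.sum_range_add, ih, Finset.sum_range_succ]

/-- Along the binary tree, `W` is at most doubled at one child of a node, and at most squared at
the other. -/
def DoubleOrSquare (W : ℕ → ℕ → ℝ) : Prop :=
  ∀ m a, (W (m + 1) (2 * a) ≤ 2 * W m a ∧ W (m + 1) (2 * a + 1) ≤ W m a ^ 2) ∨
    (W (m + 1) (2 * a + 1) ≤ 2 * W m a ∧ W (m + 1) (2 * a) ≤ W m a ^ 2)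

/-- The part t of the exponent pays for one doubling at each remaining level, and a squaring at
least doubles the reserve c. In the potential l/c the two children contribute 1/c and 1/(2c), hence
the growth 3/2 per level, against 2 for the number of nodes. -/
lemma DoubleOrSquare.count_le {W : ℕ → ℕ → ℝ} (hW : DoubleOrSquare W) (h0 : ∀ m a, 0 ≤ W m a)
    {l : ℝ} (hl : 0 < l) (t : ℕ) : ∀ (m a : ℕ) (c : ℝ), 0 < c → W m a ≤ 2 ^ (-(t + c)) →
      ∑ r ∈ Finset.range (2 ^ t), (if (2 : ℝ) ^ (-l) < W (m + t) (a * 2 ^ t + r) then (1 : ℝ) else 0)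
        ≤ l * (3 / 2) ^ t / c := by
  induction t with
  | zero =>
    intro m a c hc h
    simp only [pow_zero, Finset.range_one, Finset.sum_singleton, mul_one, add_zero]
    -- At depth zero a bad node has c < l, so l / c ≥ 1 counts it.
    split_ifs with hlt
    · have h1 := hlt.trans_le h
      rw [Real.rpow_lt_rpow_left_iff one_lt_two] at h1
      rw [one_le_div hc]
      push_cast at h1
      linarith
    · positivity
  | succ t ih =>
    intro m a c hc h
    have split : ∑ r ∈ Finset.range (2 ^ (t + 1)),
        (if (2 : ℝ) ^ (-l) < W (m + (t + 1)) (a * 2 ^ (t + 1) + r) then (1 : ℝ) else 0) =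
        ∑ r ∈ Finset.range (2 ^ t),
          (if (2 : ℝ) ^ (-l) < W (m + 1 + t) ((2 * a) * 2 ^ t + r) then (1 : ℝ) else 0) +
        ∑ r ∈ Finset.range (2 ^ t),
          (if (2 : ℝ) ^ (-l) < W (m + 1 + t) ((2 * a + 1) * 2 ^ t + r) then (1 : ℝ) else 0) := by
      rw [pow_succ, mul_two, Finset.sum_range_add]
      congr 1 <;> refine Finset.sum_congr rfl fun r _ => ?_ <;>
        rw [show m + (t + 1) = m + 1 + t by ring]
      · rw [show a * (2 ^ t + 2 ^ t) + r = 2 * a * 2 ^ t + r by ring]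
      · rw [show a * (2 ^ t + 2 ^ t) + (2 ^ t + r) = (2 * a + 1) * 2 ^ t + r by ring]
    have hdouble : 2 * W m a ≤ 2 ^ (-(t + c)) := by
      calc 2 * W m a ≤ 2 * 2 ^ (-((t + 1 : ℕ) + c)) := by gcongr
        _ = 2 ^ (1 + -((t + 1 : ℕ) + c)) := by rw [Real.rpow_add two_pos, Real.rpow_one]
        _ = _ := by congr 1; push_cast; ring
    have hsquare : W m a ^ 2 ≤ 2 ^ (-(t + 2 * c)) := by
      calc W m a ^ 2 ≤ (2 ^ (-((t + 1 : ℕ) + c))) ^ 2 := by gcongr; exact h0 m a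
        _ = 2 ^ (-((t + 1 : ℕ) + c) * (2 : ℕ)) := by rw [Real.rpow_mul_natCast two_pos.le]
        _ ≤ _ := by
          apply Real.rpow_le_rpow_of_exponent_le one_le_two
          push_cast
          have : (0 : ℝ) ≤ t := t.cast_nonneg
          linarith
    have e : l * (3 / 2) ^ t / c + l * (3 / 2) ^ t / (2 * c) = l * (3 / 2) ^ (t + 1) / c := by
      field_simp; ring
    rw [split, ← e]
    rcases hW m a with ⟨hd, hs⟩ | ⟨hd, hs⟩
    · exact add_le_add (ih _ _ c hc (hd.trans hdouble))
        (ih _ _ (2 * c) (by linarith) (hs.trans hsquare))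
    · rw [add_comm]
      exact add_le_add (ih _ _ c hc (hd.trans hdouble))
        (ih _ _ (2 * c) (by linarith) (hs.trans hsquare))

/-- The evolution of the Bhattacharyya parameter `Z` and of the variational parameter `T` along
the polarization tree. -/
structure PolarTree (Z T : ℕ → ℕ → ℝ) : Prop where
  Z_nonneg : ∀ m a, 0 ≤ Z m a
  T_nonneg : ∀ m a, 0 ≤ T m a
  sq_add_sq : ∀ m a, Z m a ^ 2 + T m a ^ 2 ≤ 1
  Z_minus : ∀ m a, Z (m + 1) (2 * a) ≤ 2 * Z m a - Z m a ^ 2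
  Z_plus : ∀ m a, Z (m + 1) (2 * a + 1) ≤ Z m a ^ 2
  T_minus : ∀ m a, T (m + 1) (2 * a) ≤ T m a ^ 2
  T_plus : ∀ m a, T (m + 1) (2 * a + 1) ≤ 2 * T m a - T m a ^ 2

/-- On the unit square the sum reaches 2 only at z = t = 1, a point that the disc excludes, as z + t
≤ √2 there. -/
lemma sqrt_add_sqrt_le {z t : ℝ} (hz : 0 ≤ z) (ht : 0 ≤ t) (h : z ^ 2 + t ^ 2 ≤ 1) :
    √(z * (2 - t)) + √(t * (2 - z)) ≤ 2 * (24 / 25) := by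
  have hz1 : z ≤ 1 := by nlinarith
  have ht1 : t ≤ 1 := by nlinarith
  have hA : 0 ≤ z * (2 - t) := mul_nonneg hz (by linarith)
  have hB : 0 ≤ t * (2 - z) := mul_nonneg ht (by linarith)
  have hsum : z + t ≤ 142 / 100 := by nlinarith [sq_nonneg (z - t)]
  have hprod : √(z * (2 - t)) * √(t * (2 - z)) ≤ 1 - ((1 - z) ^ 2 + (1 - t) ^ 2) / 2 := by
    rw [← Real.sqrt_mul hA]
    apply Real.sqrt_le_iff.2
    constructor
    · nlinarith
    · nlinarith [sq_nonneg ((1 - z) ^ 2 - (1 - t) ^ 2)]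
  refine (sq_le_sq₀ (by positivity) (by norm_num)).1 ?_
  rw [add_sq, Real.sq_sqrt hA, Real.sq_sqrt hB]
  nlinarith

namespace PolarTree

variable {Z T : ℕ → ℕ → ℝ} (h : PolarTree Z T)
include h

lemma Z_le_one (m a : ℕ) : Z m a ≤ 1 := by nlinarith [h.sq_add_sq m a, h.Z_nonneg m a]

lemma T_le_one (m a : ℕ) : T m a ≤ 1 := by nlinarith [h.sq_add_sq m a, h.T_nonneg m a]

lemma Z_doubleOrSquare : DoubleOrSquare Z := fun m a =>
  Or.inl ⟨(h.Z_minus m a).trans (by nlinarith), h.Z_plus m a⟩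

lemma T_doubleOrSquare : DoubleOrSquare T := fun m a =>
  Or.inr ⟨(h.T_plus m a).trans (by nlinarith), h.T_minus m a⟩

/-- The product ZT becomes at most ZT · T(2 − Z) at one child and ZT · Z(2 − T) at the other, so
`sqrt_add_sqrt_le` contracts the mean of √(ZT). -/
lemma sum_sqrt_le (m : ℕ) :
    ∑ a ∈ Finset.range (2 ^ m), √(Z m a * T m a) ≤ (2 * (24 / 25)) ^ m := by
  induction m with
  | zero =>
    simp only [pow_zero, Finset.range_one, Finset.sum_singleton]
    exact Real.sqrt_le_one.2 (mul_le_one₀ (h.Z_le_one _ _) (h.T_nonneg _ _) (h.T_le_one _ _))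
  | succ m ih =>
    rw [pow_succ 2 m, sum_range_mul]
    calc _ ≤ ∑ a ∈ Finset.range (2 ^ m), (2 * (24 / 25)) * √(Z m a * T m a) := by
          refine Finset.sum_le_sum fun a _ => ?_
          have hz := h.Z_nonneg m a
          have ht := h.T_nonneg m a
          have h1 : √(Z (m + 1) (2 * a) * T (m + 1) (2 * a)) ≤
              √(Z m a * T m a) * √(T m a * (2 - Z m a)) := by
            rw [← Real.sqrt_mul (mul_nonneg hz ht)]
            apply Real.sqrt_le_sqrt
            calc _ ≤ (2 * Z m a - Z m a ^ 2) * T m a ^ 2 :=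
                  mul_le_mul (h.Z_minus m a) (h.T_minus m a) (h.T_nonneg _ _)
                    ((h.Z_nonneg _ _).trans (h.Z_minus m a))
              _ = _ := by ring
          have h2 : √(Z (m + 1) (2 * a + 1) * T (m + 1) (2 * a + 1)) ≤
              √(Z m a * T m a) * √(Z m a * (2 - T m a)) := by
            rw [← Real.sqrt_mul (mul_nonneg hz ht)]
            apply Real.sqrt_le_sqrt
            calc _ ≤ Z m a ^ 2 * (2 * T m a - T m a ^ 2) :=
                  mul_le_mul (h.Z_plus m a) (h.T_plus m a) (h.T_nonneg _ _) (by positivity)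
              _ = _ := by ring
          have h3 := mul_le_mul_of_nonneg_left
            (sqrt_add_sqrt_le hz ht (h.sq_add_sq m a)) (Real.sqrt_nonneg (Z m a * T m a))
          simp only [Finset.sum_range_succ, Finset.range_zero, Finset.sum_empty, zero_add,
            add_zero, mul_comm a 2]
          linarith
      _ ≤ _ := by
          rw [← Finset.mul_sum, pow_succ, mul_comm]
          gcongr

/-- If Z or T is at most 2^(-(t+1)) at depth m, few descendants are bad by `DoubleOrSquare.count_le`
with c = 1. Otherwise √(ZT) ≥ 2^(-(t+1)), and all 2^t descendants are charged to √(ZT). -/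
lemma count_add_le {l : ℝ} (hl : 0 < l) (m t : ℕ) :
    ∑ j ∈ Finset.range (2 ^ (m + t)),
      (if (2 : ℝ) ^ (-l) < Z (m + t) j ∧ (2 : ℝ) ^ (-l) < T (m + t) j then (1 : ℝ) else 0) ≤
      2 * (2 : ℝ) ^ t * 2 ^ t * (2 * (24 / 25)) ^ m + 2 ^ m * (l * (3 / 2) ^ t) := by
  rw [pow_add 2 m t, sum_range_mul]
  have hnode : ∀ a, ∑ r ∈ Finset.range (2 ^ t),
      (if (2 : ℝ) ^ (-l) < Z (m + t) (a * 2 ^ t + r) ∧ (2 : ℝ) ^ (-l) < T (m + t) (a * 2 ^ t + r)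
        then (1 : ℝ) else 0) ≤
      2 * (2 : ℝ) ^ t * 2 ^ t * √(Z m a * T m a) + l * (3 / 2) ^ t := by
    intro a
    have hpos : (0 : ℝ) ≤ l * (3 / 2) ^ t := by positivity
    have hx : ∀ x : ℝ, ¬ x ≤ 2 ^ (-((t : ℝ) + 1)) → (2 * (2 : ℝ) ^ t)⁻¹ ≤ x := by
      intro x hx
      refine le_trans (le_of_eq ?_) (not_le.1 hx).le
      rw [Real.rpow_neg two_pos.le, Real.rpow_add two_pos, Real.rpow_natCast, Real.rpow_one,
        mul_comm]
    by_cases hZ : Z m a ≤ 2 ^ (-((t : ℝ) + 1))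
    · have := h.Z_doubleOrSquare.count_le h.Z_nonneg hl t m a 1 one_pos hZ
      rw [div_one] at this
      refine le_trans (Finset.sum_le_sum fun r _ => ?_) (this.trans ?_)
      · split_ifs with h1 h2 h2
        · exact le_rfl
        · exact absurd h1.1 h2
        · exact zero_le_one
        · exact le_rfl
      · have : 0 ≤ 2 * (2 : ℝ) ^ t * 2 ^ t * √(Z m a * T m a) := by positivity
        linarith
    by_cases hT : T m a ≤ 2 ^ (-((t : ℝ) + 1))
    · have := h.T_doubleOrSquare.count_le h.T_nonneg hl t m a 1 one_pos hT
      rw [div_one] at this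
      refine le_trans (Finset.sum_le_sum fun r _ => ?_) (this.trans ?_)
      · split_ifs with h1 h2 h2
        · exact le_rfl
        · exact absurd h1.2 h2
        · exact zero_le_one
        · exact le_rfl
      · have : 0 ≤ 2 * (2 : ℝ) ^ t * 2 ^ t * √(Z m a * T m a) := by positivity
        linarith
    have h1 : (2 * (2 : ℝ) ^ t)⁻¹ ≤ √(Z m a * T m a) := by
      apply Real.le_sqrt_of_sq_le
      rw [sq]
      exact mul_le_mul (hx _ hZ) (hx _ hT) (by positivity) (h.Z_nonneg _ _)
    calc _ ≤ ∑ r ∈ Finset.range (2 ^ t), (1 : ℝ) :=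
          Finset.sum_le_sum fun r _ => by split_ifs <;> norm_num
      _ = 2 * (2 : ℝ) ^ t * 2 ^ t * (2 * (2 : ℝ) ^ t)⁻¹ := by simp; field_simp
      _ ≤ 2 * (2 : ℝ) ^ t * 2 ^ t * √(Z m a * T m a) := by gcongr
      _ ≤ _ := by linarith
  refine (Finset.sum_le_sum fun a _ => hnode a).trans ?_
  rw [Finset.sum_add_distrib, ← Finset.mul_sum]
  simp only [Finset.sum_const, Finset.card_range, nsmul_eq_mul, Nat.cast_pow, Nat.cast_ofNat]
  have := h.sum_sqrt_le m
  gcongr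

/-- All but an exponentially small fraction of the nodes at depth `m` are polarized. -/
theorem count_le (m : ℕ) :
    ∑ j ∈ Finset.range (2 ^ m),
      (if (2 : ℝ) ^ (-((2 : ℝ) ^ ((m : ℝ) / 100) + 1)) < Z m j ∧
          (2 : ℝ) ^ (-((2 : ℝ) ^ ((m : ℝ) / 100) + 1)) < T m j then (1 : ℝ) else 0) ≤
      6 * (93 / 100) ^ (m / 20) * 2 ^ m := by
  -- The first 19t + s levels make √(ZT) small on average, the last t make the smaller parameter
  -- tiny. The rates fit because 2(24/25)^19 and (115/100)(3/4) are below 93/100.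
  obtain ⟨t, s, hs, hm⟩ : ∃ t s, s < 20 ∧ m = 19 * t + s + t :=
    ⟨m / 20, m % 20, Nat.mod_lt _ (by norm_num), by omega⟩
  have ht : m / 20 = t := by omega
  rw [ht]
  set l : ℝ := (2 : ℝ) ^ ((m : ℝ) / 100) + 1 with hl
  have hl0 : 0 < l := by positivity
  -- As m ≤ 20t + 20, the exponent m/100 is at most 1 + t/5, and 2^(1/5) ≤ 115/100.
  have hl1 : l ≤ 4 * (115 / 100) ^ t := by
    have h1 : (2 : ℝ) ^ ((m : ℝ) / 100) ≤ 2 * (115 / 100) ^ t := by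
      calc (2 : ℝ) ^ ((m : ℝ) / 100) ≤ 2 ^ (1 + (1 / 5 : ℝ) * t) := by
            apply Real.rpow_le_rpow_of_exponent_le one_le_two
            have h2 : (m : ℝ) ≤ 20 * t + 20 := by
              have : m ≤ 20 * t + 20 := by omega
              exact_mod_cast this
            have : (0 : ℝ) ≤ t := t.cast_nonneg
            linarith
        _ = 2 * ((2 : ℝ) ^ (1 / 5 : ℝ)) ^ t := by
            rw [Real.rpow_add two_pos, Real.rpow_one, Real.rpow_mul two_pos.le, Real.rpow_natCast]
        _ ≤ _ := by
            have : (2 : ℝ) ^ (1 / 5 : ℝ) ≤ 115 / 100 := by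
              rw [one_div, Real.rpow_inv_le_iff_of_pos two_pos.le (by norm_num) (by norm_num)]
              norm_num
            gcongr
    have h2 : (1 : ℝ) ≤ (115 / 100) ^ t := one_le_pow₀ (by norm_num)
    linarith
  have hmain := h.count_add_le hl0 (19 * t + s) t
  rw [← hm] at hmain
  refine hmain.trans ?_
  have e : (2 : ℝ) ^ m = 2 ^ (19 * t + s) * 2 ^ t := by rw [← pow_add, ← hm]
  have a1 : 2 * (2 : ℝ) ^ t * 2 ^ t * (2 * (24 / 25)) ^ (19 * t + s) ≤
      2 * (93 / 100) ^ t * 2 ^ m := by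
    calc 2 * (2 : ℝ) ^ t * 2 ^ t * (2 * (24 / 25)) ^ (19 * t + s)
        = 2 * (2 * (24 / 25) ^ 19) ^ t * (24 / 25) ^ s * 2 ^ m := by
          rw [e]; simp only [pow_add, mul_pow, pow_mul]; ring
      _ ≤ 2 * (93 / 100) ^ t * 1 * 2 ^ m := by
          gcongr
          · norm_num
          · exact pow_le_one₀ (by norm_num) (by norm_num)
      _ = _ := by ring
  have a2 : (2 : ℝ) ^ (19 * t + s) * (l * (3 / 2) ^ t) ≤ 4 * (93 / 100) ^ t * 2 ^ m := by
    calc (2 : ℝ) ^ (19 * t + s) * (l * (3 / 2) ^ t)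
        ≤ (2 : ℝ) ^ (19 * t + s) * (4 * (115 / 100) ^ t * (3 / 2) ^ t) := by gcongr
      _ = 4 * (115 / 100 * (3 / 4)) ^ t * 2 ^ m := by
          rw [e, show (3 / 2 : ℝ) = 3 / 4 * 2 by norm_num]; simp only [mul_pow]; ring
      _ ≤ _ := by gcongr; norm_num
  linarith

end PolarTree

end PolarCoord

namespace PolarCoord
open scoped Classical
open Real

/-! ### Functionals of the joint law of a bit and an observation -/

section Functionals

variable {Ω Ω' α β β' : Type*} [Fintype Ω] [Fintype Ω'] [Fintype β] [Fintype β']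

lemma prob_eq_sum_ite (μ : Ω → ℝ) (E : Ω → Prop) : prob μ E = ∑ ω, if E ω then μ ω else 0 := by
  rw [prob, Finset.sum_filter]

lemma prob_nonneg {μ : Ω → ℝ} (hμ : ∀ ω, 0 ≤ μ ω) (E : Ω → Prop) : 0 ≤ prob μ E :=
  Finset.sum_nonneg fun ω _ => hμ ω

lemma prob_congr {μ : Ω → ℝ} {E E' : Ω → Prop} (h : ∀ ω, E ω ↔ E' ω) : prob μ E = prob μ E' := by
  rw [show E = E' from funext fun ω => propext (h ω)]

lemma prob_equiv (e : Ω ≃ Ω') {μ : Ω → ℝ} {μ' : Ω' → ℝ} (hμ : ∀ ω, μ' (e ω) = μ ω)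
    (E : Ω' → Prop) : prob μ' E = prob μ (fun ω => E (e ω)) := by
  rw [prob_eq_sum_ite, prob_eq_sum_ite, ← e.sum_comp]
  simp only [hμ]

lemma prob_prod {Ω₂ : Type*} [Fintype Ω₂] (μ : Ω → ℝ) (μ' : Ω₂ → ℝ) (E : Ω → Prop)
    (E' : Ω₂ → Prop) :
    prob (fun w : Ω × Ω₂ => μ w.1 * μ' w.2) (fun w => E w.1 ∧ E' w.2) = prob μ E * prob μ' E' := by
  rw [prob_eq_sum_ite, prob_eq_sum_ite, prob_eq_sum_ite, Finset.sum_mul_sum,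
    Fintype.sum_prod_type]
  refine Finset.sum_congr rfl fun a _ => Finset.sum_congr rfl fun b _ => ?_
  by_cases h1 : E a <;> by_cases h2 : E' b <;> simp [h1, h2]

/-- Joint law of the bit `A` and the observation `B`. -/
noncomputable def jointBit (μ : Ω → ℝ) (A : Ω → ZMod 2) (B : Ω → α) (b : ZMod 2) (z : α) : ℝ :=
  prob μ (fun ω => A ω = b ∧ B ω = z)

/-- The sum of a function of the joint probabilities over the values of the observation. -/
noncomputable def bitSum (F : ℝ → ℝ → ℝ) (μ : Ω → ℝ) (A : Ω → ZMod 2) (B : Ω → β) : ℝ :=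
  ∑ z, F (jointBit μ A B 0 z) (jointBit μ A B 1 z)

lemma jointBit_nonneg {μ : Ω → ℝ} (hμ : ∀ ω, 0 ≤ μ ω) (A : Ω → ZMod 2) (B : Ω → α) (b : ZMod 2)
    (z : α) : 0 ≤ jointBit μ A B b z := prob_nonneg hμ _

lemma zmod_two_cases (b : ZMod 2) : b = 0 ∨ b = 1 := by
  revert b; decide

lemma sum_zmod_two {M : Type*} [AddCommMonoid M] (f : ZMod 2 → M) : ∑ b, f b = f 0 + f 1 :=
  Fin.sum_univ_two f

lemma prob_eq_jointBit_add (μ : Ω → ℝ) (A : Ω → ZMod 2) (B : Ω → α) (z : α) :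
    prob μ (fun ω => B ω = z) = jointBit μ A B 0 z + jointBit μ A B 1 z := by
  rw [jointBit, jointBit, prob_eq_sum_ite, prob_eq_sum_ite, prob_eq_sum_ite,
    ← Finset.sum_add_distrib]
  refine Finset.sum_congr rfl fun ω _ => ?_
  rcases zmod_two_cases (A ω) with h | h <;> simp [h]

lemma sum_mul_comp (μ : Ω → ℝ) (A : Ω → ZMod 2) (B : Ω → β) (G : ZMod 2 → β → ℝ) :
    ∑ ω, μ ω * G (A ω) (B ω) = ∑ z, ∑ b, jointBit μ A B b z * G b z := by
  simp only [jointBit, prob_eq_sum_ite, Finset.sum_mul]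
  rw [Finset.sum_congr rfl fun z _ => Finset.sum_comm, Finset.sum_comm]
  refine Finset.sum_congr rfl fun ω _ => ?_
  rw [Finset.sum_eq_single (B ω), Finset.sum_eq_single (A ω)]
  · simp
  · intro b _ hb; simp [hb.symm]
  · simp
  · intro z _ hz; simp [hz.symm]
  · simp

lemma condEntropy_eq_bitSum {μ : Ω → ℝ} (hμ : ∀ ω, 0 ≤ μ ω) (A : Ω → ZMod 2) (B : Ω → β) :
    condEntropy μ A B = bitSum entTerm μ A B := by
  rw [condEntropy, sum_mul_comp μ A B (fun b z =>
    logb 2 (prob μ (fun ω' => B ω' = z) / prob μ (fun ω' => A ω' = b ∧ B ω' = z))), bitSum]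
  refine Finset.sum_congr rfl fun z _ => ?_
  rw [sum_zmod_two, prob_eq_jointBit_add μ A]
  change jointBit μ A B 0 z * logb 2 (_ / jointBit μ A B 0 z) +
    jointBit μ A B 1 z * logb 2 (_ / jointBit μ A B 1 z) = _
  have h0 := jointBit_nonneg hμ A B 0 z
  have h1 := jointBit_nonneg hμ A B 1 z
  generalize jointBit μ A B 0 z = x at *
  generalize jointBit μ A B 1 z = y at *
  have key : ∀ u v : ℝ, 0 ≤ u → 0 ≤ v →
      u * logb 2 ((u + v) / u) = (negMulLog u + u * log (u + v)) / log 2 := by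
    intro u v hu hv
    rcases hu.eq_or_lt with rfl | hu
    · simp
    rw [logb, log_div (by positivity) hu.ne', negMulLog]
    ring
  rw [key x y h0 h1, add_comm x y, key y x h1 h0, entTerm, ← add_div, add_comm y x]
  congr 1
  simp only [negMulLog]
  ring

/-- Dividing by the size of the fibre of B gives a sum over outcomes in which only the partition
into fibres enters. Observations that never occur contribute F 0 0 = 0. -/
lemma bitSum_eq_sum_div_card {F : ℝ → ℝ → ℝ} (hF : F 0 0 = 0) (μ : Ω → ℝ) (A : Ω → ZMod 2)
    (B : Ω → β) :
    bitSum F μ A B = ∑ ω, F (jointBit μ A B 0 (B ω)) (jointBit μ A B 1 (B ω)) /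
      (Finset.univ.filter fun ω' => B ω' = B ω).card := by
  rw [bitSum, ← Finset.sum_fiberwise (s := Finset.univ) (g := B)]
  refine Finset.sum_congr rfl fun z _ => ?_
  rw [Finset.sum_congr rfl (g := fun _ => F (jointBit μ A B 0 z) (jointBit μ A B 1 z) /
    (Finset.univ.filter fun ω' => B ω' = z).card)]
  · rw [Finset.sum_const, nsmul_eq_mul]
    by_cases hc : (Finset.univ.filter fun ω' => B ω' = z).card = 0
    · rw [Finset.card_eq_zero, Finset.filter_eq_empty_iff] at hc
      have : ∀ b, jointBit μ A B b z = 0 := by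
        intro b
        rw [jointBit, prob_eq_sum_ite]
        exact Finset.sum_eq_zero fun ω _ => if_neg fun h => hc (Finset.mem_univ ω) h.2
      simp [this, hF]
    · field_simp
  · intro ω hω
    rw [(Finset.mem_filter.1 hω).2]

/-- The functionals depend on the observation only through the partition it induces. -/
lemma bitSum_congr {F : ℝ → ℝ → ℝ} (hF : F 0 0 = 0) (e : Ω ≃ Ω') {μ : Ω → ℝ} {μ' : Ω' → ℝ}
    (hμ : ∀ ω, μ' (e ω) = μ ω) {A : Ω → ZMod 2} {A' : Ω' → ZMod 2} (hA : ∀ ω, A' (e ω) = A ω)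
    {B : Ω → β} {B' : Ω' → β'} (hB : ∀ ω ω', B' (e ω) = B' (e ω') ↔ B ω = B ω') :
    bitSum F μ' A' B' = bitSum F μ A B := by
  rw [bitSum_eq_sum_div_card hF, bitSum_eq_sum_div_card hF, ← e.sum_comp]
  refine Finset.sum_congr rfl fun ω _ => ?_
  have h1 : ∀ b, jointBit μ' A' B' b (B' (e ω)) = jointBit μ A B b (B ω) := by
    intro b
    rw [jointBit, jointBit, prob_equiv e hμ]
    simp only [hA, hB]
  rw [h1, h1]
  congr 2
  rw [← Finset.card_map e.symm.toEmbedding]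
  congr 1
  ext x
  simp only [Finset.mem_map_equiv, Equiv.symm_symm, Finset.mem_filter, Finset.mem_univ, true_and,
    hB]

lemma sum_jointBit {μ : Ω → ℝ} (A : Ω → ZMod 2) (B : Ω → β) :
    ∑ z, (jointBit μ A B 0 z + jointBit μ A B 1 z) = ∑ ω, μ ω := by
  have := sum_mul_comp μ A B (fun _ _ => 1)
  simp only [mul_one, sum_zmod_two] at this
  exact this.symm

lemma jointBit_minus (μ : Ω → ℝ) (A : Ω → ZMod 2) (B : Ω → α) (b : ZMod 2) (z : α × α) :
    jointBit (fun w : Ω × Ω => μ w.1 * μ w.2) (fun w => A w.1 + A w.2) (fun w => (B w.1, B w.2)) b z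
      = jointBit μ A B b z.1 * jointBit μ A B 0 z.2 +
        jointBit μ A B (b + 1) z.1 * jointBit μ A B 1 z.2 := by
  simp only [jointBit, ← prob_prod]
  rw [prob_eq_sum_ite, prob_eq_sum_ite, prob_eq_sum_ite, ← Finset.sum_add_distrib]
  refine Finset.sum_congr rfl fun w _ => ?_
  obtain ⟨z1, z2⟩ := z
  simp only [Prod.mk.injEq]
  by_cases h1 : B w.1 = z1 <;> by_cases h2 : B w.2 = z2 <;> simp [h1, h2]
  rcases zmod_two_cases (A w.1) with h3 | h3 <;> rcases zmod_two_cases (A w.2) with h4 | h4 <;>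
    rcases zmod_two_cases b with h5 | h5 <;> subst h5 <;> simp [h3, h4, show (1 : ZMod 2) + 1 = 0 from rfl]

lemma jointBit_plus (μ : Ω → ℝ) (A : Ω → ZMod 2) (B : Ω → α) (b : ZMod 2)
    (z : ZMod 2 × α × α) :
    jointBit (fun w : Ω × Ω => μ w.1 * μ w.2) (fun w => A w.2)
      (fun w => (A w.1 + A w.2, B w.1, B w.2)) b z
      = jointBit μ A B (z.1 + b) z.2.1 * jointBit μ A B b z.2.2 := by
  simp only [jointBit, ← prob_prod]
  apply prob_congr
  intro w
  obtain ⟨c, z1, z2⟩ := z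
  simp only [Prod.mk.injEq]
  constructor
  · rintro ⟨h1, h2, h3, h4⟩
    refine ⟨⟨?_, h3⟩, h1, h4⟩
    rw [← h2, ← h1, add_assoc, CharTwo.add_self_eq_zero, add_zero]
  · rintro ⟨⟨h1, h2⟩, h3, h4⟩
    refine ⟨h3, ?_, h2, h4⟩
    rw [h1, h3, add_assoc, CharTwo.add_self_eq_zero, add_zero]

lemma bitSum_minus (F : ℝ → ℝ → ℝ) (μ : Ω → ℝ) (A : Ω → ZMod 2) (B : Ω → β) :
    bitSum F (fun w : Ω × Ω => μ w.1 * μ w.2) (fun w => A w.1 + A w.2) (fun w => (B w.1, B w.2)) =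
      ∑ z₁, ∑ z₂, F (jointBit μ A B 0 z₁ * jointBit μ A B 0 z₂ +
          jointBit μ A B 1 z₁ * jointBit μ A B 1 z₂)
        (jointBit μ A B 1 z₁ * jointBit μ A B 0 z₂ +
          jointBit μ A B 0 z₁ * jointBit μ A B 1 z₂) := by
  rw [bitSum, Fintype.sum_prod_type]
  simp only [jointBit_minus, zero_add, CharTwo.add_self_eq_zero]

lemma bitSum_plus (F : ℝ → ℝ → ℝ) (μ : Ω → ℝ) (A : Ω → ZMod 2) (B : Ω → β) :
    bitSum F (fun w : Ω × Ω => μ w.1 * μ w.2) (fun w => A w.2)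
      (fun w => (A w.1 + A w.2, B w.1, B w.2)) =
      ∑ z₁, ∑ z₂, (F (jointBit μ A B 0 z₁ * jointBit μ A B 0 z₂)
          (jointBit μ A B 1 z₁ * jointBit μ A B 1 z₂) +
        F (jointBit μ A B 1 z₁ * jointBit μ A B 0 z₂)
          (jointBit μ A B 0 z₁ * jointBit μ A B 1 z₂)) := by
  rw [bitSum, Fintype.sum_prod_type, sum_zmod_two, Fintype.sum_prod_type, Fintype.sum_prod_type]
  simp only [jointBit_plus, zero_add, add_zero, CharTwo.add_self_eq_zero, Finset.sum_add_distrib]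

end Functionals

/-! ### The inequalities of the two polarization transforms -/

/-- The squares of the two sides differ by 8√(x₁y₁)√(x₂y₂)(x₁ + y₁ − 2√(x₁y₁))(x₂ + y₂ − 2√(x₂y₂)),
which is nonnegative by the arithmetic–geometric mean inequality. -/
lemma sqrt_minus_le {x₁ y₁ x₂ y₂ : ℝ} (hx₁ : 0 ≤ x₁) (hy₁ : 0 ≤ y₁) (hx₂ : 0 ≤ x₂)
    (hy₂ : 0 ≤ y₂) :
    2 * √((x₁ * x₂ + y₁ * y₂) * (y₁ * x₂ + x₁ * y₂)) ≤
      (x₁ + y₁) * (2 * √(x₂ * y₂)) + (2 * √(x₁ * y₁)) * (x₂ + y₂) -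
        (2 * √(x₁ * y₁)) * (2 * √(x₂ * y₂)) := by
  have h1 : 2 * √(x₁ * y₁) ≤ x₁ + y₁ := by
    rw [Real.sqrt_mul hx₁]
    nlinarith [sq_nonneg (√x₁ - √y₁), Real.sq_sqrt hx₁, Real.sq_sqrt hy₁]
  have h2 : 2 * √(x₂ * y₂) ≤ x₂ + y₂ := by
    rw [Real.sqrt_mul hx₂]
    nlinarith [sq_nonneg (√x₂ - √y₂), Real.sq_sqrt hx₂, Real.sq_sqrt hy₂]
  have g1 : 0 ≤ √(x₁ * y₁) := Real.sqrt_nonneg _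
  have g2 : 0 ≤ √(x₂ * y₂) := Real.sqrt_nonneg _
  have e1 := Real.sq_sqrt (mul_nonneg hx₁ hy₁)
  have e2 := Real.sq_sqrt (mul_nonneg hx₂ hy₂)
  set a := √(x₁ * y₁)
  set b := √(x₂ * y₂)
  have hnn : 0 ≤ (x₁ + y₁) * (2 * b) + (2 * a) * (x₂ + y₂) - (2 * a) * (2 * b) := by
    nlinarith [mul_nonneg g2 (sub_nonneg.2 h1), mul_nonneg g1 (add_nonneg hx₂ hy₂)]
  refine (sq_le_sq₀ (by positivity) hnn).1 ?_
  rw [mul_pow, Real.sq_sqrt (by positivity)]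
  have key : 0 ≤ (4 * a) * b * ((x₁ + y₁ - 2 * a) * (x₂ + y₂ - 2 * b)) :=
    mul_nonneg (by positivity) (mul_nonneg (sub_nonneg.2 h1) (sub_nonneg.2 h2))
  have expand : ((x₁ + y₁) * (2 * b) + (2 * a) * (x₂ + y₂) - (2 * a) * (2 * b)) ^ 2 =
      (x₁ + y₁) ^ 2 * (4 * b ^ 2) + 4 * a ^ 2 * (x₂ + y₂) ^ 2 - 16 * a ^ 2 * b ^ 2 +
        2 * ((4 * a) * b * ((x₁ + y₁ - 2 * a) * (x₂ + y₂ - 2 * b))) := by ring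
  rw [expand, e1, e2]
  nlinarith

/-- With s = x + y and d = x − y, the left side is max(s₁|d₂|, s₂|d₁|), and the smaller of the two
products is at least |d₁||d₂|. -/
lemma abs_plus_le {x₁ y₁ x₂ y₂ : ℝ} (hx₁ : 0 ≤ x₁) (hy₁ : 0 ≤ y₁) (hx₂ : 0 ≤ x₂)
    (hy₂ : 0 ≤ y₂) :
    |x₁ * x₂ - y₁ * y₂| + |y₁ * x₂ - x₁ * y₂| ≤
      (x₁ + y₁) * |x₂ - y₂| + |x₁ - y₁| * (x₂ + y₂) - |x₁ - y₁| * |x₂ - y₂| := by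
  have h1 : |x₁ - y₁| ≤ x₁ + y₁ := abs_le.2 ⟨by linarith, by linarith⟩
  have h2 : |x₂ - y₂| ≤ x₂ + y₂ := abs_le.2 ⟨by linarith, by linarith⟩
  rcases abs_cases (x₁ - y₁) with ⟨e1, _⟩ | ⟨e1, _⟩ <;>
  rcases abs_cases (x₂ - y₂) with ⟨e2, _⟩ | ⟨e2, _⟩ <;>
  rcases abs_cases (x₁ * x₂ - y₁ * y₂) with ⟨e3, _⟩ | ⟨e3, _⟩ <;>
  rcases abs_cases (y₁ * x₂ - x₁ * y₂) with ⟨e4, _⟩ | ⟨e4, _⟩ <;>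
  rw [e1, e2, e3, e4] <;> nlinarith [mul_nonneg hx₁ hx₂, mul_nonneg hx₁ hy₂, mul_nonneg hy₁ hx₂,
    mul_nonneg hy₁ hy₂]

/-- Conservation of entropy for one pair of observations: the transforms split the entropy of a pair
of bits by the chain rule, and `negMulLog` of a product expands. -/
lemma negMulLog_expand (x₁ y₁ x₂ y₂ : ℝ) :
    entTerm (x₁ * x₂ + y₁ * y₂) (y₁ * x₂ + x₁ * y₂) +
      (entTerm (x₁ * x₂) (y₁ * y₂) + entTerm (y₁ * x₂) (x₁ * y₂)) =
      (x₁ + y₁) * entTerm x₂ y₂ + entTerm x₁ y₁ * (x₂ + y₂) := by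
  simp only [entTerm]
  rw [show x₁ * x₂ + y₁ * y₂ + (y₁ * x₂ + x₁ * y₂) = (x₁ + y₁) * (x₂ + y₂) by ring]
  simp only [negMulLog_mul]
  ring

section Sums

variable {β : Type*} [Fintype β] {x y : β → ℝ} (hx : ∀ z, 0 ≤ x z) (hy : ∀ z, 0 ≤ y z)
  (h1 : ∑ z, (x z + y z) = 1)
include hx hy h1

lemma sum_two_sqrt_minus_le :
    ∑ z₁, ∑ z₂, 2 * √((x z₁ * x z₂ + y z₁ * y z₂) * (y z₁ * x z₂ + x z₁ * y z₂)) ≤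
      2 * (∑ z, 2 * √(x z * y z)) - (∑ z, 2 * √(x z * y z)) ^ 2 := by
  refine (Finset.sum_le_sum fun z₁ _ => Finset.sum_le_sum fun z₂ _ =>
    sqrt_minus_le (hx z₁) (hy z₁) (hx z₂) (hy z₂)).trans (le_of_eq ?_)
  simp only [Finset.sum_sub_distrib, Finset.sum_add_distrib, ← Finset.mul_sum, ← Finset.sum_mul]
  simp only [Finset.sum_add_distrib] at h1
  rw [h1]
  ring

omit h1 in
lemma sum_two_sqrt_plus :
    ∑ z₁, ∑ z₂, (2 * √((x z₁ * x z₂) * (y z₁ * y z₂)) + 2 * √((y z₁ * x z₂) * (x z₁ * y z₂))) =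
      (∑ z, 2 * √(x z * y z)) ^ 2 := by
  rw [sq, Finset.sum_mul_sum]
  refine Finset.sum_congr rfl fun z₁ _ => Finset.sum_congr rfl fun z₂ _ => ?_
  rw [show (x z₁ * x z₂) * (y z₁ * y z₂) = (x z₁ * y z₁) * (x z₂ * y z₂) by ring,
    show (y z₁ * x z₂) * (x z₁ * y z₂) = (x z₁ * y z₁) * (x z₂ * y z₂) by ring,
    Real.sqrt_mul (mul_nonneg (hx z₁) (hy z₁))]
  ring

omit hx hy h1 in
lemma sum_abs_minus :
    ∑ z₁, ∑ z₂, |(x z₁ * x z₂ + y z₁ * y z₂) - (y z₁ * x z₂ + x z₁ * y z₂)| =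
      (∑ z, |x z - y z|) ^ 2 := by
  rw [sq, Finset.sum_mul_sum]
  refine Finset.sum_congr rfl fun z₁ _ => Finset.sum_congr rfl fun z₂ _ => ?_
  rw [← abs_mul]
  congr 1
  ring

lemma sum_abs_plus_le :
    ∑ z₁, ∑ z₂, (|x z₁ * x z₂ - y z₁ * y z₂| + |y z₁ * x z₂ - x z₁ * y z₂|) ≤
      2 * (∑ z, |x z - y z|) - (∑ z, |x z - y z|) ^ 2 := by
  refine (Finset.sum_le_sum fun z₁ _ => Finset.sum_le_sum fun z₂ _ =>
    abs_plus_le (hx z₁) (hy z₁) (hx z₂) (hy z₂)).trans (le_of_eq ?_)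
  simp only [Finset.sum_sub_distrib, Finset.sum_add_distrib, ← Finset.mul_sum, ← Finset.sum_mul]
  simp only [Finset.sum_add_distrib] at h1
  rw [h1]
  ring

omit hx hy in
lemma sum_entTerm_minus_add_plus :
    (∑ z₁, ∑ z₂, entTerm (x z₁ * x z₂ + y z₁ * y z₂) (y z₁ * x z₂ + x z₁ * y z₂)) +
      (∑ z₁, ∑ z₂, (entTerm (x z₁ * x z₂) (y z₁ * y z₂) + entTerm (y z₁ * x z₂) (x z₁ * y z₂))) =
      2 * ∑ z, entTerm (x z) (y z) := by
  rw [← Finset.sum_add_distrib]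
  simp only [← Finset.sum_add_distrib, negMulLog_expand]
  simp only [Finset.sum_add_distrib, ← Finset.mul_sum, ← Finset.sum_mul]
  simp only [Finset.sum_add_distrib] at h1
  rw [h1]
  ring

/-- Each planar vector (2√(xy), |x − y|) has length x + y, so the triangle inequality bounds the
length of their sum by the total mass. -/
lemma sq_add_sq_le_one :
    (∑ z, 2 * √(x z * y z)) ^ 2 + (∑ z, |x z - y z|) ^ 2 ≤ 1 := by
  have h := norm_sum_le (Finset.univ) fun z => (⟨2 * √(x z * y z), |x z - y z|⟩ : ℂ)
  have e : ∀ z, ‖(⟨2 * √(x z * y z), |x z - y z|⟩ : ℂ)‖ = x z + y z := by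
    intro z
    rw [Complex.norm_def, Complex.normSq_mk]
    have : 2 * √(x z * y z) * (2 * √(x z * y z)) + |x z - y z| * |x z - y z| =
        (x z + y z) ^ 2 := by
      rw [abs_mul_abs_self]
      nlinarith [Real.sq_sqrt (mul_nonneg (hx z) (hy z))]
    rw [this, Real.sqrt_sq (add_nonneg (hx z) (hy z))]
  simp only [e, h1] at h
  have h2 := mul_self_le_mul_self (norm_nonneg _) h
  rw [Complex.norm_mul_self_eq_normSq, Complex.normSq_apply, Complex.re_sum, Complex.im_sum] at h2
  simp only at h2
  nlinarith

end Sums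

end PolarCoord

namespace PolarCoord
open scoped Classical
open Real

/-! ### The recursive structure of the polar transform -/

section Recursion

variable {O : Type*} {m : ℕ}

/-- The positions of a word of length `2^(m+1)`: `(a, b)` is sent to `2 a + b`. -/
def childEquiv (m : ℕ) : Fin (2 ^ m) × Fin 2 ≃ Fin (2 ^ (m + 1)) := finProdFinEquiv

/-- Position `2 a + b` of a word of length `2^(m+1)`. -/
def childIdx (a : Fin (2 ^ m)) (b : Fin 2) : Fin (2 ^ (m + 1)) := childEquiv m (a, b)

lemma childIdx_val (a : Fin (2 ^ m)) (b : Fin 2) :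
    (childIdx a b : ℕ) = 2 * a + b :=
  (finProdFinEquiv_apply_val (a, b)).trans (add_comm _ _)

lemma exists_childIdx (i : Fin (2 ^ (m + 1))) : ∃ a b, i = childIdx (m := m) a b :=
  ⟨((childEquiv m).symm i).1, ((childEquiv m).symm i).2,
    ((childEquiv m).apply_symm_apply i).symm⟩

/-- Interleaving of two words. -/
def interleave {A : Type*} (f : Fin 2 → Fin (2 ^ m) → A) (i : Fin (2 ^ (m + 1))) : A :=
  f ((childEquiv m).symm i).2 ((childEquiv m).symm i).1

lemma interleave_childIdx {A : Type*} (f : Fin 2 → Fin (2 ^ m) → A) (a : Fin (2 ^ m))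
    (b : Fin 2) : interleave f (childIdx a b) = f b a := by
  unfold interleave childIdx
  rw [Equiv.symm_apply_apply]

lemma prod_childIdx {M : Type*} [CommMonoid M] (f : Fin (2 ^ (m + 1)) → M) :
    ∏ i, f i = (∏ a, f (childIdx a 0)) * ∏ a, f (childIdx (m := m) a 1) := by
  rw [← (childEquiv m).prod_comp, Fintype.prod_prod_type, ← Finset.prod_mul_distrib]
  exact Finset.prod_congr rfl fun a _ => Fin.prod_univ_two _

lemma sum_childIdx {M : Type*} [AddCommMonoid M] (f : Fin (2 ^ (m + 1)) → M) :
    ∑ i, f i = (∑ a, f (childIdx a 0)) + ∑ a, f (childIdx (m := m) a 1) := by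
  rw [← (childEquiv m).sum_comp, Fintype.sum_prod_type, ← Finset.sum_add_distrib]
  exact Finset.sum_congr rfl fun a _ => Fin.sum_univ_two _

lemma polarMatrix_childIdx (a a' : Fin (2 ^ m)) (b b' : Fin 2) :
    polarMatrix (m + 1) (childIdx a b) (childIdx a' b') =
      polarMatrix m a a' * (!![1, 0; 1, 1] : Matrix (Fin 2) (Fin 2) (ZMod 2)) b b' := by
  have h : polarMatrix (m + 1) = Matrix.reindex (childEquiv m) (childEquiv m)
    (Matrix.kroneckerMap (· * ·) (polarMatrix m) !![1, 0; 1, 1]) := rfl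
  rw [h, Matrix.reindex_apply, Matrix.submatrix_apply, childIdx, childIdx, Equiv.symm_apply_apply,
    Equiv.symm_apply_apply, Matrix.kroneckerMap_apply]

/-- The last Kronecker factor acts on the parity of the index: even outputs see the sum of the two
half words, odd outputs only the second. -/
lemma vecMul_polarMatrix_zero (v : Word (m + 1)) (a : Fin (2 ^ m)) :
    Matrix.vecMul v (polarMatrix (m + 1)) (childIdx a 0) =
      Matrix.vecMul (fun c => v (childIdx c 0) + v (childIdx c 1)) (polarMatrix m) a := by
  simp only [Matrix.vecMul, dotProduct]
  rw [sum_childIdx, ← Finset.sum_add_distrib]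
  refine Finset.sum_congr rfl fun c _ => ?_
  rw [polarMatrix_childIdx, polarMatrix_childIdx]
  simp
  ring

lemma vecMul_polarMatrix_one (v : Word (m + 1)) (a : Fin (2 ^ m)) :
    Matrix.vecMul v (polarMatrix (m + 1)) (childIdx a 1) =
      Matrix.vecMul (fun c => v (childIdx c 1)) (polarMatrix m) a := by
  simp only [Matrix.vecMul, dotProduct]
  rw [sum_childIdx, ← Finset.sum_add_distrib]
  refine Finset.sum_congr rfl fun c _ => ?_
  rw [polarMatrix_childIdx, polarMatrix_childIdx]
  simp

lemma polarMatrix_mul_self (m : ℕ) : polarMatrix m * polarMatrix m = 1 := by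
  induction m with
  | zero => simp [polarMatrix]
  | succ m ih =>
    have h2 : (!![1, 0; 1, 1] : Matrix (Fin 2) (Fin 2) (ZMod 2)) * !![1, 0; 1, 1] = 1 := by decide
    have h : polarMatrix (m + 1) = Matrix.reindex (childEquiv m) (childEquiv m)
      (Matrix.kroneckerMap (· * ·) (polarMatrix m) !![1, 0; 1, 1]) := rfl
    rw [h, Matrix.reindex_apply, Matrix.submatrix_mul_equiv, ← Matrix.mul_kronecker_mul, ih, h2, Matrix.one_kronecker_one,
      Matrix.submatrix_one_equiv]

/-- The polar transform as a permutation of the words. -/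
def polarEquiv (m : ℕ) : Word m ≃ Word m where
  toFun v := Matrix.vecMul v (polarMatrix m)
  invFun v := Matrix.vecMul v (polarMatrix m)
  left_inv v := by simp only [Matrix.vecMul_vecMul, polarMatrix_mul_self, Matrix.vecMul_one]
  right_inv v := by simp only [Matrix.vecMul_vecMul, polarMatrix_mul_self, Matrix.vecMul_one]

/-- A polarized word of length `2^(m+1)` with its observations, from two of length `2^m`. -/
def combine (m : ℕ) (O : Type*) :
    (Word m × (Fin (2 ^ m) → O)) × (Word m × (Fin (2 ^ m) → O)) ≃
      Word (m + 1) × (Fin (2 ^ (m + 1)) → O) where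
  toFun w := (interleave ![w.1.1 + w.2.1, w.2.1], interleave ![w.1.2, w.2.2])
  invFun w := ((fun c => w.1 (childIdx c 0) + w.1 (childIdx c 1), fun c => w.2 (childIdx c 0)),
    (fun c => w.1 (childIdx c 1), fun c => w.2 (childIdx c 1)))
  left_inv := by
    rintro ⟨⟨v, o⟩, ⟨v', o'⟩⟩
    simp [interleave_childIdx, add_assoc, CharTwo.add_self_eq_zero]
  right_inv := by
    rintro ⟨v, o⟩
    refine Prod.ext (funext fun i => ?_) (funext fun i => ?_) <;>
    · obtain ⟨a, b, rfl⟩ := exists_childIdx i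
      simp only [interleave_childIdx]
      fin_cases b <;> simp [add_assoc, CharTwo.add_self_eq_zero]

variable (w : (Word m × (Fin (2 ^ m) → O)) × (Word m × (Fin (2 ^ m) → O))) (a : Fin (2 ^ m))

lemma combine_fst_zero : (combine m O w).1 (childIdx a 0) = w.1.1 a + w.2.1 a := by
  simp [combine, interleave_childIdx]

lemma combine_fst_one : (combine m O w).1 (childIdx a 1) = w.2.1 a := by
  simp [combine, interleave_childIdx]

lemma combine_snd_zero : (combine m O w).2 (childIdx a 0) = w.1.2 a := by
  simp [combine, interleave_childIdx]

lemma combine_snd_one : (combine m O w).2 (childIdx a 1) = w.2.2 a := by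
  simp [combine, interleave_childIdx]

/-- In the even half the second word is added twice and cancels, so the two halves are independent
transforms of length 2^m. -/
lemma polarLaw_combine (p : ZMod 2 → O → ℝ) :
    polarLaw p (m + 1) (combine m O w) = polarLaw p m w.1 * polarLaw p m w.2 := by
  rw [polarLaw, prod_childIdx]
  simp only [vecMul_polarMatrix_zero, vecMul_polarMatrix_one, combine_fst_zero, combine_fst_one,
    combine_snd_zero, combine_snd_one, add_assoc, CharTwo.add_self_eq_zero, add_zero]
  rfl

lemma before_eq_iff {j : Fin (2 ^ m)} {v v' : Word m} :
    before j v = before j v' ↔ ∀ i < j, v i = v' i :=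
  ⟨fun h i hi => congrFun h ⟨i, hi⟩, fun h => funext fun i => h i.1 i.2⟩

lemma childIdx_lt_zero {a c : Fin (2 ^ m)} {b : Fin 2} :
    childIdx c b < childIdx a 0 ↔ c < a := by
  rw [Fin.lt_def, Fin.lt_def, childIdx_val, childIdx_val]
  have := b.isLt
  simp only [Fin.val_zero]
  omega

lemma childIdx_lt_one {a c : Fin (2 ^ m)} {b : Fin 2} :
    childIdx c b < childIdx a 1 ↔ c < a ∨ (c = a ∧ b = 0) := by
  rw [Fin.lt_def, Fin.lt_def, childIdx_val, childIdx_val, Fin.ext_iff, Fin.ext_iff]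
  have := b.isLt
  simp only [Fin.val_zero, Fin.val_one]
  omega

lemma combine_snd_eq_iff {w w' : (Word m × (Fin (2 ^ m) → O)) × (Word m × (Fin (2 ^ m) → O))} :
    (combine m O w).2 = (combine m O w').2 ↔ w.1.2 = w'.1.2 ∧ w.2.2 = w'.2.2 := by
  constructor
  · intro h
    refine ⟨funext fun c => ?_, funext fun c => ?_⟩
    · simpa only [combine_snd_zero] using congrFun h (childIdx c 0)
    · simpa only [combine_snd_one] using congrFun h (childIdx c 1)
  · rintro ⟨h1, h2⟩
    simp [combine, h1, h2]

/-- The past of position 2a consists of the pairs (v + v', v') before a, which carry the same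
information as the pairs (v, v'). -/
lemma combine_before_zero {w w' : (Word m × (Fin (2 ^ m) → O)) × (Word m × (Fin (2 ^ m) → O))} :
    before (childIdx a 0) (combine m O w).1 = before (childIdx a 0) (combine m O w').1 ↔
      before a w.1.1 = before a w'.1.1 ∧ before a w.2.1 = before a w'.2.1 := by
  simp only [before_eq_iff]
  constructor
  · intro h
    have h2 : ∀ i < a, w.2.1 i = w'.2.1 i := fun i hi => by
      simpa only [combine_fst_one] using h (childIdx i 1) (childIdx_lt_zero.2 hi)
    refine ⟨fun i hi => ?_, h2⟩
    have h1 := h (childIdx i 0) (childIdx_lt_zero.2 hi)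
    rwa [combine_fst_zero, combine_fst_zero, h2 i hi, add_left_inj] at h1
  · rintro ⟨h1, h2⟩ i hi
    obtain ⟨c, b, rfl⟩ := exists_childIdx i
    have hc := childIdx_lt_zero.1 hi
    fin_cases b
    · simp only [Fin.zero_eta, combine_fst_zero, h1 c hc, h2 c hc]
    · simp only [Fin.mk_one, combine_fst_one, h2 c hc]

/-- The past of position 2a + 1 contains in addition the sum of the two bits at a. -/
lemma combine_before_one {w w' : (Word m × (Fin (2 ^ m) → O)) × (Word m × (Fin (2 ^ m) → O))} :
    before (childIdx a 1) (combine m O w).1 = before (childIdx a 1) (combine m O w').1 ↔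
      w.1.1 a + w.2.1 a = w'.1.1 a + w'.2.1 a ∧
      before a w.1.1 = before a w'.1.1 ∧ before a w.2.1 = before a w'.2.1 := by
  rw [← combine_before_zero, ← combine_fst_zero, ← combine_fst_zero]
  simp only [before_eq_iff]
  constructor
  · intro h
    exact ⟨h _ (childIdx_lt_one.2 (Or.inr ⟨rfl, rfl⟩)), fun i hi => h i
      (hi.trans (childIdx_lt_one.2 (Or.inr ⟨rfl, rfl⟩)))⟩
  · rintro ⟨h1, h2⟩ i hi
    obtain ⟨c, b, rfl⟩ := exists_childIdx i
    rcases childIdx_lt_one.1 hi with hc | ⟨rfl, rfl⟩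
    · exact h2 _ (childIdx_lt_zero.2 hc)
    · exact h1

end Recursion

/-! ### Polarization of the bit channels -/

section BitChannels

variable {O : Type*} [Fintype O]

/-- A functional of the joint law of `V^j` and `(V^{1:j-1}, O^{1:n})`; zero for `j ≥ n`. -/
noncomputable def bitPar (F : ℝ → ℝ → ℝ) (p : ZMod 2 → O → ℝ) (m a : ℕ) : ℝ :=
  if h : a < 2 ^ m then
    bitSum F (polarLaw p m) (fun w => w.1 ⟨a, h⟩) (fun w => (before ⟨a, h⟩ w.1, w.2))
  else 0

/-- Joint law of `V^j` and `(V^{1:j-1}, O^{1:n})`. -/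
noncomputable def bitLaw (p : ZMod 2 → O → ℝ) {m : ℕ} (j : Fin (2 ^ m)) (b : ZMod 2)
    (z : ({i : Fin (2 ^ m) // i < j} → ZMod 2) × (Fin (2 ^ m) → O)) : ℝ :=
  jointBit (polarLaw p m) (fun w => w.1 j) (fun w => (before j w.1, w.2)) b z

lemma bitPar_fin (F : ℝ → ℝ → ℝ) (p : ZMod 2 → O → ℝ) {m : ℕ} (a : Fin (2 ^ m)) :
    bitPar F p m a = ∑ z, F (bitLaw p a 0 z) (bitLaw p a 1 z) := by
  rw [bitPar, dif_pos a.isLt]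
  rfl

lemma bitPar_minus {F : ℝ → ℝ → ℝ} (hF : F 0 0 = 0) (p : ZMod 2 → O → ℝ) {m : ℕ}
    (a : Fin (2 ^ m)) :
    bitPar F p (m + 1) (2 * a) =
      ∑ z₁, ∑ z₂, F (bitLaw p a 0 z₁ * bitLaw p a 0 z₂ + bitLaw p a 1 z₁ * bitLaw p a 1 z₂)
        (bitLaw p a 1 z₁ * bitLaw p a 0 z₂ + bitLaw p a 0 z₁ * bitLaw p a 1 z₂) := by
  have h := bitPar_fin F p (childIdx a 0)
  rw [childIdx_val, Fin.val_zero, add_zero] at h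
  rw [h]
  refine Eq.trans ?_ (bitSum_minus F (polarLaw p m) (fun w => w.1 a)
    (fun w => (before a w.1, w.2)))
  refine bitSum_congr hF (combine m O) (fun w => polarLaw_combine w p)
    (fun w => combine_fst_zero w a) fun w w' => ?_
  simp only [Prod.mk.injEq, combine_snd_eq_iff, combine_before_zero]
  tauto

lemma bitPar_plus {F : ℝ → ℝ → ℝ} (hF : F 0 0 = 0) (p : ZMod 2 → O → ℝ) {m : ℕ}
    (a : Fin (2 ^ m)) :
    bitPar F p (m + 1) (2 * a + 1) =
      ∑ z₁, ∑ z₂, (F (bitLaw p a 0 z₁ * bitLaw p a 0 z₂) (bitLaw p a 1 z₁ * bitLaw p a 1 z₂) +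
        F (bitLaw p a 1 z₁ * bitLaw p a 0 z₂) (bitLaw p a 0 z₁ * bitLaw p a 1 z₂)) := by
  have h := bitPar_fin F p (childIdx a 1)
  rw [childIdx_val, Fin.val_one] at h
  rw [h]
  refine Eq.trans ?_ (bitSum_plus F (polarLaw p m) (fun w => w.1 a)
    (fun w => (before a w.1, w.2)))
  refine bitSum_congr hF (combine m O) (fun w => polarLaw_combine w p)
    (fun w => combine_fst_one w a) fun w w' => ?_
  simp only [Prod.mk.injEq, combine_snd_eq_iff, combine_before_one]
  tauto

lemma sum_pi_prod {ι A : Type*} [Fintype ι] [DecidableEq ι] [Fintype A] (f : ι → A → ℝ) :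
    ∑ w : ι → A, ∏ i, f i (w i) = ∏ i, ∑ a, f i a := by
  rw [Finset.prod_univ_sum, Fintype.piFinset_univ]

/-- `p` is the joint law of a bit and an observation. -/
structure IsBitLaw (p : ZMod 2 → O → ℝ) : Prop where
  nonneg : ∀ b o, 0 ≤ p b o
  sum_eq_one : ∑ o, (p 0 o + p 1 o) = 1

namespace IsBitLaw

variable {p : ZMod 2 → O → ℝ} (hp : IsBitLaw p)
include hp

lemma polarLaw_nonneg (m : ℕ) (w : Word m × (Fin (2 ^ m) → O)) : 0 ≤ polarLaw p m w :=
  Finset.prod_nonneg fun _ _ => hp.nonneg _ _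

lemma sum_polarLaw (m : ℕ) : ∑ w, polarLaw p m w = 1 := by
  rw [← ((polarEquiv m).prodCongr (Equiv.refl _)).sum_comp,
    ← (Equiv.arrowProdEquivProdArrow _ _ _).sum_comp]
  have e : ∀ f : Fin (2 ^ m) → ZMod 2 × O, polarLaw p m (((polarEquiv m).prodCongr (Equiv.refl _))
      (Equiv.arrowProdEquivProdArrow _ _ _ f)) = ∏ i, p (f i).1 (f i).2 := by
    intro f
    refine Finset.prod_congr rfl fun i _ => ?_
    exact congrArg (fun g => p (g i) (f i).2) ((polarEquiv m).left_inv fun i => (f i).1)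
  simp only [e]
  rw [sum_pi_prod fun _ (z : ZMod 2 × O) => p z.1 z.2]
  simp only [Fintype.sum_prod_type, sum_zmod_two, ← Finset.sum_add_distrib, hp.sum_eq_one,
    Finset.prod_const_one]

lemma bitLaw_nonneg {m : ℕ} (a : Fin (2 ^ m)) (b : ZMod 2)
    (z : ({i : Fin (2 ^ m) // i < a} → ZMod 2) × (Fin (2 ^ m) → O)) : 0 ≤ bitLaw p a b z :=
  jointBit_nonneg (hp.polarLaw_nonneg _) _ _ _ _

lemma sum_bitLaw {m : ℕ} (a : Fin (2 ^ m)) : ∑ z, (bitLaw p a 0 z + bitLaw p a 1 z) = 1 :=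
  (sum_jointBit _ _).trans (hp.sum_polarLaw _)

lemma bitEntropy_eq {m : ℕ} (j : Fin (2 ^ m)) :
    bitEntropy p m j = ∑ z, entTerm (bitLaw p j 0 z) (bitLaw p j 1 z) :=
  condEntropy_eq_bitSum (hp.polarLaw_nonneg m) _ _

/-- Each field is a one-step inequality summed over pairs of observations. Indices a ≥ 2^m, where
`bitPar` is zero, only have children 2a, 2a + 1 ≥ 2^(m+1), where it is zero too. -/
lemma polarTree : PolarTree (bitPar (fun x y => 2 * √(x * y)) p) (bitPar (fun x y => |x - y|) p) := by
  have out : ∀ F m a, ¬ a < 2 ^ m → bitPar F p m a = 0 := fun F m a h => dif_neg h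
  constructor
  · intro m a
    by_cases h : a < 2 ^ m
    · rw [bitPar_fin _ p ⟨a, h⟩]
      exact Finset.sum_nonneg fun z _ => by positivity
    · rw [out _ _ _ h]
  · intro m a
    by_cases h : a < 2 ^ m
    · rw [bitPar_fin _ p ⟨a, h⟩]
      exact Finset.sum_nonneg fun z _ => abs_nonneg _
    · rw [out _ _ _ h]
  · intro m a
    by_cases h : a < 2 ^ m
    · rw [bitPar_fin _ p ⟨a, h⟩, bitPar_fin _ p ⟨a, h⟩]
      exact sq_add_sq_le_one (hp.bitLaw_nonneg _ 0) (hp.bitLaw_nonneg _ 1) (hp.sum_bitLaw _)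
    · rw [out _ _ _ h, out _ _ _ h]; norm_num
  · intro m a
    by_cases h : a < 2 ^ m
    · rw [bitPar_minus (by simp) p ⟨a, h⟩, bitPar_fin _ p ⟨a, h⟩]
      exact sum_two_sqrt_minus_le (hp.bitLaw_nonneg _ 0) (hp.bitLaw_nonneg _ 1) (hp.sum_bitLaw _)
    · rw [out _ _ _ h, out _ _ _ (by rw [pow_succ]; omega)]; norm_num
  · intro m a
    by_cases h : a < 2 ^ m
    · rw [bitPar_plus (by simp) p ⟨a, h⟩, bitPar_fin _ p ⟨a, h⟩]
      exact (sum_two_sqrt_plus (hp.bitLaw_nonneg _ 0) (hp.bitLaw_nonneg _ 1)).le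
    · rw [out _ _ _ h, out _ _ _ (by rw [pow_succ]; omega)]; norm_num
  · intro m a
    by_cases h : a < 2 ^ m
    · rw [bitPar_minus (by simp) p ⟨a, h⟩, bitPar_fin _ p ⟨a, h⟩]
      exact sum_abs_minus.le
    · rw [out _ _ _ h, out _ _ _ (by rw [pow_succ]; omega)]; norm_num
  · intro m a
    by_cases h : a < 2 ^ m
    · rw [bitPar_plus (by simp) p ⟨a, h⟩, bitPar_fin _ p ⟨a, h⟩]
      exact sum_abs_plus_le (hp.bitLaw_nonneg _ 0) (hp.bitLaw_nonneg _ 1) (hp.sum_bitLaw _)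
    · rw [out _ _ _ h, out _ _ _ (by rw [pow_succ]; omega)]; norm_num

/-- Chain rule: the polar transform preserves entropy. -/
lemma sum_bitEntropy (m : ℕ) :
    ∑ j, bitEntropy p m j = 2 ^ m * ∑ o, entTerm (p 0 o) (p 1 o) := by
  simp only [hp.bitEntropy_eq, ← bitPar_fin]
  induction m with
  | zero =>
    have : Unique (Fin (2 ^ 0)) := inferInstanceAs (Unique (Fin 1))
    obtain ⟨a, -⟩ : ∃ a : Fin (2 ^ 0), a = default := ⟨_, rfl⟩
    rw [Fintype.sum_subsingleton _ a, bitPar_fin]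
    -- For n = 1 the transform is the identity and the past is empty, so the only bit channel is p
    -- itself.
    have h := bitSum_congr (F := entTerm) entTerm_zero
      (e := ((Equiv.funUnique (Fin (2 ^ 0)) (ZMod 2)).prodCongr
        (Equiv.funUnique (Fin (2 ^ 0)) O)).symm)
      (μ := fun w : ZMod 2 × O => p w.1 w.2) (μ' := polarLaw p 0) (A := fun w => w.1)
      (A' := fun w => w.1 a) (B := fun w => w.2) (B' := fun w => (before a w.1, w.2))
      (by intro w; simp [polarLaw, polarMatrix]) (by intro w; rfl)
      (by
        intro w w'
        simp only [Prod.mk.injEq, before_eq_iff]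
        constructor
        · rintro ⟨-, h⟩; exact congrFun h a
        · intro h
          refine ⟨fun i hi => absurd (Subsingleton.elim i a) hi.ne, funext fun _ => h⟩)
    change bitSum entTerm (polarLaw p 0) (fun w => w.1 a)
      (fun w => (before a w.1, w.2)) = _
    rw [h, bitSum, show ((2 : ℝ) ^ 0) = 1 from pow_zero 2, one_mul]
    refine Finset.sum_congr rfl fun o _ => ?_
    have : ∀ b, jointBit (fun w : ZMod 2 × O => p w.1 w.2) (fun w => w.1) (fun w => w.2) b o =
        p b o := by
      intro b
      rw [jointBit, prob_eq_sum_ite, Finset.sum_eq_single (b, o)]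
      · simp
      · rintro ⟨b', o'⟩ _ hne
        apply if_neg
        rintro ⟨rfl, rfl⟩
        exact hne rfl
      · simp
    rw [this, this]
  | succ m ih =>
    rw [sum_childIdx, ← Finset.sum_add_distrib, pow_succ (2 : ℝ) m, mul_right_comm, ← ih,
      Finset.sum_mul]
    refine Finset.sum_congr rfl fun a _ => ?_
    simp only [childIdx_val, Fin.val_zero, Fin.val_one, add_zero]
    rw [bitPar_minus entTerm_zero, bitPar_plus entTerm_zero, bitPar_fin,
      sum_entTerm_minus_add_plus (hp.sum_bitLaw a), mul_comm]

end IsBitLaw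

end BitChannels

end PolarCoord

namespace PolarCoord
open scoped Classical
open Real

/-! ### Sizes of the high entropy sets -/

section Entropies

variable {O : Type*} [Fintype O] {p : ZMod 2 → O → ℝ}

/-- `H(B | O)` for `(B, O)` with law `p`. -/
noncomputable def lawEntropy (p : ZMod 2 → O → ℝ) : ℝ := ∑ o, entTerm (p 0 o) (p 1 o)

/-- A bound on the fraction of positions whose entropy is not within `δ_n` of `0` or `1`, plus the
error made by rounding the entropies. -/
noncomputable def polarGap (m : ℕ) : ℝ := 6 * (93 / 100) ^ (m / 20) + threshold (1 / 100) m

lemma threshold_pos (β : ℝ) (m : ℕ) : 0 < threshold β m := Real.rpow_pos_of_pos two_pos _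

lemma threshold_eq (m : ℕ) : threshold (1 / 100) m = 2 ^ (-(2 : ℝ) ^ ((m : ℝ) / 100)) := by
  rw [threshold, ← Real.rpow_natCast, ← Real.rpow_mul two_pos.le, mul_one_div]

lemma threshold_le_half {β : ℝ} (hβ : 0 ≤ β) (m : ℕ) : threshold β m ≤ 1 / 2 := by
  rw [threshold, show (1 / 2 : ℝ) = 2 ^ (-1 : ℝ) by rw [Real.rpow_neg_one]; norm_num]
  apply Real.rpow_le_rpow_of_exponent_le one_le_two
  have : (1 : ℝ) ≤ ((2 : ℝ) ^ m) ^ β := Real.one_le_rpow (one_le_pow₀ one_le_two) hβ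
  linarith

lemma entTerm_mul {c x y : ℝ} : entTerm (c * x) (c * y) = c * entTerm x y := by
  simp only [entTerm, ← mul_add, negMulLog_mul]
  ring

namespace IsBitLaw

section Single
variable (hp : IsBitLaw p) {m : ℕ}
include hp

lemma bitEntropy_nonneg (j : Fin (2 ^ m)) : 0 ≤ bitEntropy p m j := by
  rw [hp.bitEntropy_eq]
  exact Finset.sum_nonneg fun z _ => entTerm_nonneg (hp.bitLaw_nonneg _ _ _)
    (hp.bitLaw_nonneg _ _ _)

lemma bitEntropy_le_one (j : Fin (2 ^ m)) : bitEntropy p m j ≤ 1 := by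
  rw [hp.bitEntropy_eq, ← hp.sum_bitLaw j]
  exact Finset.sum_le_sum fun z _ => entTerm_le_add (hp.bitLaw_nonneg _ _ _)
    (hp.bitLaw_nonneg _ _ _)

lemma bitEntropy_le_bitPar (j : Fin (2 ^ m)) :
    bitEntropy p m j ≤ 2 * bitPar (fun x y => 2 * √(x * y)) p m j := by
  rw [hp.bitEntropy_eq, bitPar_fin, Finset.mul_sum]
  refine Finset.sum_le_sum fun z _ => (entTerm_le (hp.bitLaw_nonneg _ _ _)
    (hp.bitLaw_nonneg _ _ _)).trans (le_of_eq ?_)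
  ring

lemma one_sub_bitEntropy_le (j : Fin (2 ^ m)) :
    1 - bitEntropy p m j ≤ bitPar (fun x y => |x - y|) p m j := by
  rw [hp.bitEntropy_eq, bitPar_fin, ← hp.sum_bitLaw j, ← Finset.sum_sub_distrib]
  exact Finset.sum_le_sum fun z _ => add_sub_entTerm_le (hp.bitLaw_nonneg _ _ _)
    (hp.bitLaw_nonneg _ _ _)

/-- Cauchy–Schwarz over the observations, from the pointwise Pinsker bound. A bit of entropy close
to one is thus nearly fair given past and observation. -/
lemma sum_abs_sub_le (j : Fin (2 ^ m)) :
    ∑ z, |bitLaw p j 0 z - bitLaw p j 1 z| ≤ 2 * √(1 - bitEntropy p m j) := by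
  have h0 := hp.bitLaw_nonneg j 0
  have h1 := hp.bitLaw_nonneg j 1
  have hs : ∀ z, 0 ≤ bitLaw p j 0 z + bitLaw p j 1 z := fun z => add_nonneg (h0 z) (h1 z)
  have hd : ∀ z, 0 ≤ bitLaw p j 0 z + bitLaw p j 1 z -
      entTerm (bitLaw p j 0 z) (bitLaw p j 1 z) :=
    fun z => sub_nonneg.2 (entTerm_le_add (h0 z) (h1 z))
  calc _ ≤ ∑ z, 2 * (√(bitLaw p j 0 z + bitLaw p j 1 z) * √(bitLaw p j 0 z + bitLaw p j 1 z -
        entTerm (bitLaw p j 0 z) (bitLaw p j 1 z))) := by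
        refine Finset.sum_le_sum fun z _ => ?_
        rw [← Real.sqrt_mul (hs z), show (2 : ℝ) = √4 by
          rw [show (4 : ℝ) = 2 ^ 2 by norm_num, Real.sqrt_sq two_pos.le],
          ← Real.sqrt_mul (by norm_num)]
        apply Real.abs_le_sqrt
        exact sq_sub_le_entTerm (h0 z) (h1 z)
    _ = 2 * ∑ z, (√(bitLaw p j 0 z + bitLaw p j 1 z) * √(bitLaw p j 0 z + bitLaw p j 1 z -
        entTerm (bitLaw p j 0 z) (bitLaw p j 1 z))) := by rw [Finset.mul_sum]
    _ ≤ 2 * (√(∑ z, (bitLaw p j 0 z + bitLaw p j 1 z)) *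
        √(∑ z, (bitLaw p j 0 z + bitLaw p j 1 z -
        entTerm (bitLaw p j 0 z) (bitLaw p j 1 z)))) := by
        gcongr
        exact Real.sum_sqrt_mul_sqrt_le _ hs hd
    _ = _ := by
        rw [Finset.sum_sub_distrib, hp.sum_bitLaw, Real.sqrt_one, one_mul, hp.bitEntropy_eq]

/-- An entropy above δ forces Z > δ/2, and one of at most 1 − δ forces T ≥ δ, so such a position is
bad in the sense of `PolarTree.count_le`. The halving explains the summand 1 in the exponent there.
-/
lemma card_high_sdiff_veryHigh_le :
    ((high p (1 / 100) m \ veryHigh p (1 / 100) m).card : ℝ) ≤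
      6 * (93 / 100) ^ (m / 20) * 2 ^ m := by
  refine le_trans ?_ (hp.polarTree.count_le m)
  rw [← Fin.sum_univ_eq_sum_range (fun j =>
      if (2 : ℝ) ^ (-((2 : ℝ) ^ ((m : ℝ) / 100) + 1)) < bitPar (fun x y => 2 * √(x * y)) p m j ∧
        (2 : ℝ) ^ (-((2 : ℝ) ^ ((m : ℝ) / 100) + 1)) < bitPar (fun x y => |x - y|) p m j
      then (1 : ℝ) else 0), ← Finset.sum_filter, Finset.sum_const, nsmul_eq_mul, mul_one]
  have e : (2 : ℝ) ^ (-((2 : ℝ) ^ ((m : ℝ) / 100) + 1)) = threshold (1 / 100) m / 2 := by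
    rw [threshold_eq, neg_add, ← sub_eq_add_neg, Real.rpow_sub two_pos, Real.rpow_one]
  rw [e]
  have hδ := threshold_pos (1 / 100) m
  gcongr
  intro j hj
  simp only [high, veryHigh, Finset.mem_sdiff, Finset.mem_filter, Finset.mem_univ, true_and,
    not_lt] at hj ⊢
  have h1 := hp.bitEntropy_le_bitPar j
  have h2 := hp.one_sub_bitEntropy_le j
  constructor <;> linarith [hj.1, hj.2]

/-- The entropies sum to n H(B|O), and each of those counted exceeds 1 − δ. -/
lemma card_veryHigh_le :
    ((veryHigh p (1 / 100) m).card : ℝ) ≤ (lawEntropy p + threshold (1 / 100) m) * 2 ^ m := by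
  have h1 : ((veryHigh p (1 / 100) m).card : ℝ) * (1 - threshold (1 / 100) m) ≤
      ∑ j, bitEntropy p m j := by
    rw [← nsmul_eq_mul, ← Finset.sum_const]
    refine (Finset.sum_le_sum fun j hj => (Finset.mem_filter.1 hj).2.le).trans
      (Finset.sum_le_sum_of_subset_of_nonneg (Finset.subset_univ _)
        fun j _ _ => hp.bitEntropy_nonneg j)
  have h2 : ((veryHigh p (1 / 100) m).card : ℝ) ≤ 2 ^ m := by
    have := Finset.card_le_univ (veryHigh p (1 / 100) m)
    rw [Fintype.card_fin] at this
    exact_mod_cast this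
  have h3 : ∑ j, bitEntropy p m j = 2 ^ m * lawEntropy p := hp.sum_bitEntropy m
  have hδ := threshold_pos (1 / 100) m
  nlinarith

/-- Entropies outside ℋ add at most nδ to the total n H(B|O), those inside at most one each. -/
lemma le_card_high :
    (lawEntropy p - threshold (1 / 100) m) * 2 ^ m ≤ ((high p (1 / 100) m).card : ℝ) := by
  have h1 : ∑ j, bitEntropy p m j ≤ ∑ j, ((if j ∈ high p (1 / 100) m then 1 else 0) +
      threshold (1 / 100) m) := by
    refine Finset.sum_le_sum fun j _ => ?_
    split_ifs with h
    · linarith [hp.bitEntropy_le_one j, threshold_pos (1 / 100) m]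
    · simp only [high, Finset.mem_filter, Finset.mem_univ, true_and, not_lt] at h
      linarith
  have h3 : ∑ j, bitEntropy p m j = 2 ^ m * lawEntropy p := hp.sum_bitEntropy m
  rw [Finset.sum_add_distrib, Finset.sum_boole, Finset.filter_mem_eq_inter, Finset.univ_inter,
    Finset.sum_const, Finset.card_univ, Fintype.card_fin, nsmul_eq_mul, h3] at h1
  push_cast at h1
  linarith

lemma card_high_le_add :
    ((high p (1 / 100) m).card : ℝ) ≤ (veryHigh p (1 / 100) m).card +
      6 * (93 / 100) ^ (m / 20) * 2 ^ m := by
  have h := hp.card_high_sdiff_veryHigh_le (m := m)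
  have : (high p (1 / 100) m).card ≤ (veryHigh p (1 / 100) m).card +
      (high p (1 / 100) m \ veryHigh p (1 / 100) m).card := by
    rw [add_comm]; exact Finset.card_le_card_sdiff_add_card
  have : ((high p (1 / 100) m).card : ℝ) ≤ (veryHigh p (1 / 100) m).card +
      (high p (1 / 100) m \ veryHigh p (1 / 100) m).card := by exact_mod_cast this
  linarith

lemma card_high_le :
    ((high p (1 / 100) m).card : ℝ) ≤ (lawEntropy p + polarGap m) * 2 ^ m := by
  have h1 := hp.card_high_le_add (m := m)
  have h2 := hp.card_veryHigh_le (m := m)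
  rw [polarGap]
  linarith

lemma le_card_veryHigh :
    (lawEntropy p - polarGap m) * 2 ^ m ≤ ((veryHigh p (1 / 100) m).card : ℝ) := by
  have h1 := hp.card_high_le_add (m := m)
  have h2 := hp.le_card_high (m := m)
  rw [polarGap]
  linarith

end Single

end IsBitLaw

/-! ### Forgetting the observation -/

lemma bitLaw_eq_sum (p : ZMod 2 → O → ℝ) {m : ℕ} (j : Fin (2 ^ m)) (b : ZMod 2)
    (z : ({i : Fin (2 ^ m) // i < j} → ZMod 2) × (Fin (2 ^ m) → O)) :
    bitLaw p j b z = ∑ v, if v j = b ∧ before j v = z.1 then polarLaw p m (v, z.2) else 0 := by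
  rw [bitLaw, jointBit, prob_eq_sum_ite, Fintype.sum_prod_type]
  refine Finset.sum_congr rfl fun v _ => ?_
  obtain ⟨z1, z2⟩ := z
  rw [Finset.sum_eq_single z2]
  · simp
  · intro o _ ho; simp [ho]
  · simp

lemma sum_polarLaw_obs (p : ZMod 2 → O → ℝ) {p' : ZMod 2 → Unit → ℝ}
    (h : ∀ b, p' b () = ∑ o, p b o) {m : ℕ} (v : Word m) (u : Fin (2 ^ m) → Unit) :
    ∑ o, polarLaw p m (v, o) = polarLaw p' m (v, u) := by
  simp only [polarLaw]
  rw [sum_pi_prod]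
  exact Finset.prod_congr rfl fun i _ => (h _).symm

lemma IsBitLaw.forget (hp : IsBitLaw p) {p' : ZMod 2 → Unit → ℝ}
    (h : ∀ b, p' b () = ∑ o, p b o) : IsBitLaw p' := by
  refine ⟨fun b _ => (h b).symm ▸ Finset.sum_nonneg fun o _ => hp.nonneg b o, ?_⟩
  rw [Fintype.sum_unique, show (default : Unit) = () from rfl, h, h, ← Finset.sum_add_distrib]
  exact hp.sum_eq_one

/-- Conditioning reduces entropy. -/
lemma IsBitLaw.bitEntropy_le_forget (hp : IsBitLaw p) {p' : ZMod 2 → Unit → ℝ}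
    (h : ∀ b, p' b () = ∑ o, p b o) {m : ℕ} (j : Fin (2 ^ m)) :
    bitEntropy p m j ≤ bitEntropy p' m j := by
  rw [hp.bitEntropy_eq, (hp.forget h).bitEntropy_eq, Fintype.sum_prod_type, Fintype.sum_prod_type]
  refine Finset.sum_le_sum fun pre _ => ?_
  rw [Fintype.sum_subsingleton (fun u : Fin (2 ^ m) → Unit =>
    entTerm (bitLaw p' j 0 (pre, u)) (bitLaw p' j 1 (pre, u))) fun _ => ()]
  have e : ∀ b, bitLaw p' j b (pre, fun _ => ()) = ∑ o, bitLaw p j b (pre, o) := by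
    intro b
    simp only [bitLaw_eq_sum]
    rw [Finset.sum_comm]
    refine Finset.sum_congr rfl fun v _ => ?_
    split_ifs
    · exact (sum_polarLaw_obs p h v _).symm
    · simp
  rw [e, e]
  exact sum_entTerm_le _ _ _ (fun _ _ => hp.bitLaw_nonneg _ _ _) fun _ _ => hp.bitLaw_nonneg _ _ _

lemma bitLaw_indep {p' : ZMod 2 → Unit → ℝ} {r : O → ℝ} (h : ∀ b o, p b o = p' b () * r o) {m : ℕ}
    (j : Fin (2 ^ m)) (b : ZMod 2)
    (z : ({i : Fin (2 ^ m) // i < j} → ZMod 2) × (Fin (2 ^ m) → O)) :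
    bitLaw p j b z = (∏ i, r (z.2 i)) * bitLaw p' j b (z.1, fun _ => ()) := by
  rw [bitLaw_eq_sum, bitLaw_eq_sum, Finset.mul_sum]
  refine Finset.sum_congr rfl fun v _ => ?_
  rw [mul_ite, mul_zero]
  congr 1
  simp only [polarLaw, h, Finset.prod_mul_distrib]
  ring

/-- An independent observation multiplies the joint probabilities by a factor that does not involve
the bit, and `entTerm` is homogeneous. -/
lemma bitEntropy_indep {p' : ZMod 2 → Unit → ℝ} {r : O → ℝ} (hp : IsBitLaw p) (hp' : IsBitLaw p')
    (hr : ∑ o, r o = 1) (h : ∀ b o, p b o = p' b () * r o) {m : ℕ} (j : Fin (2 ^ m)) :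
    bitEntropy p m j = bitEntropy p' m j := by
  rw [hp.bitEntropy_eq, hp'.bitEntropy_eq, Fintype.sum_prod_type, Fintype.sum_prod_type]
  refine Finset.sum_congr rfl fun pre _ => ?_
  rw [Fintype.sum_subsingleton (fun u : Fin (2 ^ m) → Unit =>
    entTerm (bitLaw p' j 0 (pre, u)) (bitLaw p' j 1 (pre, u))) fun _ => ()]
  simp only [bitLaw_indep h, entTerm_mul]
  rw [← Finset.sum_mul, sum_pi_prod (fun _ o => r o)]
  simp only [hr, Finset.prod_const_one, one_mul]

end Entropies

end PolarCoord

namespace PolarCoord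
open scoped Classical
open Real

/-! ### Sequential kernels -/

section Kernels

variable {n : ℕ} {B : Type*} [Fintype B]

/-- `f j v` is the probability of the letter `v j` given the earlier letters of `v`. -/
structure IsKernel (f : Fin n → (Fin n → B) → ℝ) : Prop where
  nonneg : ∀ j v, 0 ≤ f j v
  causal : ∀ j v v', (∀ i ≤ j, v i = v' i) → f j v = f j v'
  sum_eq_one : ∀ j v, ∑ b, f j (Function.update v j b) = 1

lemma sum_snoc {M : Type*} [AddCommMonoid M] (F : (Fin (n + 1) → B) → M) :
    ∑ v, F v = ∑ v : Fin n → B, ∑ b, F (Fin.snoc v b) := by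
  rw [← (Fin.snocEquiv fun _ => B).sum_comp, Fintype.sum_prod_type, Finset.sum_comm]
  rfl

lemma IsKernel.snoc_eq {f : Fin (n + 1) → (Fin (n + 1) → B) → ℝ} (hf : IsKernel f) (j : Fin n)
    (v : Fin n → B) (b b' : B) :
    f j.castSucc (Fin.snoc v b) = f j.castSucc (Fin.snoc v b') := by
  apply hf.causal
  intro i hi
  induction i using Fin.lastCases with
  | last => exact absurd (hi.trans_lt (Fin.castSucc_lt_last j)) (lt_irrefl _)
  | cast i => simp

/-- Causality makes the letter b₀ in the last place immaterial; fixing one allows induction on the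
length. -/
lemma IsKernel.init {f : Fin (n + 1) → (Fin (n + 1) → B) → ℝ} (hf : IsKernel f) (b₀ : B) :
    IsKernel fun (j : Fin n) v => f j.castSucc (Fin.snoc v b₀) := by
  refine ⟨fun j v => hf.nonneg _ _, fun j v v' h => hf.causal _ _ _ fun i hi => ?_, fun j v => ?_⟩
  · induction i using Fin.lastCases with
    | last => simp
    | cast i => simpa using h i hi
  · simp only [Fin.snoc_update]
    exact hf.sum_eq_one _ _

lemma IsKernel.sum_last {f : Fin (n + 1) → (Fin (n + 1) → B) → ℝ} (hf : IsKernel f) (b₀ : B)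
    (v : Fin n → B) : ∑ b, f (Fin.last n) (Fin.snoc v b) = 1 := by
  rw [← hf.sum_eq_one (Fin.last n) (Fin.snoc v b₀)]
  simp only [Fin.update_snoc_last]

lemma IsKernel.sum_prod [Inhabited B] {f : Fin n → (Fin n → B) → ℝ} (hf : IsKernel f) :
    ∑ v, ∏ j, f j v = 1 := by
  induction n with
  | zero => simp
  | succ n ih =>
    rw [sum_snoc, ← ih (hf.init default)]
    refine Finset.sum_congr rfl fun v _ => ?_
    simp only [Fin.prod_univ_castSucc, fun j b => hf.snoc_eq j v b default]
    rw [← Finset.mul_sum, hf.sum_last default, mul_one]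

/-- The variational distance of two sequential laws is at most the sum of the expected distances of
the steps. -/
lemma IsKernel.sum_abs_sub_le [Inhabited B] {f g : Fin n → (Fin n → B) → ℝ} (hf : IsKernel f) (hg : IsKernel g) :
    ∑ v, |∏ j, f j v - ∏ j, g j v| ≤
      ∑ j, ∑ v, (∏ l, g l v) *
        ∑ b, |f j (Function.update v j b) - g j (Function.update v j b)| := by
  induction n with
  | zero => simp
  | succ n ih =>
    rw [Fin.sum_univ_castSucc]
    simp only [sum_snoc, Fin.prod_univ_castSucc, ← Fin.snoc_update, Fin.update_snoc_last,
      fun j v b => hf.snoc_eq j v b default, fun j v b => hg.snoc_eq j v b default,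
      ← Finset.sum_mul, ← Finset.mul_sum, hg.sum_last default, mul_one]
    refine le_trans ?_ (add_le_add_left (ih (hf.init default) (hg.init default)) _)
    rw [← Finset.sum_add_distrib]
    refine Finset.sum_le_sum fun v _ => ?_
    have hG : 0 ≤ ∏ j : Fin n, g j.castSucc (Fin.snoc v default) :=
      Finset.prod_nonneg fun j _ => hg.nonneg _ _
    have h1 := hf.sum_last default v
    generalize ∏ j : Fin n, g j.castSucc (Fin.snoc v default) = G at *
    generalize ∏ j : Fin n, f j.castSucc (Fin.snoc v default) = F at *
    -- Telescoping: F f − G g = (F − G) f + G (f − g), and the last step of f sums to one.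
    calc ∑ b, |F * f (Fin.last n) (Fin.snoc v b) - G * g (Fin.last n) (Fin.snoc v b)|
        ≤ ∑ b, (|F - G| * f (Fin.last n) (Fin.snoc v b) +
            G * |f (Fin.last n) (Fin.snoc v b) - g (Fin.last n) (Fin.snoc v b)|) := by
          refine Finset.sum_le_sum fun b _ => ?_
          rw [← abs_of_nonneg (hf.nonneg (Fin.last n) (Fin.snoc v b)), ← abs_mul,
            abs_of_nonneg (hf.nonneg (Fin.last n) (Fin.snoc v b))]
          nth_rewrite 3 [← abs_of_nonneg hG]
          rw [← abs_mul]
          refine le_trans (le_of_eq ?_) (abs_add_le _ _)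
          congr 1
          ring
      _ = _ := by rw [Finset.sum_add_distrib, ← Finset.mul_sum, ← Finset.mul_sum, h1, mul_one]

end Kernels

/-! ### The sequential description of the polarized law -/

section Sequential

variable {O : Type*} {p : ZMod 2 → O → ℝ} {m : ℕ}

lemma condBit_eq [Fintype O] (p : ZMod 2 → O → ℝ) (j : Fin (2 ^ m)) (b : ZMod 2) (v : Word m)
    (o : Fin (2 ^ m) → O) :
    condBit p m j b v o =
      if bitLaw p j 0 (before j v, o) + bitLaw p j 1 (before j v, o) = 0 then 1 / 2
      else bitLaw p j b (before j v, o) /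
        (bitLaw p j 0 (before j v, o) + bitLaw p j 1 (before j v, o)) := by
  have h1 : prob (polarLaw p m) (fun w => before j w.1 = before j v ∧ w.2 = o) =
      bitLaw p j 0 (before j v, o) + bitLaw p j 1 (before j v, o) := by
    rw [bitLaw, bitLaw, ← prob_eq_jointBit_add]
    exact prob_congr fun w => by rw [Prod.mk.injEq]
  have h2 : prob (polarLaw p m) (fun w => w.1 j = b ∧ before j w.1 = before j v ∧ w.2 = o) =
      bitLaw p j b (before j v, o) :=
    prob_congr fun w => by rw [Prod.mk.injEq]
  rw [condBit, h1, h2]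

lemma condBit_congr [Fintype O] (p : ZMod 2 → O → ℝ) {j : Fin (2 ^ m)} {v v' : Word m}
    (h : ∀ i < j, v i = v' i) (b : ZMod 2) (o : Fin (2 ^ m) → O) :
    condBit p m j b v o = condBit p m j b v' o := by
  rw [condBit, condBit, before_eq_iff.2 h]

lemma decide01_congr [Fintype O] (p : ZMod 2 → O → ℝ) {j : Fin (2 ^ m)} {v v' : Word m}
    (h : ∀ i < j, v i = v' i) (o : Fin (2 ^ m) → O) :
    decide01 p m j v o = decide01 p m j v' o := by
  rw [decide01, decide01, condBit_congr p h, condBit_congr p h]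

/-- The law of the observation, from the joint law with the bit. -/
def obsLaw (p : ZMod 2 → O → ℝ) (o : O) : ℝ := p 0 o + p 1 o

lemma sum_polarLaw_word (p : ZMod 2 → O → ℝ) (o : Fin (2 ^ m) → O) :
    ∑ v, polarLaw p m (v, o) = ∏ i, obsLaw p (o i) := by
  rw [← (polarEquiv m).sum_comp]
  have e : ∀ u, polarLaw p m (polarEquiv m u, o) = ∏ i, p (u i) (o i) := fun u =>
    Finset.prod_congr rfl fun i _ =>
      congrArg (fun g => p (g i) (o i)) ((polarEquiv m).left_inv u)
  simp only [e]
  rw [sum_pi_prod fun i b => p b (o i)]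
  exact Finset.prod_congr rfl fun i _ => sum_zmod_two _

namespace IsBitLaw
variable [Fintype O] (hp : IsBitLaw p)
include hp

lemma condBit_nonneg (j : Fin (2 ^ m)) (b : ZMod 2) (v : Word m) (o : Fin (2 ^ m) → O) :
    0 ≤ condBit p m j b v o := by
  rw [condBit_eq]
  have h0 := hp.bitLaw_nonneg j 0 (before j v, o)
  have h1 := hp.bitLaw_nonneg j 1 (before j v, o)
  have hb := hp.bitLaw_nonneg j b (before j v, o)
  split_ifs <;> positivity

omit hp in
lemma condBit_add (j : Fin (2 ^ m)) (v : Word m) (o : Fin (2 ^ m) → O) :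
    condBit p m j 0 v o + condBit p m j 1 v o = 1 := by
  rw [condBit_eq, condBit_eq]
  split_ifs with h
  · norm_num
  · rw [← add_div, div_self h]

/-- Multiplying by the mass of the past removes the case distinction: for a null past both sides
vanish. -/
lemma mul_condBit (j : Fin (2 ^ m)) (b : ZMod 2) (v : Word m) (o : Fin (2 ^ m) → O) :
    (bitLaw p j 0 (before j v, o) + bitLaw p j 1 (before j v, o)) * condBit p m j b v o =
      bitLaw p j b (before j v, o) := by
  have h0 := hp.bitLaw_nonneg j 0 (before j v, o)
  have h1 := hp.bitLaw_nonneg j 1 (before j v, o)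
  rw [condBit_eq]
  split_ifs with h
  · rw [h, zero_mul]
    rcases zmod_two_cases b with rfl | rfl <;> linarith
  · field_simp

lemma condBit_isKernel (o : Fin (2 ^ m) → O) :
    IsKernel fun j (v : Word m) => condBit p m j (v j) v o := by
  refine ⟨fun j v => hp.condBit_nonneg _ _ _ _, fun j v v' h => ?_, fun j v => ?_⟩
  · rw [h j le_rfl]
    exact condBit_congr p (fun i hi => h i hi.le) _ _
  · rw [← condBit_add (p := p) j v o, sum_zmod_two]
    congr 1 <;>
    · rw [Function.update_self]
      exact condBit_congr p (fun i hi => Function.update_of_ne hi.ne _ _) _ _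

/-- Chain rule, by induction on the length of the revealed prefix. The convention of a fair bit
after a null past is harmless, as the prefix then has mass zero already. -/
lemma polarLaw_eq_prod (v : Word m) (o : Fin (2 ^ m) → O) :
    polarLaw p m (v, o) = (∏ i, obsLaw p (o i)) * ∏ j, condBit p m j (v j) v o := by
  have key : ∀ t ≤ 2 ^ m, prob (polarLaw p m) (fun w => (∀ i : Fin (2 ^ m), i.val < t → w.1 i = v i)
      ∧ w.2 = o) = (∏ i, obsLaw p (o i)) * ∏ j with j.val < t, condBit p m j (v j) v o := by
    intro t
    induction t with
    | zero =>
      intro _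
      simp only [not_lt_zero, Finset.filter_false, Finset.prod_empty, mul_one, false_imp_iff,
        implies_true, true_and]
      rw [← sum_polarLaw_word, prob_eq_sum_ite, Fintype.sum_prod_type]
      refine Finset.sum_congr rfl fun v _ => ?_
      refine (Finset.sum_eq_single o (fun o' _ h => if_neg h) ?_).trans (if_pos rfl)
      exact fun h => absurd (Finset.mem_univ o) h
    | succ t ih =>
      intro ht
      have hf : (Finset.univ.filter fun j : Fin (2 ^ m) => j.val < t + 1) =
          insert ⟨t, ht⟩ (Finset.univ.filter fun j : Fin (2 ^ m) => j.val < t) := by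
        ext j
        simp only [Finset.mem_filter, Finset.mem_univ, true_and, Finset.mem_insert, Fin.ext_iff]
        omega
      rw [hf, Finset.prod_insert (by simp), mul_left_comm, ← ih (by omega)]
      have e1 : prob (polarLaw p m)
          (fun w => (∀ i : Fin (2 ^ m), i.val < t → w.1 i = v i) ∧ w.2 = o) =
          bitLaw p ⟨t, ht⟩ 0 (before ⟨t, ht⟩ v, o) + bitLaw p ⟨t, ht⟩ 1 (before ⟨t, ht⟩ v, o) := by
        rw [bitLaw, bitLaw, ← prob_eq_jointBit_add]
        exact prob_congr fun w => by rw [Prod.mk.injEq, before_eq_iff]; rfl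
      rw [e1, mul_comm, hp.mul_condBit]
      refine prob_congr fun w => ?_
      rw [Prod.mk.injEq, before_eq_iff, ← and_assoc]
      refine and_congr_left fun _ => ⟨fun h => ⟨h _ (Nat.lt_succ_self t), fun i hi => h i
        (Nat.lt_succ_of_lt hi)⟩, ?_⟩
      rintro ⟨h1, h2⟩ i hi
      rcases (Nat.lt_succ_iff.1 hi).lt_or_eq with h | h
      · exact h2 i h
      · rwa [show i = ⟨t, ht⟩ from Fin.ext h]
  have h := key (2 ^ m) le_rfl
  simp only [Fin.is_lt, Finset.filter_true, forall_true_left] at h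
  rw [← h, prob_eq_sum_ite, Finset.sum_eq_single (v, o)]
  · simp
  · rintro ⟨v', o'⟩ _ hne
    refine if_neg ?_
    rintro ⟨h1, rfl⟩
    exact hne (by rw [show v' = v from funext h1])
  · simp

/-- The error probability of a successive cancellation decision. -/
lemma sum_decide_ne_le (j : Fin (2 ^ m)) :
    ∑ w, polarLaw p m w * (if decide01 p m j w.1 w.2 = w.1 j then 0 else 1) ≤
      bitEntropy p m j := by
  -- The decision compares joint probabilities; after a null past both rules give 0.
  have e : ∀ (v : Word m) o, decide01 p m j v o =
      if bitLaw p j 1 (before j v, o) ≤ bitLaw p j 0 (before j v, o) then 0 else 1 := by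
    intro v o
    have h0 := hp.bitLaw_nonneg j 0 (before j v, o)
    have h1 := hp.bitLaw_nonneg j 1 (before j v, o)
    rw [decide01, condBit_eq, condBit_eq]
    congr 1
    rw [eq_iff_iff]
    split_ifs with h
    · rw [show bitLaw p j 1 (before j v, o) = 0 by linarith,
        show bitLaw p j 0 (before j v, o) = 0 by linarith]
      simp
    · rw [div_le_div_iff_of_pos_right]
      exact lt_of_le_of_ne (add_nonneg h0 h1) (Ne.symm h)
  have h := sum_mul_comp (polarLaw p m) (fun w => w.1 j) (fun w => (before j w.1, w.2))
    (fun b z => if (if bitLaw p j 1 z ≤ bitLaw p j 0 z then (0 : ZMod 2) else 1) = b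
      then (0 : ℝ) else 1)
  simp only [← e] at h
  rw [h, hp.bitEntropy_eq]
  refine Finset.sum_le_sum fun z _ => ?_
  have h2 := min_le_entTerm (hp.bitLaw_nonneg j 0 z) (hp.bitLaw_nonneg j 1 z)
  have h3 := entTerm_nonneg (hp.bitLaw_nonneg j 0 z) (hp.bitLaw_nonneg j 1 z)
  rw [sum_zmod_two]
  change bitLaw p j 0 z * _ + bitLaw p j 1 z * _ ≤ _
  split_ifs with h4 h5 h6 h7 h8
  all_goals first
    | (rw [min_eq_right h4] at h2; linarith)
    | (rw [min_eq_left (le_of_not_ge h4)] at h2; linarith)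
    | simp_all

lemma sum_abs_condBit_le (j : Fin (2 ^ m)) :
    ∑ w, polarLaw p m w * |condBit p m j 0 w.1 w.2 - condBit p m j 1 w.1 w.2| ≤
      2 * √(1 - bitEntropy p m j) := by
  have h := sum_mul_comp (polarLaw p m) (fun w => w.1 j) (fun w => (before j w.1, w.2))
    (fun _ z => |(if bitLaw p j 0 z + bitLaw p j 1 z = 0 then 1 / 2
      else bitLaw p j 0 z / (bitLaw p j 0 z + bitLaw p j 1 z)) -
      (if bitLaw p j 0 z + bitLaw p j 1 z = 0 then 1 / 2
      else bitLaw p j 1 z / (bitLaw p j 0 z + bitLaw p j 1 z))|)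
  simp only [← condBit_eq] at h
  rw [h]
  refine le_trans (Finset.sum_le_sum fun z _ => ?_) (hp.sum_abs_sub_le j)
  rw [sum_zmod_two, ← add_mul]
  change (bitLaw p j 0 z + bitLaw p j 1 z) * _ ≤ _
  have hs := add_nonneg (hp.bitLaw_nonneg j 0 z) (hp.bitLaw_nonneg j 1 z)
  split_ifs with h0
  · simp [h0]
  · rw [← sub_div, abs_div, abs_of_nonneg hs, mul_div_cancel₀ _ h0]

/-- Sequential generation in which the bits of very high entropy are replaced by fair bits and the
others are approximated produces nearly the polarized law. -/
lemma sum_abs_sub_polarLaw_le {β η : ℝ} (hη : 0 ≤ η)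
    {f : Fin (2 ^ m) → Word m → (Fin (2 ^ m) → O) → ℝ} (hf : ∀ o, IsKernel fun j v => f j v o)
    (h : ∀ j, (j ∈ veryHigh p β m ∧ ∀ v o, f j v o = 1 / 2) ∨
      ∀ v o, (∏ i, obsLaw p (o i)) ≠ 0 → |f j v o - condBit p m j (v j) v o| ≤ η) :
    ∑ w : Word m × (Fin (2 ^ m) → O),
      |(∏ i, obsLaw p (w.2 i)) * ∏ j, f j w.1 w.2 - polarLaw p m w| ≤
      2 ^ m * (2 * √(threshold β m) + 2 * η) := by
  have hobs : ∀ o, 0 ≤ obsLaw p o := fun o => add_nonneg (hp.nonneg _ _) (hp.nonneg _ _)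
  have hP : ∀ o : Fin (2 ^ m) → O, 0 ≤ ∏ i, obsLaw p (o i) := fun o =>
    Finset.prod_nonneg fun i _ => hobs _
  have hc : ∀ j b (v : Word m) o, condBit p m j ((Function.update v j b) j)
      (Function.update v j b) o = condBit p m j b v o := by
    intro j b v o
    rw [Function.update_self]
    exact condBit_congr p (fun i hi => Function.update_of_ne hi.ne _ _) _ _
  -- For each observation, `IsKernel.sum_abs_sub_le` charges the steps under the true law, where the
  -- mean distance of a step is controlled by its entropy.
  calc _ ≤ ∑ o : Fin (2 ^ m) → O, (∏ i, obsLaw p (o i)) * ∑ j, ∑ v : Word m,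
        (∏ l, condBit p m l (v l) v o) * ∑ b, |f j (Function.update v j b) o -
          condBit p m j b v o| := by
        rw [Fintype.sum_prod_type, Finset.sum_comm]
        refine Finset.sum_le_sum fun o _ => ?_
        simp only [hp.polarLaw_eq_prod, ← mul_sub, abs_mul, abs_of_nonneg (hP o)]
        rw [← Finset.mul_sum]
        refine mul_le_mul_of_nonneg_left ?_ (hP o)
        have := (hf o).sum_abs_sub_le (hp.condBit_isKernel o)
        simpa only [hc] using this
    _ = ∑ j, ∑ w : Word m × (Fin (2 ^ m) → O), polarLaw p m w *
        ∑ b, |f j (Function.update w.1 j b) w.2 - condBit p m j b w.1 w.2| := by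
        simp only [Finset.mul_sum]
        rw [Finset.sum_comm]
        refine Finset.sum_congr rfl fun j _ => ?_
        rw [Fintype.sum_prod_type, Finset.sum_comm]
        refine Finset.sum_congr rfl fun v _ => Finset.sum_congr rfl fun o _ => ?_
        rw [hp.polarLaw_eq_prod]
        refine Finset.sum_congr rfl fun b _ => ?_
        ring
    _ ≤ ∑ j : Fin (2 ^ m), (2 * √(threshold β m) + 2 * η) := by
        refine Finset.sum_le_sum fun j _ => ?_
        rcases h j with ⟨hj, hfj⟩ | hfj
        -- The ℓ¹ distance of a fair bit from one with probabilities c₀, c₁ is |c₀ − c₁|, whose mean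
        -- is at most 2√(1 − H).
        · have hs : ∀ w : Word m × (Fin (2 ^ m) → O),
              ∑ b, |f j (Function.update w.1 j b) w.2 - condBit p m j b w.1 w.2| =
              |condBit p m j 0 w.1 w.2 - condBit p m j 1 w.1 w.2| := by
            intro w
            have := condBit_add (p := p) j w.1 w.2
            rw [sum_zmod_two, hfj, hfj, show condBit p m j 1 w.1 w.2 = 1 -
              condBit p m j 0 w.1 w.2 by linarith, show (1 : ℝ) / 2 - (1 - condBit p m j 0 w.1 w.2)
              = -(1 / 2 - condBit p m j 0 w.1 w.2) by ring, abs_neg,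
              show condBit p m j 0 w.1 w.2 - (1 - condBit p m j 0 w.1 w.2)
              = -(2 * (1 / 2 - condBit p m j 0 w.1 w.2)) by ring, abs_neg, abs_mul, abs_two]
            ring
          simp only [hs]
          refine (hp.sum_abs_condBit_le j).trans ?_
          have : 1 - bitEntropy p m j ≤ threshold β m := by
            have := (Finset.mem_filter.1 hj).2
            linarith
          have := Real.sqrt_le_sqrt this
          linarith
        · calc _ ≤ ∑ w : Word m × (Fin (2 ^ m) → O), polarLaw p m w * (2 * η) := by
                refine Finset.sum_le_sum fun w _ => ?_
                by_cases h0 : ∏ i, obsLaw p (w.2 i) = 0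
                · rw [show polarLaw p m w = 0 by rw [← Prod.mk.eta (p := w), hp.polarLaw_eq_prod,
                    h0, zero_mul], zero_mul, zero_mul]
                · refine mul_le_mul_of_nonneg_left ?_ (hp.polarLaw_nonneg _ _)
                  rw [sum_zmod_two, ← hc j 0, ← hc j 1]
                  linarith [hfj (Function.update w.1 j 0) w.2 h0,
                    hfj (Function.update w.1 j 1) w.2 h0]
            _ = 2 * η := by rw [← Finset.sum_mul, hp.sum_polarLaw, one_mul]
            _ ≤ _ := by linarith [Real.sqrt_nonneg (threshold β m)]
    _ = _ := by
        rw [Finset.sum_const, Finset.card_univ, Fintype.card_fin, nsmul_eq_mul]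
        push_cast
        rfl

end IsBitLaw

end Sequential

end PolarCoord

namespace PolarCoord
open scoped Classical BigOperators

/-! ### Marginals of product laws -/

section Marginals

variable {ι A : Type*} [Fintype ι] [DecidableEq ι] [Fintype A]

lemma sum_pi_eq_one {k : ι → A → ℝ} (hk : ∀ u, ∑ a, k u a = 1) :
    ∑ x : ι → A, ∏ u, k u (x u) = 1 := by
  rw [sum_pi_prod]
  simp [hk]

lemma sum_pi_apply {k : ι → A → ℝ} (hk : ∀ u, ∑ a, k u a = 1) (i : ι) (φ : A → ℝ) :
    ∑ x : ι → A, (∏ u, k u (x u)) * φ (x i) = ∑ a, k i a * φ a := by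
  have h : ∀ x : ι → A, (∏ u, k u (x u)) * φ (x i) =
      ∏ u, (k u (x u) * if u = i then φ (x u) else 1) := by
    intro x
    rw [Finset.prod_mul_distrib, Fintype.prod_ite_eq']
  simp only [h]
  rw [sum_pi_prod (fun u a => k u a * if u = i then φ a else 1),
    Finset.prod_eq_single i _ (by simp)]
  · simp
  · intro u _ hu
    simp [hu, hk]

/-- Sequences indexed by `k` blocks of length `n` and an extra block. -/
def useEquiv (k n n' : ℕ) (A : Type*) :
    ((Fin k × Fin n) ⊕ Fin n' → A) ≃ (Fin k → Fin n → A) × (Fin n' → A) :=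
  (Equiv.sumArrowEquivProdArrow _ _ _).trans ((Equiv.curry _ _ _).prodCongr (Equiv.refl _))

lemma sum_use {k n n' : ℕ} (F : ((Fin k × Fin n) ⊕ Fin n' → A) → ℝ) :
    ∑ x, F x = ∑ xb, ∑ xe, F ((useEquiv k n n' A).symm (xb, xe)) := by
  rw [← (useEquiv k n n' A).symm.sum_comp, Fintype.sum_prod_type]

lemma sum_use_block {k n n' : ℕ} {g : (Fin k × Fin n) ⊕ Fin n' → A → ℝ}
    (hg : ∀ u, ∑ a, g u a = 1) (i : Fin k) (φ : (Fin n → A) → ℝ) :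
    ∑ x : (Fin k × Fin n) ⊕ Fin n' → A, (∏ u, g u (x u)) * φ (fun j => x (.inl (i, j))) =
      ∑ x : Fin n → A, (∏ j, g (.inl (i, j)) (x j)) * φ x := by
  rw [sum_use]
  simp only [Fintype.prod_sum_type, Fintype.prod_prod_type]
  change ∑ xb : Fin k → Fin n → A, ∑ xe : Fin n' → A, ((∏ l, ∏ j, g (.inl (l, j)) (xb l j)) *
    ∏ t, g (.inr t) (xe t)) * φ (xb i) = _
  simp only [mul_right_comm _ _ (φ _), ← Finset.mul_sum]
  rw [sum_pi_eq_one fun t => hg (.inr t)]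
  simp only [mul_one]
  exact sum_pi_apply (k := fun l (x : Fin n → A) => ∏ j, g (.inl (l, j)) (x j))
    (fun l => sum_pi_eq_one fun j => hg (.inl (l, j))) i φ

lemma sum_use_extra {k n n' : ℕ} {g : (Fin k × Fin n) ⊕ Fin n' → A → ℝ}
    (hg : ∀ u, ∑ a, g u a = 1) (φ : (Fin n' → A) → ℝ) :
    ∑ x : (Fin k × Fin n) ⊕ Fin n' → A, (∏ u, g u (x u)) * φ (fun t => x (.inr t)) =
      ∑ x : Fin n' → A, (∏ t, g (.inr t) (x t)) * φ x := by
  rw [sum_use, Finset.sum_comm]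
  simp only [Fintype.prod_sum_type, Fintype.prod_prod_type]
  change ∑ xe : Fin n' → A, ∑ xb : Fin k → Fin n → A, ((∏ l, ∏ j, g (.inl (l, j)) (xb l j)) *
    ∏ t, g (.inr t) (xe t)) * φ xe = _
  simp only [mul_assoc, ← Finset.sum_mul]
  rw [sum_pi_eq_one (k := fun l (x : Fin n → A) => ∏ j, g (.inl (l, j)) (x j))
    (fun l => sum_pi_eq_one fun j => hg (.inl (l, j)))]
  simp only [one_mul]

end Marginals

/-! ### The weak law of large numbers for types -/

section LargeNumbers

variable {A : Type*} [Fintype A]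

/-- Cross terms vanish because f is centred, so second moments add up. -/
lemma sum_prod_mul_sq {P f : A → ℝ} (h1 : ∑ a, P a = 1) (hf : ∑ a, P a * f a = 0) (n : ℕ) :
    ∑ w : Fin n → A, (∏ i, P (w i)) * (∑ i, f (w i)) ^ 2 = n * ∑ a, P a * f a ^ 2 := by
  induction n with
  | zero => simp
  | succ n ih =>
    have hone := sum_pi_eq_one (ι := Fin n) (k := fun _ => P) fun _ => h1
    rw [sum_snoc]
    simp only [Fin.prod_univ_castSucc, Fin.sum_univ_castSucc, Fin.snoc_castSucc, Fin.snoc_last]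
    have e : ∀ w : Fin n → A, ∑ b, (∏ i, P (w i)) * P b * (∑ i, f (w i) + f b) ^ 2 =
        (∏ i, P (w i)) * (∑ i, f (w i)) ^ 2 + (∏ i, P (w i)) * ∑ a, P a * f a ^ 2 := by
      intro w
      have : ∀ b, (∏ i, P (w i)) * P b * (∑ i, f (w i) + f b) ^ 2 =
          (∏ i, P (w i)) * (∑ i, f (w i)) ^ 2 * P b +
          2 * (∏ i, P (w i)) * (∑ i, f (w i)) * (P b * f b) +
          (∏ i, P (w i)) * (P b * f b ^ 2) := fun b => by ring
      simp only [this, Finset.sum_add_distrib, ← Finset.mul_sum, h1, hf]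
      ring
    simp only [e, Finset.sum_add_distrib, ← Finset.sum_mul, ih, hone]
    push_cast
    ring

/-- By Cauchy–Schwarz the mean deviation of each frequency is at most its standard deviation, hence
at most 1/√n. -/
lemma sum_prod_mul_varDist_le {P : A → ℝ} (hP : P ∈ stdSimplex ℝ A) {n : ℕ} (hn : 0 < n) :
    ∑ w : Fin n → A, (∏ i, P (w i)) * varDist (empirical w) P ≤ Fintype.card A / √n := by
  have hn' : (0 : ℝ) < n := by exact_mod_cast hn
  have hle : ∀ a, P a ≤ 1 := fun a => hP.2 ▸
    Finset.single_le_sum (fun b _ => hP.1 b) (Finset.mem_univ a)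
  have hW : ∀ w : Fin n → A, 0 ≤ ∏ i, P (w i) := fun w => Finset.prod_nonneg fun i _ => hP.1 _
  have hone := sum_pi_eq_one (ι := Fin n) (k := fun _ => P) fun _ => hP.2
  have key : ∀ a, ∑ w : Fin n → A, (∏ i, P (w i)) * |empirical w a - P a| ≤ 1 / √n := by
    intro a
    have hf0 : ∑ b, P b * ((if b = a then 1 else 0) - P a) = 0 := by
      simp [mul_sub, Finset.sum_sub_distrib, ← Finset.sum_mul, hP.2]
    have hv : ∑ b, P b * ((if b = a then 1 else 0) - P a) ^ 2 ≤ 1 := by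
      refine le_of_le_of_eq (Finset.sum_le_sum fun b _ => mul_le_of_le_one_right (hP.1 b) ?_) hP.2
      have := hP.1 a
      have := hle a
      split_ifs <;> nlinarith
    have hsq := sum_prod_mul_sq hP.2 hf0 n
    have he : ∀ w : Fin n → A, |empirical w a - P a| =
        |∑ i, ((if w i = a then 1 else 0) - P a)| / n := by
      intro w
      rw [← abs_of_pos hn', ← abs_div, empirical, Finset.sum_sub_distrib,
        Finset.sum_boole, Finset.sum_const, Finset.card_univ, Fintype.card_fin, nsmul_eq_mul]
      congr 1
      field_simp
    calc _ = ∑ w : Fin n → A, (√(∏ i, P (w i)) *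
          √((∏ i, P (w i)) * (∑ i, ((if w i = a then 1 else 0) - P a)) ^ 2)) / n := by
          refine Finset.sum_congr rfl fun w _ => ?_
          rw [he, ← Real.sqrt_mul (hW w), ← mul_assoc, Real.sqrt_mul (mul_nonneg (hW w) (hW w)),
            Real.sqrt_mul_self (hW w), Real.sqrt_sq_eq_abs, mul_div_assoc]
      _ ≤ (√(∑ w : Fin n → A, ∏ i, P (w i)) * √(∑ w : Fin n → A, (∏ i, P (w i)) *
          (∑ i, ((if w i = a then 1 else 0) - P a)) ^ 2)) / n := by
          rw [← Finset.sum_div]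
          gcongr
          exact Real.sum_sqrt_mul_sqrt_le _ hW fun w => mul_nonneg (hW w) (sq_nonneg _)
      _ ≤ (1 * √n) / n := by
          rw [hone, hsq, Real.sqrt_one]
          gcongr
          nlinarith
      _ = 1 / √n := by
          rw [one_mul, Real.sqrt_div_self, one_div]
  calc _ = ∑ a, ∑ w : Fin n → A, (∏ i, P (w i)) * |empirical w a - P a| := by
        simp only [varDist, Finset.mul_sum]
        exact Finset.sum_comm
    _ ≤ ∑ a : A, 1 / √n := Finset.sum_le_sum fun a _ => key a
    _ = _ := by rw [Finset.sum_const, Finset.card_univ, nsmul_eq_mul, mul_one_div]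

lemma empirical_mem_stdSimplex {ι : Type*} [Fintype ι] [Nonempty ι] (w : ι → A) :
    empirical w ∈ stdSimplex ℝ A := by
  refine ⟨fun a => div_nonneg (Nat.cast_nonneg _) (Nat.cast_nonneg _), ?_⟩
  simp only [empirical]
  rw [← Finset.sum_div, ← Nat.cast_sum, ← Finset.card_eq_sum_card_fiberwise (f := w) (t := Finset.univ)
    (fun _ _ => Finset.mem_coe.2 (Finset.mem_univ _)), Finset.card_univ,
    div_self (Nat.cast_ne_zero.2 Fintype.card_ne_zero)]

lemma varDist_nonneg (P Q : A → ℝ) : 0 ≤ varDist P Q := Finset.sum_nonneg fun _ _ => abs_nonneg _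

lemma varDist_le_two {P Q : A → ℝ} (hP : P ∈ stdSimplex ℝ A) (hQ : Q ∈ stdSimplex ℝ A) :
    varDist P Q ≤ 2 := by
  calc varDist P Q ≤ ∑ a, (P a + Q a) := Finset.sum_le_sum fun a _ => by
        have h1 := hP.1 a
        have h2 := hQ.1 a
        exact abs_le.2 ⟨by linarith, by linarith⟩
    _ = 2 := by rw [Finset.sum_add_distrib, hP.2, hQ.2]; norm_num

lemma card_filter_use {k n n' : ℕ} (E : (Fin k × Fin n) ⊕ Fin n' → Prop) :
    (Finset.univ.filter E).card = ∑ i, (Finset.univ.filter fun j => E (.inl (i, j))).card +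
      (Finset.univ.filter fun t => E (.inr t)).card := by
  simp only [Finset.card_filter, Fintype.sum_sum_type, Fintype.sum_prod_type]

/-- The type of a concatenation is a mixture of the types of the blocks. -/
lemma varDist_empirical_use_le {k n n' : ℕ} (hn : 0 < n) (hn' : 0 < n') {P : A → ℝ}
    (hP : P ∈ stdSimplex ℝ A) (w : (Fin k × Fin n) ⊕ Fin n' → A) :
    varDist (empirical w) P ≤
      (n / (k * n + n' : ℝ)) * ∑ i, varDist (empirical fun j => w (.inl (i, j))) P +
        2 * n' / (k * n + n' : ℝ) := by
  have hn1 : (0 : ℝ) < n := by exact_mod_cast hn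
  have hn1' : (0 : ℝ) < n' := by exact_mod_cast hn'
  have hN : (0 : ℝ) < k * n + n' := by positivity
  have : Nonempty (Fin n') := ⟨⟨0, hn'⟩⟩
  have h2 := varDist_le_two (empirical_mem_stdSimplex fun t => w (.inr t)) hP
  have key : ∀ a, |empirical w a - P a| ≤ (n / (k * n + n' : ℝ)) *
      ∑ i, |empirical (fun j => w (.inl (i, j))) a - P a| +
      n' / (k * n + n' : ℝ) * |empirical (fun t => w (.inr t)) a - P a| := by
    intro a
    have e : empirical w a - P a = (n / (k * n + n' : ℝ)) *
        ∑ i, (empirical (fun j => w (.inl (i, j))) a - P a) +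
        n' / (k * n + n' : ℝ) * (empirical (fun t => w (.inr t)) a - P a) := by
      simp only [empirical, Fintype.card_sum, Fintype.card_prod, Fintype.card_fin,
        Finset.sum_sub_distrib, Finset.sum_const, Finset.card_univ, nsmul_eq_mul,
        card_filter_use, ← Finset.sum_div]
      push_cast
      field_simp
      ring
    rw [e]
    refine (abs_add_le _ _).trans ?_
    rw [abs_mul, abs_mul, abs_of_nonneg (by positivity : (0 : ℝ) ≤ n / (k * n + n')),
      abs_of_nonneg (by positivity : (0 : ℝ) ≤ n' / (k * n + n'))]
    gcongr
    exact Finset.abs_sum_le_sum_abs _ _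
  calc varDist (empirical w) P ≤ ∑ a, ((n / (k * n + n' : ℝ)) *
      ∑ i, |empirical (fun j => w (.inl (i, j))) a - P a| +
      n' / (k * n + n' : ℝ) * |empirical (fun t => w (.inr t)) a - P a|) :=
        Finset.sum_le_sum fun a _ => key a
    _ = (n / (k * n + n' : ℝ)) * ∑ i, varDist (empirical fun j => w (.inl (i, j))) P +
        n' / (k * n + n' : ℝ) * varDist (empirical fun t => w (.inr t)) P := by
        rw [Finset.sum_add_distrib, ← Finset.mul_sum, ← Finset.mul_sum, Finset.sum_comm]
        rfl
    _ ≤ _ := by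
        have : n' / (k * n + n' : ℝ) * varDist (empirical fun t => w (.inr t)) P ≤
            n' / (k * n + n' : ℝ) * 2 := by gcongr
        have e : n' / (k * n + n' : ℝ) * 2 = 2 * n' / (k * n + n' : ℝ) := by ring
        linarith

end LargeNumbers

/-! ### Replacing stochastic codes by deterministic ones -/

section Derandomize

/-- The minimum over the support is at most the mean. Staying in the support keeps the values of the
deterministic codes among the possible outputs. -/
lemma exists_pos_le_sum {A : Type*} [Fintype A] {w : A → ℝ} (hw : w ∈ stdSimplex ℝ A) (φ : A → ℝ) :
    ∃ a, 0 < w a ∧ φ a ≤ ∑ b, w b * φ b := by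
  have hne : (Finset.univ.filter fun a => 0 < w a).Nonempty := by
    by_contra h
    rw [Finset.not_nonempty_iff_eq_empty, Finset.filter_eq_empty_iff] at h
    have : ∑ a, w a = 0 := Finset.sum_eq_zero fun a ha => le_antisymm (not_lt.1 (h ha)) (hw.1 a)
    rw [hw.2] at this
    exact one_ne_zero this
  obtain ⟨a, ha, hmin⟩ := Finset.exists_min_image _ φ hne
  refine ⟨a, (Finset.mem_filter.1 ha).2, ?_⟩
  calc φ a = ∑ b, w b * φ a := by rw [← Finset.sum_mul, hw.2, one_mul]
    _ ≤ _ := by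
      refine Finset.sum_le_sum fun b _ => ?_
      rcases (hw.1 b).eq_or_lt with h | h
      · simp [← h]
      · exact mul_le_mul_of_nonneg_left
          (hmin b (Finset.mem_filter.2 ⟨Finset.mem_univ b, h⟩)) h.le

variable {ι C S X Y T : Type*} [Fintype ι] [Fintype C] [Fintype S] [Fintype X] [Fintype Y]
  [Fintype T] {PS : S → ℝ} {W : X → Y → ℝ}

lemma failProb_nonneg (hPS : ∀ s, 0 ≤ PS s) (hW : ∀ x y, 0 ≤ W x y) (P : S × X × Y × T → ℝ) (ε : ℝ)
    {enc : (ι → S) → C → (ι → X) → ℝ} {dec : (ι → Y) → C → (ι → T) → ℝ}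
    (henc : ∀ s c x, 0 ≤ enc s c x) (hdec : ∀ y c t, 0 ≤ dec y c t) :
    0 ≤ failProb PS W P ε enc dec := by
  refine div_nonneg ?_ (Nat.cast_nonneg _)
  refine Finset.sum_nonneg fun c _ => Finset.sum_nonneg fun s _ => Finset.sum_nonneg fun x _ =>
    Finset.sum_nonneg fun y _ => Finset.sum_nonneg fun t _ => ?_
  refine mul_nonneg (mul_nonneg (mul_nonneg (mul_nonneg ?_ (henc _ _ _)) ?_) (hdec _ _ _)) ?_
  · exact Finset.prod_nonneg fun i _ => hPS _
  · exact Finset.prod_nonneg fun i _ => hW _ _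
  · split_ifs <;> norm_num

/-- For a fixed decoder the failure probability is linear in `enc s c`, separately for each s and c,
so each law can be replaced by its best atom. -/
lemma exists_detKernel_enc (P : S × X × Y × T → ℝ) (ε : ℝ)
    {enc : (ι → S) → C → (ι → X) → ℝ} (dec : (ι → Y) → C → (ι → T) → ℝ) (hPS : ∀ s, 0 ≤ PS s)
    (henc : ∀ s c, enc s c ∈ stdSimplex ℝ (ι → X)) :
    ∃ f : (ι → S) → C → (ι → X), (∀ s c, 0 < enc s c (f s c)) ∧
      failProb PS W P ε (detKernel f) dec ≤ failProb PS W P ε enc dec := by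
  let Φ : C → (ι → S) → (ι → X) → ℝ := fun c s x => ∑ y : ι → Y, ∑ t : ι → T,
    (∏ i, W (x i) (y i)) * dec y c t *
      (if ε < varDist (empirical fun i => (s i, x i, y i, t i)) P then 1 else 0)
  have e : ∀ enc' : (ι → S) → C → (ι → X) → ℝ, failProb PS W P ε enc' dec =
      (∑ c : C, ∑ s : ι → S, (∏ i, PS (s i)) * ∑ x : ι → X, enc' s c x * Φ c s x) /
        (Fintype.card C : ℝ) := by
    intro enc'
    rw [failProb]
    congr 1
    refine Finset.sum_congr rfl fun c _ => Finset.sum_congr rfl fun s _ => ?_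
    simp only [Φ, Finset.mul_sum]
    refine Finset.sum_congr rfl fun x _ => Finset.sum_congr rfl fun y _ =>
      Finset.sum_congr rfl fun t _ => ?_
    ring
  choose f hf using fun s c => exists_pos_le_sum (henc s c) (Φ c s)
  refine ⟨f, fun s c => (hf s c).1, ?_⟩
  rw [e, e]
  refine div_le_div_of_nonneg_right (Finset.sum_le_sum fun c _ => Finset.sum_le_sum fun s _ =>
    mul_le_mul_of_nonneg_left ?_ (Finset.prod_nonneg fun i _ => hPS _)) (Nat.cast_nonneg _)
  simpa [detKernel] using (hf s c).2

lemma exists_detKernel_dec (P : S × X × Y × T → ℝ) (ε : ℝ)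
    (enc : (ι → S) → C → (ι → X) → ℝ) {dec : (ι → Y) → C → (ι → T) → ℝ}
    (hdec : ∀ y c, dec y c ∈ stdSimplex ℝ (ι → T)) :
    ∃ g : (ι → Y) → C → (ι → T), (∀ y c, 0 < dec y c (g y c)) ∧
      failProb PS W P ε enc (detKernel g) ≤ failProb PS W P ε enc dec := by
  let Φ : C → (ι → Y) → (ι → T) → ℝ := fun c y t => ∑ s : ι → S, ∑ x : ι → X,
    (∏ i, PS (s i)) * enc s c x * (∏ i, W (x i) (y i)) *
      (if ε < varDist (empirical fun i => (s i, x i, y i, t i)) P then 1 else 0)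
  have e : ∀ dec' : (ι → Y) → C → (ι → T) → ℝ, failProb PS W P ε enc dec' =
      (∑ c : C, ∑ y : ι → Y, ∑ t : ι → T, dec' y c t * Φ c y t) / (Fintype.card C : ℝ) := by
    intro dec'
    rw [failProb]
    congr 1
    refine Finset.sum_congr rfl fun c _ => ?_
    simp only [Φ, Finset.mul_sum]
    calc _ = ∑ s : ι → S, ∑ y : ι → Y, ∑ x : ι → X, ∑ t : ι → T, _ :=
          Finset.sum_congr rfl fun s _ => Finset.sum_comm
      _ = ∑ y : ι → Y, ∑ s : ι → S, ∑ x : ι → X, ∑ t : ι → T, _ := Finset.sum_comm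
      _ = _ := by
          refine Finset.sum_congr rfl fun y _ => ?_
          rw [Finset.sum_congr rfl fun s _ => Finset.sum_comm, Finset.sum_comm]
          refine Finset.sum_congr rfl fun t _ => Finset.sum_congr rfl fun s _ =>
            Finset.sum_congr rfl fun x _ => ?_
          ring
  choose g hg using fun y c => exists_pos_le_sum (hdec y c) (Φ c y)
  refine ⟨g, fun y c => (hg y c).1, ?_⟩
  rw [e, e]
  refine div_le_div_of_nonneg_right (Finset.sum_le_sum fun c _ => Finset.sum_le_sum fun y _ =>
    ?_) (Nat.cast_nonneg _)
  simpa [detKernel] using (hg y c).2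

end Derandomize

end PolarCoord

namespace PolarCoord
open scoped Classical BigOperators

/-! ### Markov chains driven by reused one-time pads -/

section Chain

variable {St G : Type*} [Fintype St]

/-- The law of the state at time `i`, from the initial law and the transition weights. -/
noncomputable def stateLaw (U : St → ℝ) (M : ℕ → St → St → ℝ) : ℕ → St → ℝ
  | 0, st => U st
  | i + 1, st => ∑ st', stateLaw U M i st' * M i st' st

/-- States after time i sum out because the weights are normalized; those before i build up
`stateLaw`. -/
lemma sum_path {U : St → ℝ} {M : ℕ → St → St → ℝ} (hM : ∀ i st, ∑ st', M i st st' = 1) (k : ℕ) :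
    ∀ (i : Fin (k + 1)) (φ : St → ℝ),
      ∑ a : Fin (k + 1) → St, (U (a 0) * ∏ l : Fin k, M l (a l.castSucc) (a l.succ)) * φ (a i) =
        ∑ st, stateLaw U M i st * φ st := by
  induction k with
  | zero =>
    intro i φ
    have hi : i = 0 := Fin.ext (by omega)
    subst hi
    rw [sum_snoc, Fintype.sum_unique]
    refine Finset.sum_congr rfl fun st _ => ?_
    rw [show (0 : Fin 1) = Fin.last 0 from rfl, Fin.snoc_last]
    simp [stateLaw]
  | succ k ih =>
    intro i φ
    rw [sum_snoc]
    simp only [Fin.prod_univ_castSucc, Fin.snoc_apply_zero, ← Fin.castSucc_succ, Fin.snoc_castSucc,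
      Fin.succ_last, Fin.snoc_last, Fin.val_castSucc, Fin.val_last]
    induction i using Fin.lastCases with
    | last =>
      simp only [Fin.snoc_last, Fin.val_last, stateLaw]
      have h := ih (Fin.last k) fun st => ∑ st', M k st st' * φ st'
      simp only [Fin.val_last] at h
      calc _ = ∑ v : Fin (k + 1) → St, (U (v 0) * ∏ l : Fin k, M l (v l.castSucc) (v l.succ)) *
            ∑ st', M k (v (Fin.last k)) st' * φ st' := by
            refine Finset.sum_congr rfl fun v _ => ?_
            rw [Finset.mul_sum]
            exact Finset.sum_congr rfl fun b _ => by ring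
        _ = _ := by
            rw [h]
            simp only [Finset.mul_sum, Finset.sum_mul]
            rw [Finset.sum_comm]
            exact Finset.sum_congr rfl fun b _ => Finset.sum_congr rfl fun c _ => by ring
    | cast i =>
      simp only [Fin.snoc_castSucc, Fin.val_castSucc]
      rw [← ih i φ]
      refine Finset.sum_congr rfl fun v _ => ?_
      simp only [← mul_assoc, ← Finset.sum_mul, ← Finset.mul_sum, hM, mul_one]

lemma sum_stateLaw {U : St → ℝ} {M : ℕ → St → St → ℝ} (hU : ∑ st, U st = 1)
    (hM : ∀ i st, ∑ st', M i st st' = 1) (i : ℕ) : ∑ st, stateLaw U M i st = 1 := by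
  induction i with
  | zero => exact hU
  | succ i ih =>
    simp only [stateLaw]
    rw [Finset.sum_comm]
    simp only [← Finset.mul_sum, hM, mul_one, ih]

/-- Path weights written with the index of the preceding state. -/
lemma sum_path' {U : St → ℝ} {M : ℕ → St → St → ℝ} (hM : ∀ i st, ∑ st', M i st st' = 1) {k : ℕ}
    (i : Fin k) (φ : St → ℝ) :
    ∑ a : Fin k → St, (∏ l : Fin k, if 0 < l.val then
        M (l.val - 1) (a ⟨l.val - 1, (Nat.sub_le _ _).trans_lt l.isLt⟩) (a l) else U (a l)) *
      φ (a i) = ∑ st, stateLaw U M i st * φ st := by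
  cases k with
  | zero => exact i.elim0
  | succ k =>
    rw [← sum_path hM k i φ]
    refine Finset.sum_congr rfl fun a _ => ?_
    rw [Fin.prod_univ_succ]
    rfl

/-- Redrawing one coordinate of a uniform family leaves it uniform. -/
lemma expect_update {ι : Type*} [Fintype ι] [DecidableEq ι] [Fintype G] [Nonempty G] (a : ι) (F : (ι → G) → ℝ) :
    𝔼 key, F key = 𝔼 key, 𝔼 x, F (Function.update key a x) := by
  let e := Equiv.funSplitAt a G
  have h1 : 𝔼 key, F key = 𝔼 z : G × ({j // j ≠ a} → G), F (e.symm z) :=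
    Fintype.expect_equiv e _ _ fun key => by rw [Equiv.symm_apply_apply]
  have h2 : 𝔼 key, 𝔼 x, F (Function.update key a x) =
      𝔼 z : G × ({j // j ≠ a} → G), 𝔼 x, F (e.symm (x, z.2)) := by
    refine Fintype.expect_equiv e _ _ fun key => Finset.expect_congr rfl fun x _ => ?_
    congr 1
  rw [h1, h2, ← Finset.univ_product_univ, Finset.expect_product, Finset.expect_product,
    Finset.expect_comm]
  exact (Fintype.expect_const _).symm

variable [Fintype G] [AddCommGroup G] {p : ℕ}

/-- The schedule of the keys: in each of `p` rounds, the `p` cyclic keys are used in turn, and then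
a fresh key ends the round. -/
def keySchedule (p : ℕ) (hp : 0 < p) (i : ℕ) : Fin p ⊕ Fin p :=
  if h : i % (p + 1) < p then .inl ⟨i % (p + 1), h⟩ else .inr ⟨i / (p + 1) % p, Nat.mod_lt _ hp⟩

lemma keySchedule_inl (hp : 0 < p) (r : ℕ) {t : ℕ} (ht : t < p) :
    keySchedule p hp (r * (p + 1) + t) = .inl ⟨t, ht⟩ := by
  have h : (r * (p + 1) + t) % (p + 1) = t := by
    rw [Nat.mul_add_mod', Nat.mod_eq_of_lt (by omega)]
  simp only [keySchedule, h, ht, dif_pos]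

lemma keySchedule_inr (hp : 0 < p) {r : ℕ} (hr : r < p) :
    keySchedule p hp (r * (p + 1) + p) = .inr ⟨r, hr⟩ := by
  have h : (r * (p + 1) + p) % (p + 1) = p := by
    rw [Nat.mul_add_mod', Nat.mod_eq_of_lt (by omega)]
  have h2 : (r * (p + 1) + p) / (p + 1) = r := by
    rw [add_comm, Nat.add_mul_div_right _ _ (by omega), Nat.div_eq_of_lt (by omega), zero_add]
  simp only [keySchedule, h, lt_irrefl, dif_neg, not_false_eq_true, h2, Nat.mod_eq_of_lt hr]

/-- The transition weights of a chain in which a word `r st` of the current state is padded with the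
scheduled key and passed on. -/
def padStep (hp : 0 < p) (r : St → G) (M : G → St → ℝ) (key : Fin p ⊕ Fin p → G) (i : ℕ)
    (st st' : St) : ℝ := M (r st + key (keySchedule p hp i)) st'

variable (hp : 0 < p) {U : St → ℝ} {r : St → G} {M : G → St → ℝ}

omit [Fintype G] in
-- The state at time i depends only on the keys scheduled before i.
lemma stateLaw_update (a : Fin p ⊕ Fin p) (x : G) (key : Fin p ⊕ Fin p → G) (i : ℕ)
    (h : ∀ l < i, keySchedule p hp l ≠ a) :
    stateLaw U (padStep hp r M (Function.update key a x)) i =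
      stateLaw U (padStep hp r M key) i := by
  induction i with
  | zero => rfl
  | succ i ih =>
    funext st
    simp only [stateLaw, padStep, Function.update_of_ne (h i (Nat.lt_succ_self i))]
    rw [ih fun l hl => h l (hl.trans (Nat.lt_succ_self i))]

omit [Fintype St] [Fintype G] in
lemma keySchedule_ne_inr {q : ℕ} (hq : q < p) {l : ℕ} (hl : l < q * (p + 1) + p) :
    keySchedule p hp l ≠ .inr ⟨q, hq⟩ := by
  intro h
  simp only [keySchedule] at h
  split_ifs at h with h1
  rw [Sum.inr.injEq, Fin.mk.injEq] at h
  have h2 : l / (p + 1) < p := by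
    rw [Nat.div_lt_iff_lt_mul (by omega)]
    nlinarith
  rw [Nat.mod_eq_of_lt h2] at h
  have h3 := Nat.div_add_mod l (p + 1)
  rw [h] at h3
  nlinarith

variable (hMU : ∀ st, 𝔼 w, M w st = U st) (hU : ∑ st, U st = 1) (hM : ∀ w, ∑ st, M w st = 1)
include hMU hU hM

/-- A key used for the first time is independent of the state, so the padded word is uniform
whatever the word was, and averaging over the key turns every transition into U. -/
lemma expect_stateLaw_succ (key : Fin p ⊕ Fin p → G) (i : ℕ)
    (h : ∀ l < i, keySchedule p hp l ≠ keySchedule p hp i) (st : St) :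
    𝔼 x, stateLaw U (padStep hp r M (Function.update key (keySchedule p hp i) x)) (i + 1) st =
      U st := by
  simp only [stateLaw, stateLaw_update hp _ _ key i h]
  simp only [padStep, Function.update_self]
  rw [Finset.expect_sum_comm]
  simp only [← Finset.mul_expect]
  have e : ∀ g : G, 𝔼 x, M (g + x) st = U st := fun g => by
    rw [← hMU st]
    exact Fintype.expect_equiv (Equiv.addLeft g) _ _ fun x => rfl
  simp only [e, ← Finset.sum_mul]
  rw [sum_stateLaw (M := padStep hp r M key) hU (fun i st => hM _) i, one_mul]

/-- Resetting the last fresh key makes the law in a round the same as in the first round. -/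
lemma expect_stateLaw_round (key : Fin p ⊕ Fin p → G) {q : ℕ} (hq : q < p) (t : ℕ) (ht : t ≤ p)
    (st : St) :
    𝔼 x, stateLaw U (padStep hp r M (Function.update key (.inr ⟨q, hq⟩) x))
      ((q + 1) * (p + 1) + t) st = stateLaw U (padStep hp r M key) t st := by
  -- The fresh key restores U at the start of round q + 1. From there the transitions are those of
  -- the first round with the same cyclic keys, and the evolution is linear in the law.
  induction t generalizing st with
  | zero =>
    have h := expect_stateLaw_succ hp hMU hU hM (r := r) key (q * (p + 1) + p)
      (by rw [keySchedule_inr hp hq]; exact fun l hl => keySchedule_ne_inr hp hq hl) st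
    rw [keySchedule_inr hp hq] at h
    rw [show (q + 1) * (p + 1) + 0 = q * (p + 1) + p + 1 by ring]
    exact h
  | succ t ih =>
    have h1 : keySchedule p hp ((q + 1) * (p + 1) + t) = .inl ⟨t, ht⟩ := keySchedule_inl hp _ ht
    have h2 : keySchedule p hp t = .inl ⟨t, ht⟩ := by
      have := keySchedule_inl hp 0 ht
      rwa [zero_mul, zero_add] at this
    rw [← add_assoc]
    simp only [stateLaw, ← ih (by omega), padStep, h1, h2]
    rw [Finset.expect_sum_comm]
    refine Finset.sum_congr rfl fun st' _ => ?_
    rw [Finset.expect_mul]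
    refine Finset.expect_congr rfl fun x _ => ?_
    rw [Function.update_of_ne (by simp)]

/-- With the scheduled keys, the law of every state equals the initial law, on average over the
keys. -/
theorem expect_stateLaw (i : ℕ) (hi : i < p * (p + 1)) (st : St) :
    𝔼 key, stateLaw U (padStep hp r M key) i st = U st := by
  -- Within the first round every cyclic key is used for the first time.
  have hfirst : ∀ t ≤ p, 𝔼 key, stateLaw U (padStep hp r M key) t st = U st := by
    intro t ht
    cases t with
    | zero => simp only [stateLaw]; exact Fintype.expect_const _
    | succ t =>
      refine (expect_update (keySchedule p hp t) fun key =>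
        stateLaw U (padStep hp r M key) (t + 1) st).trans ?_
      have hne : ∀ l < t, keySchedule p hp l ≠ keySchedule p hp t := by
        intro l hl
        have h1 := keySchedule_inl hp 0 (show l < p by omega)
        have h2 := keySchedule_inl hp 0 (show t < p by omega)
        rw [zero_mul, zero_add] at h1 h2
        rw [h1, h2, Ne, Sum.inl.injEq, Fin.mk.injEq]
        omega
      simp only [expect_stateLaw_succ hp hMU hU hM _ t hne]
      exact Fintype.expect_const _
  obtain ⟨q, t, ht, rfl⟩ : ∃ q t, t ≤ p ∧ i = q * (p + 1) + t :=
    ⟨i / (p + 1), i % (p + 1), Nat.lt_succ_iff.1 (Nat.mod_lt _ (Nat.succ_pos p)),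
      (Nat.div_add_mod' i (p + 1)).symm⟩
  cases q with
  | zero => simpa using hfirst t ht
  | succ q =>
    -- Round q + 1 follows the fresh key of index q, which exists since i < p(p + 1).
    have hq : q < p := by nlinarith
    refine (expect_update (Sum.inr ⟨q, hq⟩) fun key =>
      stateLaw U (padStep hp r M key) ((q + 1) * (p + 1) + t) st).trans ?_
    simp only [expect_stateLaw_round hp hMU hU hM _ hq t ht]
    exact hfirst t ht

end Chain

end PolarCoord

namespace PolarCoord
open scoped Classical BigOperators

/-! ### Correctness of the decoder -/

/-- A successively filled word is the unique solution of its recursion, so statements about encoder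
and decoder are proved by checking that a candidate solves it. -/
lemma seqFill_eq_iff {n : ℕ} {rule : Fin n → (Fin n → ZMod 2) → ZMod 2} {z : Fin n → ZMod 2} :
    seqFill rule = z ↔ ∀ t, z t = rule t fun i => if i < t then z i else 0 := by
  constructor
  · rintro rfl t
    rw [seqFill]
    rfl
  · intro h
    have key : ∀ N : ℕ, ∀ t : Fin n, t.val = N → seqFill rule t = z t := by
      intro N
      induction N using Nat.strong_induction_on with
      | _ N ih =>
        intro t ht
        rw [seqFill, h t]
        congr 1
        funext i
        by_cases hi : i < t
        · rw [dif_pos hi, if_pos hi]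
          exact ih i.val (by omega) i rfl
        · rw [dif_neg hi, if_neg hi]
    exact funext fun t => key _ t rfl

namespace Choice

variable {S X Y T : Type*} [Fintype S] [Fintype X] [Fintype Y] [Fintype T]
  {L : AuxLaw S X Y T} {β : ℝ} {m : ℕ} (κ : Choice L β m) (c : κ.Common)

lemma mem_A3_of_mem {j : Fin (2 ^ m)} (h : j ∈ κ.R ∨ j ∈ κ.E ∨ j ∈ κ.D) : j ∈ L.A3 β m := by
  rw [← κ.cover]
  simpa only [Finset.mem_union, or_assoc] using h

lemma disjoint_A1_A2 (L : AuxLaw S X Y T) (β : ℝ) (m : ℕ) {j : Fin (2 ^ m)} (h : j ∈ L.A2 β m) :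
    j ∉ L.A1 β m := fun h1 =>
  (Finset.mem_sdiff.1 h).2 (Finset.mem_inter.1 h1).2

lemma notMem_A1_of_A3 (L : AuxLaw S X Y T) (β : ℝ) (m : ℕ) {j : Fin (2 ^ m)} (h : j ∈ L.A3 β m) :
    j ∉ L.A1 β m := fun h1 =>
  (Finset.mem_sdiff.1 h).2 (Finset.mem_inter.1 h1).1

lemma notMem_A2_of_A3 (L : AuxLaw S X Y T) (β : ℝ) (m : ℕ) {j : Fin (2 ^ m)} (h : j ∈ L.A3 β m) :
    j ∉ L.A2 β m := fun h1 =>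
  (Finset.mem_sdiff.1 h).2 (Finset.mem_sdiff.1 h1).1

lemma sharedBit_congr {j : Fin (2 ^ m)} (h : j ∈ κ.D) {v v' : Word m} (hv : ∀ i < j, v i = v' i) :
    κ.sharedBit c j h v = κ.sharedBit c j h v' := by
  rw [sharedBit, sharedBit, condBit_congr _ hv]

lemma mem_msg {i : Fin κ.k} {j : Fin (2 ^ m)} :
    (i, j) ∈ κ.msg ↔ j ∈ κ.E ∨ (i.val + 1 = κ.k ∧ j ∈ κ.R) := by
  simp [msg]

lemma place_injOn_msg : Set.InjOn κ.place κ.msg := by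
  have h := κ.place_inj
  convert h using 1
  ext p
  simp [msg]

lemma filter_place_eq {p : Fin κ.k × Fin (2 ^ m)} (hp : p ∈ κ.msg) :
    κ.msg.filter (fun p' => κ.place p' = κ.place p) = {p} := by
  ext p'
  simp only [Finset.mem_filter, Finset.mem_singleton]
  exact ⟨fun h => κ.place_injOn_msg h.1 hp h.2, by rintro rfl; exact ⟨hp, rfl⟩⟩

lemma filter_τ_eq {l : Fin (2 ^ m)} (hl : l ∈ κ.R) :
    κ.R.filter (fun l' => κ.τ l' = κ.τ l) = {l} := by
  ext l'
  simp only [Finset.mem_filter, Finset.mem_singleton]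
  exact ⟨fun h => κ.τ_inj h.1 hl h.2, by rintro rfl; exact ⟨hl, rfl⟩⟩

lemma slots_subset {t : Fin (2 ^ κ.mx)} (ht : t ∈ κ.slots) :
    t ∈ veryHigh κ.lawB β κ.mx \ high κ.lawBY β κ.mx := by
  obtain ⟨⟨i, j⟩, hp, rfl⟩ := Finset.mem_image.1 ht
  exact κ.place_maps i j (κ.mem_msg.1 hp)

lemma channelWord_eq_iff {f : Fin (2 ^ κ.mx) → Word κ.mx → ZMod 2} {z : Word κ.mx} :
    κ.channelWord c f = z ↔ ∀ t, z t =
      if t ∈ κ.slots then f t (fun i => if i < t then z i else 0)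
      else if h : t ∈ κ.frozen then c.2.2.2.1 ⟨t, h⟩
      else if h : t ∈ κ.drawn then
        seedBit κ.b (c.2.2.2.2 ⟨t, h⟩) (condBit κ.lawB κ.mx t 1 z fun _ => ())
      else 0 := by
  rw [channelWord, seqFill_eq_iff]
  refine forall_congr' fun t => ?_
  have : condBit κ.lawB κ.mx t 1 (fun i => if i < t then z i else 0) (fun _ => ()) =
      condBit κ.lawB κ.mx t 1 z fun _ => () :=
    condBit_congr _ (fun i hi => if_pos hi) _ _
  rw [this]

lemma encExtra_place (v : Fin κ.k → Word m) {p : Fin κ.k × Fin (2 ^ m)} (hp : p ∈ κ.msg) :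
    κ.encExtra c v (κ.place p) = v p.1 p.2 + c.2.1 (κ.padX p) := by
  have h := (κ.channelWord_eq_iff c (z := κ.encExtra c v)).1 rfl (κ.place p)
  rw [if_pos (show κ.place p ∈ κ.slots from Finset.mem_image_of_mem _ hp), κ.filter_place_eq hp,
    Finset.sum_singleton] at h
  exact h

/-- Some decision of the successive cancellation decoder, with the true past, is wrong. -/
def blockError (L : AuxLaw S X Y T) (β : ℝ) {m : ℕ} (v : Word m) (y : Fin (2 ^ m) → Y) : Prop :=
  ∃ j, j ∉ high L.lawUY β m ∧ decide01 L.lawUY m j v y ≠ v j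

/-- Some decision of the decoder of the extra block, with the true past, is wrong. -/
def extraError (z : Word κ.mx) (y : Fin (2 ^ κ.mx) → Y) : Prop :=
  ∃ t, t ∉ high κ.lawBY β κ.mx ∧ decide01 κ.lawBY κ.mx t z y ≠ z t

variable {c}

/-- The true word solves the recursion of the decoder: outside the slots both nodes follow the same
rule, and in a slot the decision is right given the true past. Hence errors need to be counted with
the true past only. -/
lemma decExtra_eq {v : Fin κ.k → Word m} {y : κ.Use → Y}
    (h : ¬κ.extraError (κ.encExtra c v) (κ.extra y)) : κ.decExtra c y = κ.encExtra c v := by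
  rw [decExtra, channelWord_eq_iff]
  intro t
  have ht := (κ.channelWord_eq_iff c (z := κ.encExtra c v)).1 rfl t
  by_cases hs : t ∈ κ.slots
  · rw [if_pos hs, decide01_congr _ (fun i hi => if_pos hi)]
    by_contra hne
    exact h ⟨t, (Finset.mem_sdiff.1 (κ.slots_subset hs)).2, fun e => hne e.symm⟩
  · rw [if_neg hs] at ht ⊢
    exact ht

lemma decMsg_eq {v : Fin κ.k → Word m} {y : κ.Use → Y}
    (h : ¬κ.extraError (κ.encExtra c v) (κ.extra y)) {p : Fin κ.k × Fin (2 ^ m)}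
    (hp : p ∈ κ.msg) : κ.decMsg c y p = v p.1 p.2 := by
  rw [decMsg, κ.decExtra_eq h, κ.encExtra_place c v hp, add_assoc, CharTwo.add_self_eq_zero,
    add_zero]

/-- Without wrong decisions, the decoder recovers the polarized words of all blocks. -/
theorem decChain_eq {s : Fin κ.k → Fin (2 ^ m) → S} {v : Fin κ.k → Word m} {y : κ.Use → Y}
    (hv : ∀ i j, κ.encStep c s v i j ≠ 0) (hx : ¬κ.extraError (κ.encExtra c v) (κ.extra y))
    (hb : ∀ i, ¬blockError L β (v i) (κ.blocks y i)) (i : Fin κ.k) : κ.decChain c y i = v i := by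
  have key : ∀ N : ℕ, ∀ i : Fin κ.k, κ.k - i.val = N → κ.decChain c y i = v i := by
    intro N
    induction N using Nat.strong_induction_on with
    | _ N ih =>
      intro i hi
      rw [decChain, decBlock, seqFill_eq_iff]
      intro j
      -- Positive weight forces the prescribed value wherever the rule of the encoder is
      -- deterministic.
      have hij := hv i j
      rw [encStep] at hij
      by_cases h1 : j ∈ L.A1 β m
      · rw [dif_pos h1] at hij ⊢
        by_contra hne
        exact hij (if_neg hne)
      rw [dif_neg h1] at hij ⊢
      by_cases h2 : j ∈ κ.D
      · rw [if_neg (notMem_A2_of_A3 L β m (κ.mem_A3_of_mem (.inr (.inr h2)))), dif_pos h2] at hij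
        rw [dif_pos h2, κ.sharedBit_congr c h2 (v' := v i) fun i hi => if_pos hi]
        by_contra hne
        exact hij (if_neg hne)
      rw [dif_neg h2]
      by_cases h3 : j ∈ L.A3 β m
      · rw [if_pos h3]
        by_cases hR : j ∈ κ.R
        · rw [if_pos hR]
          split_ifs with hk
          -- The next block is already decoded, and its bit in position `κ.τ j` is the wanted bit
          -- plus a pad, which cancels.
          · rw [ih (κ.k - (i.val + 1)) (by omega) ⟨i.val + 1, hk⟩ rfl]
            have hτ := hv ⟨i.val + 1, hk⟩ (κ.τ j)
            rw [encStep, dif_neg (disjoint_A1_A2 L β m (κ.τ_maps j hR)), if_pos (κ.τ_maps j hR),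
              if_pos ⟨Nat.succ_pos _, Finset.mem_image_of_mem _ hR⟩] at hτ
            simp only [κ.filter_τ_eq hR, Finset.sum_singleton, Nat.add_sub_cancel] at hτ
            have e : v ⟨i.val + 1, hk⟩ (κ.τ j) = v i j + c.2.1 (κ.padR i j) := by
              by_contra hne
              exact hτ (if_neg hne)
            rw [e, add_assoc, CharTwo.add_self_eq_zero, add_zero]
          · exact (κ.decMsg_eq hx (κ.mem_msg.2 (.inr ⟨by omega, hR⟩))).symm
        · rw [if_neg hR]
          have hE : j ∈ κ.E := by
            rw [← κ.cover, Finset.mem_union, Finset.mem_union] at h3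
            tauto
          exact (κ.decMsg_eq hx (κ.mem_msg.2 (.inl hE))).symm
      -- A position outside A₁ and A₃ lies outside ℋ, where no decision is wrong by hypothesis.
      · rw [if_neg h3, decide01_congr _ (v' := v i) (fun i hi => if_pos hi)]
        by_contra hne
        refine hb i ⟨j, fun hh => ?_, fun e => hne e.symm⟩
        simp only [AuxLaw.A1, AuxLaw.A3, Finset.mem_inter, Finset.mem_sdiff, not_and, not_not]
          at h1 h3
        exact h1 (h3 hh) hh
  exact key _ i rfl

end Choice

end PolarCoord

namespace PolarCoord
open scoped Classical BigOperators

/-! ### Averages over the common randomness -/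

section Averages

variable {ι Ξ : Type*} [Fintype ι] [DecidableEq ι] [Fintype Ξ]

lemma expect_prod_pi (F : ι → Ξ → ℝ) :
    𝔼 c : ι → Ξ, ∏ a, F a (c a) = ∏ a, 𝔼 x, F a x := by
  simp only [Fintype.expect_eq_sum_div_card]
  rw [sum_pi_prod, Finset.prod_div_distrib, Finset.prod_const, Fintype.card_fun, Finset.card_univ,
    Nat.cast_pow]

lemma prod_dite_subtype (A : Finset ι) (F : A → ℝ) :
    (∏ j, if h : j ∈ A then F ⟨j, h⟩ else 1) = ∏ a, F a := by
  rw [← Finset.prod_subset (Finset.subset_univ A) fun j _ hj => dif_neg hj,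
    ← Finset.prod_coe_sort A]
  exact Finset.prod_congr rfl fun a _ => dif_pos a.2

lemma expect_prod_dite (A : Finset ι) (F : ι → Ξ → ℝ) :
    𝔼 c : A → Ξ, (∏ j, if h : j ∈ A then F j (c ⟨j, h⟩) else 1) =
      ∏ j, if j ∈ A then 𝔼 x, F j x else 1 := by
  have h1 : ∀ c : A → Ξ, (∏ j, if h : j ∈ A then F j (c ⟨j, h⟩) else 1) =
      ∏ a : A, F a (c a) := fun c => prod_dite_subtype A fun a => F a (c a)
  have h2 := prod_dite_subtype A fun a : A => 𝔼 x, F a x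
  simp only [h1]
  rw [expect_prod_pi fun (a : A) x => F a x, ← h2]
  rfl

lemma expect_fair_bit (a : ZMod 2) : 𝔼 x : ZMod 2, (if a = x then 1 else 0 : ℝ) = 1 / 2 := by
  rw [Fintype.expect_eq_sum_div_card, ZMod.card]
  simp

/-- The probability that the bit drawn from a seed is `v`. -/
noncomputable def seedProb (b : ℕ) (p1 : ℝ) (v : ZMod 2) : ℝ :=
  𝔼 ρ : Fin (2 ^ b), if v = seedBit b ρ p1 then 1 else 0

lemma seedProb_nonneg (b : ℕ) (p1 : ℝ) (v : ZMod 2) : 0 ≤ seedProb b p1 v :=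
  Finset.expect_nonneg fun ρ _ => by split_ifs <;> norm_num

lemma seedProb_add (b : ℕ) (p1 : ℝ) : seedProb b p1 0 + seedProb b p1 1 = 1 := by
  rw [seedProb, seedProb, ← Finset.expect_add_distrib]
  have : ∀ ρ : Fin (2 ^ b), ((if (0 : ZMod 2) = seedBit b ρ p1 then 1 else 0 : ℝ) +
      if (1 : ZMod 2) = seedBit b ρ p1 then 1 else 0) = 1 := by
    intro ρ
    rcases zmod_two_cases (seedBit b ρ p1) with h | h <;> rw [h] <;> simp
  simp only [this]
  exact Fintype.expect_const _

/-- Exactly ⌈p1 · 2^b⌉ of the 2^b seeds give the bit 1. -/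
lemma abs_seedProb_one_sub_le {b : ℕ} {p1 : ℝ} (h0 : 0 ≤ p1) (h1 : p1 ≤ 1) :
    |seedProb b p1 1 - p1| ≤ 1 / 2 ^ b := by
  have hpos : (0 : ℝ) < 2 ^ b := by positivity
  have hc : (Finset.univ.filter fun ρ : Fin (2 ^ b) => ((ρ : ℕ) : ℝ) / 2 ^ b < p1).card =
      ⌈p1 * 2 ^ b⌉₊ := by
    have hle : ⌈p1 * 2 ^ b⌉₊ ≤ 2 ^ b := by
      rw [Nat.ceil_le]
      push_cast
      nlinarith
    rw [show (Finset.univ.filter fun ρ : Fin (2 ^ b) => ((ρ : ℕ) : ℝ) / 2 ^ b < p1) =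
      Finset.univ.filter fun ρ : Fin (2 ^ b) => ρ.val < ⌈p1 * 2 ^ b⌉₊ by
        refine Finset.filter_congr fun ρ _ => ?_
        rw [div_lt_iff₀ hpos, Nat.lt_ceil], Fin.card_filter_val_lt, min_eq_right hle]
  have e : seedProb b p1 1 = (⌈p1 * 2 ^ b⌉₊ : ℝ) / 2 ^ b := by
    rw [← hc, seedProb, Fintype.expect_eq_sum_div_card, Fintype.card_fin]
    push_cast
    congr 1
    rw [Finset.card_filter, Nat.cast_sum]
    refine Finset.sum_congr rfl fun ρ _ => ?_
    rw [seedBit]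
    split_ifs <;> simp_all
  have hl := Nat.le_ceil (p1 * 2 ^ b)
  have hu := Nat.ceil_lt_add_one (by positivity : 0 ≤ p1 * 2 ^ b)
  rw [e, abs_le]
  constructor
  · have : p1 ≤ (⌈p1 * 2 ^ b⌉₊ : ℝ) / 2 ^ b := by rwa [le_div_iff₀ hpos]
    have : 0 < 1 / (2 : ℝ) ^ b := by positivity
    linarith
  · have : (⌈p1 * 2 ^ b⌉₊ : ℝ) / 2 ^ b ≤ (p1 * 2 ^ b + 1) / 2 ^ b := by gcongr
    rw [add_div, mul_div_cancel_right₀ _ hpos.ne'] at this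
    linarith

lemma abs_seedProb_sub_le {b : ℕ} {q : ZMod 2 → ℝ} (h0 : ∀ v, 0 ≤ q v) (h : q 0 + q 1 = 1)
    (v : ZMod 2) : |seedProb b (q 1) v - q v| ≤ 1 / 2 ^ b := by
  have h1 := abs_seedProb_one_sub_le (b := b) (h0 1) (by linarith [h0 0])
  rcases zmod_two_cases v with rfl | rfl
  · have := seedProb_add b (q 1)
    rwa [show seedProb b (q 1) 0 - q 0 = -(seedProb b (q 1) 1 - q 1) by linarith, abs_neg]
  · exact h1

end Averages

namespace Choice

variable {S X Y T : Type*} [Fintype S] [Fintype X] [Fintype Y] [Fintype T]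
  {L : AuxLaw S X Y T} {β : ℝ} {m : ℕ} (κ : Choice L β m)

/-- The step of the encoder in a block, given the padded word `w` of the previous block, with the
shared bits `c₁` and the seeds `d`. -/
noncomputable def stepFun (c₁ : L.A1 β m → ZMod 2) (d : κ.D → Fin (2 ^ κ.b)) (w : Option (Word m))
    (s : Fin (2 ^ m) → S) (j : Fin (2 ^ m)) (v : Word m) : ℝ :=
  if h : j ∈ L.A1 β m then (if v j = c₁ ⟨j, h⟩ then 1 else 0)
  else if j ∈ L.A2 β m then
    w.elim (1 / 2) fun w => if j ∈ κ.R.image κ.τ then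
      (if v j = ∑ l ∈ κ.R with κ.τ l = j, w l then 1 else 0) else 1 / 2
  else if h : j ∈ κ.D then
    (if v j = seedBit κ.b (d ⟨j, h⟩) (condBit L.lawU m j 1 v fun _ => ()) then 1 else 0)
  else condBit L.lawUS m j (v j) v s

/-- A block depends on its predecessor only through the padded word, which makes the blocks a Markov
chain; `none` stands for the missing predecessor of the first block. -/
lemma encStep_eq (c : κ.Common) (s : Fin κ.k → Fin (2 ^ m) → S) (v : Fin κ.k → Word m)
    (i : Fin κ.k) (j : Fin (2 ^ m)) :
    κ.encStep c s v i j = κ.stepFun c.1 c.2.2.1 (if 0 < i.val then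
      some (v ⟨i.val - 1, (Nat.sub_le _ _).trans_lt i.isLt⟩ +
        fun l => c.2.1 (κ.padR ⟨i.val - 1, (Nat.sub_le _ _).trans_lt i.isLt⟩ l)) else none)
      (s i) j (v i) := by
  rw [encStep, stepFun]
  by_cases hi : 0 < i.val
  · simp only [hi, true_and, if_true]
    rfl
  · simp only [hi, false_and, if_false]
    rfl

/-- The steps of the encoder, on average over the shared bits, the seeds and the keys. -/
noncomputable def idealStep (s : Fin (2 ^ m) → S) (j : Fin (2 ^ m)) (v : Word m) : ℝ :=
  if j ∈ veryHigh L.lawUS β m then 1 / 2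
  else if j ∈ κ.D then seedProb κ.b (condBit L.lawU m j 1 v fun _ => ()) (v j)
  else condBit L.lawUS m j (v j) v s

lemma A1_or_A2 (L : AuxLaw S X Y T) (β : ℝ) (m : ℕ) (j : Fin (2 ^ m)) :
    j ∈ veryHigh L.lawUS β m ↔ j ∈ L.A1 β m ∨ j ∈ L.A2 β m := by
  simp only [AuxLaw.A1, AuxLaw.A2, Finset.mem_inter, Finset.mem_sdiff]
  tauto

variable (hUS : IsBitLaw L.lawUS)

lemma sum_ite_eq_bit (a : ZMod 2) : ∑ b : ZMod 2, (if b = a then 1 else 0 : ℝ) = 1 := by simp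

include hUS in
lemma stepFun_isKernel (c₁ : L.A1 β m → ZMod 2) (d : κ.D → Fin (2 ^ κ.b)) (w : Option (Word m))
    (s : Fin (2 ^ m) → S) : IsKernel (κ.stepFun c₁ d w s) := by
  refine ⟨fun j v => ?_, fun j v v' h => ?_, fun j v => ?_⟩
  · have h := hUS.condBit_nonneg j (v j) v s
    rw [stepFun]
    cases w <;> simp only [Option.elim_none, Option.elim_some] <;> split_ifs <;> positivity
  · rw [stepFun, stepFun, h j le_rfl, condBit_congr L.lawUS fun i hi => h i hi.le,
      condBit_congr L.lawU fun i hi => h i hi.le]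
  · have e1 : ∀ b : ZMod 2, condBit L.lawUS m j b (Function.update v j b) s =
        condBit L.lawUS m j b v s := fun b =>
      condBit_congr _ (fun i hi => Function.update_of_ne hi.ne _ _) _ _
    have e2 : ∀ b : ZMod 2, condBit L.lawU m j 1 (Function.update v j b) (fun _ => ()) =
        condBit L.lawU m j 1 v fun _ => () := fun b =>
      condBit_congr _ (fun i hi => Function.update_of_ne hi.ne _ _) _ _
    simp only [stepFun, Function.update_self, e1, e2]
    cases w <;> simp only [Option.elim_none, Option.elim_some] <;> split_ifs
    all_goals first
      | exact sum_ite_eq_bit _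
      | (rw [sum_zmod_two, IsBitLaw.condBit_add])
      | simp

include hUS in
lemma idealStep_isKernel (s : Fin (2 ^ m) → S) : IsKernel (κ.idealStep s) := by
  refine ⟨fun j v => ?_, fun j v v' h => ?_, fun j v => ?_⟩
  · have h := hUS.condBit_nonneg j (v j) v s
    have h' := seedProb_nonneg κ.b (condBit L.lawU m j 1 v fun _ => ()) (v j)
    rw [idealStep]
    split_ifs <;> positivity
  · rw [idealStep, idealStep, h j le_rfl, condBit_congr L.lawUS fun i hi => h i hi.le,
      condBit_congr L.lawU fun i hi => h i hi.le]
  · have e1 : ∀ b : ZMod 2, condBit L.lawUS m j b (Function.update v j b) s =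
        condBit L.lawUS m j b v s := fun b =>
      condBit_congr _ (fun i hi => Function.update_of_ne hi.ne _ _) _ _
    have e2 : ∀ b : ZMod 2, condBit L.lawU m j 1 (Function.update v j b) (fun _ => ()) =
        condBit L.lawU m j 1 v fun _ => () := fun b =>
      condBit_congr _ (fun i hi => Function.update_of_ne hi.ne _ _) _ _
    simp only [idealStep, Function.update_self, e1, e2]
    split_ifs
    · simp
    · rw [sum_zmod_two, seedProb_add]
    · rw [sum_zmod_two, IsBitLaw.condBit_add]

/-- A uniform padded word is as good as local fair bits. -/
lemma expect_stepFun_some (c₁ : L.A1 β m → ZMod 2) (d : κ.D → Fin (2 ^ κ.b))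
    (s : Fin (2 ^ m) → S) (v : Word m) :
    𝔼 w : Word m, ∏ j, κ.stepFun c₁ d (some w) s j v = ∏ j, κ.stepFun c₁ d none s j v := by
  -- Relative to the fair bits of the case `none`, a position of A₃' has a density with values 0 and
  -- 2, of mean one over w.
  have e : ∀ (w : Word m) j, κ.stepFun c₁ d (some w) s j v = κ.stepFun c₁ d none s j v *
      if j ∈ κ.R.image κ.τ then 2 * (if v j = ∑ l ∈ κ.R with κ.τ l = j, w l then 1 else 0)
      else 1 := by
    intro w j
    simp only [stepFun]
    by_cases hj : j ∈ κ.R.image κ.τ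
    · obtain ⟨l, hl, rfl⟩ := Finset.mem_image.1 hj
      simp only [hj, if_true, κ.τ_maps l hl, dif_neg (disjoint_A1_A2 L β m (κ.τ_maps l hl)),
        Option.elim_none, Option.elim_some]
      ring
    · simp only [hj, if_false, mul_one, Option.elim_none, Option.elim_some]
  -- Reindexed by the injection τ, the densities involve distinct coordinates of w, so their means
  -- multiply.
  have e2 : ∀ w : Word m, (∏ j, if j ∈ κ.R.image κ.τ then
      2 * (if v j = ∑ l ∈ κ.R with κ.τ l = j, w l then 1 else 0 : ℝ) else 1) =
      ∏ l, if l ∈ κ.R then 2 * (if v (κ.τ l) = w l then 1 else 0 : ℝ) else 1 := by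
    intro w
    rw [Finset.prod_ite_mem, Finset.univ_inter, Finset.prod_image κ.τ_inj, Finset.prod_ite_mem,
      Finset.univ_inter]
    refine Finset.prod_congr rfl fun l hl => ?_
    rw [κ.filter_τ_eq hl, Finset.sum_singleton]
  have e3 : ∏ l, 𝔼 x : ZMod 2, (if l ∈ κ.R then 2 * (if v (κ.τ l) = x then 1 else 0 : ℝ) else 1) =
      1 := by
    refine Finset.prod_eq_one fun l _ => ?_
    split_ifs
    · rw [← Finset.mul_expect, expect_fair_bit]
      norm_num
    · exact Fintype.expect_const _
  simp only [e, Finset.prod_mul_distrib, e2]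
  rw [← Finset.mul_expect,
    expect_prod_pi fun l x => if l ∈ κ.R then 2 * (if v (κ.τ l) = x then 1 else 0 : ℝ) else 1,
    e3, mul_one]

/-- Each factor of the weight involves at most one shared bit or one seed, so by independence the
average is taken position by position. -/
lemma expect_stepFun_none (s : Fin (2 ^ m) → S) (v : Word m) :
    𝔼 c₁ : L.A1 β m → ZMod 2, 𝔼 d : κ.D → Fin (2 ^ κ.b), ∏ j, κ.stepFun c₁ d none s j v =
      ∏ j, κ.idealStep s j v := by
  have e : ∀ c₁ d j, κ.stepFun c₁ d none s j v =
      (if h : j ∈ L.A1 β m then (if v j = c₁ ⟨j, h⟩ then 1 else 0) else 1) *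
      ((if h : j ∈ κ.D then (if v j = seedBit κ.b (d ⟨j, h⟩)
        (condBit L.lawU m j 1 v fun _ => ()) then 1 else 0) else 1) *
      (if j ∈ L.A1 β m then 1 else if j ∈ L.A2 β m then 1 / 2 else if j ∈ κ.D then 1 else
        condBit L.lawUS m j (v j) v s)) := by
    intro c₁ d j
    rw [stepFun]
    by_cases hD : j ∈ κ.D
    · have h3 := κ.mem_A3_of_mem (.inr (.inr hD))
      simp [hD, notMem_A1_of_A3 L β m h3, notMem_A2_of_A3 L β m h3]
    · by_cases h1 : j ∈ L.A1 β m <;> simp [h1, hD]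
  simp only [e, Finset.prod_mul_distrib, ← Finset.mul_expect, ← Finset.expect_mul]
  rw [expect_prod_dite (L.A1 β m) fun j (x : ZMod 2) => if v j = x then (1 : ℝ) else 0,
    expect_prod_dite κ.D fun j x => if v j = seedBit κ.b x
      (condBit L.lawU m j 1 v fun _ => ()) then (1 : ℝ) else 0]
  rw [← Finset.prod_mul_distrib, ← Finset.prod_mul_distrib]
  refine Finset.prod_congr rfl fun j _ => ?_
  rw [expect_fair_bit, idealStep, ← seedProb]
  simp only [A1_or_A2]
  by_cases hD : j ∈ κ.D
  · have h3 := κ.mem_A3_of_mem (.inr (.inr hD))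
    simp [hD, notMem_A1_of_A3 L β m h3, notMem_A2_of_A3 L β m h3]
  · by_cases h1 : j ∈ L.A1 β m <;> by_cases h2 : j ∈ L.A2 β m <;> simp [h1, h2, hD]

/-- The law of a bit of the extra block given the earlier bits. -/
noncomputable def extraStep (t : Fin (2 ^ κ.mx)) (z : Word κ.mx) : ℝ :=
  if t ∈ veryHigh κ.lawB β κ.mx then 1 / 2
  else seedProb κ.b (condBit κ.lawB κ.mx t 1 z fun _ => ()) (z t)

lemma extraStep_isKernel : IsKernel κ.extraStep := by
  refine ⟨fun j v => ?_, fun j v v' h => ?_, fun j v => ?_⟩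
  · have h' := seedProb_nonneg κ.b (condBit κ.lawB κ.mx j 1 v fun _ => ()) (v j)
    rw [extraStep]
    split_ifs <;> positivity
  · rw [extraStep, extraStep, h j le_rfl, condBit_congr κ.lawB fun i hi => h i hi.le]
  · have e2 : ∀ b : ZMod 2, condBit κ.lawB κ.mx j 1 (Function.update v j b) (fun _ => ()) =
        condBit κ.lawB κ.mx j 1 v fun _ => () := fun b =>
      condBit_congr _ (fun i hi => Function.update_of_ne hi.ne _ _) _ _
    simp only [extraStep, Function.update_self, e2]
    split_ifs
    · simp
    · rw [sum_zmod_two, seedProb_add]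

/-- The word of the extra block, with the message `a` and the key `x` in the slots. -/
lemma expect_channelWord (a : Word κ.mx) (F : Word κ.mx → ℝ) (c₁ : L.A1 β m → ZMod 2)
    (key : Fin κ.q → ZMod 2) (d : κ.D → Fin (2 ^ κ.b)) :
    𝔼 x : Word κ.mx, 𝔼 g : κ.frozen → ZMod 2, 𝔼 e : κ.drawn → Fin (2 ^ κ.b),
      F (κ.channelWord (c₁, key, d, g, e) fun t _ => a t + x t) =
      ∑ z, (∏ t, κ.extraStep t z) * F z := by
  have hslots : ∀ t ∈ κ.slots, t ∈ veryHigh κ.lawB β κ.mx := fun t ht =>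
    (Finset.mem_sdiff.1 (κ.slots_subset ht)).1
  -- The word is the unique solution of its recursion, so its indicator factors over slots, frozen
  -- and drawn positions, which partition the block.
  have ind : ∀ (x : Word κ.mx) g e, F (κ.channelWord (c₁, key, d, g, e) fun t _ => a t + x t) =
      ∑ z, F z * ((∏ t, if t ∈ κ.slots then (if z t = a t + x t then 1 else 0) else 1) *
        ((∏ t, if h : t ∈ κ.frozen then (if z t = g ⟨t, h⟩ then 1 else 0) else 1) *
        ∏ t, if h : t ∈ κ.drawn then (if z t = seedBit κ.b (e ⟨t, h⟩)
          (condBit κ.lawB κ.mx t 1 z fun _ => ()) then 1 else 0) else 1)) := by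
    intro x g e
    rw [Finset.sum_eq_single (κ.channelWord (c₁, key, d, g, e) fun t _ => a t + x t)]
    · have hz := (κ.channelWord_eq_iff (c₁, key, d, g, e) (f := fun t _ => a t + x t)).1 rfl
      generalize κ.channelWord (c₁, key, d, g, e) (fun t _ => a t + x t) = z at hz
      rw [← Finset.prod_mul_distrib, ← Finset.prod_mul_distrib, Finset.prod_eq_one, mul_one]
      intro t _
      have ht := hz t
      by_cases h1 : t ∈ κ.slots
      · have h2 : t ∉ κ.frozen := fun h => (Finset.mem_sdiff.1 h).2 h1
        have h3 : t ∉ κ.drawn := fun h => Finset.mem_compl.1 h (hslots t h1)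
        rw [if_pos h1] at ht
        simp [h1, h2, h3, ht]
      · rw [if_neg h1] at ht
        by_cases h2 : t ∈ κ.frozen
        · have h3 : t ∉ κ.drawn := fun h => Finset.mem_compl.1 h (Finset.mem_sdiff.1 h2).1
          rw [dif_pos h2] at ht
          simp [h1, h2, h3, ht]
        · rw [dif_neg h2] at ht
          by_cases h3 : t ∈ κ.drawn
          · rw [dif_pos h3] at ht
            simp only [h1, h2, h3, if_false, dif_neg, dif_pos, not_false_eq_true, one_mul]
            exact if_pos ht
          · simp [h1, h2, h3]
    · intro z _ hz
      have hz' : ¬∀ t, z t = _ := fun h => hz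
        ((κ.channelWord_eq_iff (c₁, key, d, g, e) (f := fun t _ => a t + x t)).2 h).symm
      obtain ⟨t, ht⟩ := not_forall.1 hz'
      rw [← Finset.prod_mul_distrib, ← Finset.prod_mul_distrib,
        Finset.prod_eq_zero (Finset.mem_univ t), mul_zero]
      by_cases h1 : t ∈ κ.slots
      · rw [if_pos h1] at ht
        simp [h1, ht]
      · rw [if_neg h1] at ht
        by_cases h2 : t ∈ κ.frozen
        · rw [dif_pos h2] at ht
          simp [h2, ht]
        · have h3 : t ∈ κ.drawn := Finset.mem_compl.2 fun h => h2 (Finset.mem_sdiff.2 ⟨h, h1⟩)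
          rw [dif_neg h2, dif_pos h3] at ht
          rw [dif_pos h3, if_neg ht, mul_zero, mul_zero]
    · simp
  simp only [ind, Finset.expect_sum_comm, ← Finset.mul_expect, ← Finset.expect_mul]
  refine Finset.sum_congr rfl fun z _ => ?_
  rw [mul_comm]
  congr 1
  rw [expect_prod_pi fun t y => if t ∈ κ.slots then (if z t = a t + y then 1 else 0 : ℝ) else 1,
    expect_prod_dite κ.frozen fun t y => if z t = y then (1 : ℝ) else 0,
    expect_prod_dite κ.drawn fun t y => if z t = seedBit κ.b y
      (condBit κ.lawB κ.mx t 1 z fun _ => ()) then (1 : ℝ) else 0,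
    ← Finset.prod_mul_distrib, ← Finset.prod_mul_distrib]
  refine Finset.prod_congr rfl fun t _ => ?_
  have hbit : 𝔼 y : ZMod 2, (if z t = a t + y then 1 else 0 : ℝ) = 1 / 2 := by
    rw [← expect_fair_bit (z t)]
    exact Fintype.expect_equiv (Equiv.addLeft (a t)) _ _ fun y => rfl
  rw [expect_fair_bit, extraStep, ← seedProb]
  by_cases h1 : t ∈ κ.slots
  · have h2 : t ∉ κ.frozen := fun h => (Finset.mem_sdiff.1 h).2 h1
    have h3 : t ∉ κ.drawn := fun h => Finset.mem_compl.1 h (hslots t h1)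
    simp only [h1, h2, h3, if_true, if_false, hslots t h1, hbit, mul_one]
  · by_cases hv : t ∈ veryHigh κ.lawB β κ.mx
    · have h2 : t ∈ κ.frozen := Finset.mem_sdiff.2 ⟨hv, h1⟩
      have h3 : t ∉ κ.drawn := fun h => Finset.mem_compl.1 h hv
      simp only [h1, h2, h3, hv, if_true, if_false, mul_one]
      rw [show 𝔼 _x : ZMod 2, (1 : ℝ) = 1 from Fintype.expect_const _, one_mul]
    · have h2 : t ∉ κ.frozen := fun h => hv (Finset.mem_sdiff.1 h).1
      have h3 : t ∈ κ.drawn := Finset.mem_compl.2 hv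
      simp only [h1, h2, h3, hv, if_true, if_false, one_mul]
      rw [show 𝔼 _x : ZMod 2, (1 : ℝ) = 1 from Fintype.expect_const _, one_mul]

end Choice

end PolarCoord

namespace PolarCoord
open scoped Classical BigOperators

/-! ### The marginals of the joint law -/

namespace AuxLaw

variable {S X Y T : Type*} [Fintype S] [Fintype X] [Fintype Y] [Fintype T] (L : AuxLaw S X Y T)

lemma joint_nonneg (a : S × ZMod 2 × X × Y × T) : 0 ≤ L.joint a :=
  mul_nonneg (mul_nonneg (mul_nonneg (mul_nonneg (L.PS_mem.1 _) ((L.PU_mem _).1 _))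
    ((L.PX_mem _ _).1 _)) ((L.W_mem _).1 _)) ((L.PT_mem _ _).1 _)

lemma sum_joint_T (s : S) (u : ZMod 2) (x : X) (y : Y) :
    ∑ t, L.joint (s, u, x, y, t) = L.PS s * L.PU s u * L.PX u s x * L.W x y := by
  simp only [joint, ← Finset.mul_sum]
  rw [(L.PT_mem u y).2, mul_one]

lemma sum_joint_YT (s : S) (u : ZMod 2) (x : X) :
    ∑ y, ∑ t, L.joint (s, u, x, y, t) = L.PS s * L.PU s u * L.PX u s x := by
  simp only [sum_joint_T, ← Finset.mul_sum]
  rw [(L.W_mem x).2, mul_one]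

lemma sum_joint_XYT (s : S) (u : ZMod 2) :
    ∑ x, ∑ y, ∑ t, L.joint (s, u, x, y, t) = L.PS s * L.PU s u := by
  simp only [sum_joint_YT, ← Finset.mul_sum]
  rw [(L.PX_mem u s).2, mul_one]

lemma lawUS_eq (u : ZMod 2) (s : S) : L.lawUS u s = L.PS s * L.PU s u := by
  rw [lawUS, prob_eq_sum_ite, Fintype.sum_prod_type, Finset.sum_eq_single s, Fintype.sum_prod_type,
    Finset.sum_eq_single u]
  · simp only [and_self, if_true, Fintype.sum_prod_type, sum_joint_XYT]
  · intro u' _ h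
    simp [h]
  · simp
  · intro s' _ h
    simp [h]
  · simp

lemma lawU_eq (u : ZMod 2) (o : Unit) : L.lawU u o = ∑ s, L.lawUS u s := by
  simp only [lawU, prob_eq_sum_ite, lawUS_eq, ← sum_joint_XYT]
  rw [Fintype.sum_prod_type]
  refine Finset.sum_congr rfl fun s _ => ?_
  rw [Fintype.sum_prod_type, Finset.sum_eq_single u]
  · simp only [if_true, Fintype.sum_prod_type]
  · intro u' _ h
    simp [h]
  · simp

lemma lawUY_eq (u : ZMod 2) (y : Y) :
    L.lawUY u y = ∑ s, ∑ x, L.lawUS u s * L.PX u s x * L.W x y := by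
  simp only [lawUY, prob_eq_sum_ite, lawUS_eq, ← sum_joint_T]
  rw [Fintype.sum_prod_type]
  refine Finset.sum_congr rfl fun s _ => ?_
  rw [Fintype.sum_prod_type, Finset.sum_eq_single u]
  · rw [Fintype.sum_prod_type]
    refine Finset.sum_congr rfl fun x _ => ?_
    rw [Fintype.sum_prod_type, Finset.sum_eq_single y]
    · simp
    · intro y' _ h
      simp [h]
    · simp
  · intro u' _ h
    simp [h]
  · simp

lemma lawUS_isBitLaw : IsBitLaw L.lawUS where
  nonneg u s := by
    rw [lawUS_eq]
    exact mul_nonneg (L.PS_mem.1 s) ((L.PU_mem s).1 u)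
  sum_eq_one := by
    rw [← L.PS_mem.2]
    refine Finset.sum_congr rfl fun s _ => ?_
    rw [lawUS_eq, lawUS_eq, ← mul_add, ← sum_zmod_two (L.PU s), (L.PU_mem s).2, mul_one]

lemma obsLaw_lawUS : obsLaw L.lawUS = L.PS := by
  funext s
  rw [obsLaw, lawUS_eq, lawUS_eq, ← mul_add, ← sum_zmod_two (L.PU s), (L.PU_mem s).2, mul_one]

lemma lawU_isBitLaw : IsBitLaw L.lawU where
  nonneg u o := by
    rw [lawU_eq]
    exact Finset.sum_nonneg fun s _ => L.lawUS_isBitLaw.nonneg u s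
  sum_eq_one := by
    rw [Fintype.sum_unique, lawU_eq, lawU_eq, ← Finset.sum_add_distrib]
    exact L.lawUS_isBitLaw.sum_eq_one

lemma sum_lawUY (u : ZMod 2) : ∑ y, L.lawUY u y = L.lawU u () := by
  simp only [lawUY_eq, lawU_eq]
  rw [Finset.sum_comm]
  refine Finset.sum_congr rfl fun s _ => ?_
  rw [Finset.sum_comm]
  simp only [← Finset.mul_sum, (L.W_mem _).2, mul_one, (L.PX_mem u s).2]

lemma lawUY_isBitLaw : IsBitLaw L.lawUY where
  nonneg u y := by
    rw [lawUY_eq]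
    exact Finset.sum_nonneg fun s _ => Finset.sum_nonneg fun x _ =>
      mul_nonneg (mul_nonneg (L.lawUS_isBitLaw.nonneg u s) ((L.PX_mem _ _).1 _)) ((L.W_mem _).1 _)
  sum_eq_one := by
    rw [Finset.sum_add_distrib, sum_lawUY, sum_lawUY, ← L.lawU_isBitLaw.sum_eq_one,
      Fintype.sum_unique]

lemma target_eq (a : S × X × Y × T) : L.target a =
    ∑ u, L.lawUS u a.1 * L.PX u a.1 a.2.1 * L.W a.2.1 a.2.2.1 * L.PT u a.2.2.1 a.2.2.2 := by
  simp only [target, joint, lawUS_eq]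

lemma target_mem : L.target ∈ stdSimplex ℝ (S × X × Y × T) := by
  refine ⟨fun a => Finset.sum_nonneg fun u _ => L.joint_nonneg _, ?_⟩
  calc ∑ a, L.target a = ∑ s, ∑ x, ∑ y, ∑ t, ∑ u, L.joint (s, u, x, y, t) := by
        simp only [target, Fintype.sum_prod_type]
    _ = ∑ s, ∑ u, ∑ x, ∑ y, ∑ t, L.joint (s, u, x, y, t) := by
        refine Finset.sum_congr rfl fun s _ => ?_
        calc _ = ∑ x, ∑ y, ∑ u, ∑ t, L.joint (s, u, x, y, t) :=
              Finset.sum_congr rfl fun x _ => Finset.sum_congr rfl fun y _ => Finset.sum_comm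
          _ = ∑ x, ∑ u, ∑ y, ∑ t, L.joint (s, u, x, y, t) :=
              Finset.sum_congr rfl fun x _ => Finset.sum_comm
          _ = _ := Finset.sum_comm
    _ = 1 := by
        simp only [sum_joint_XYT, ← Finset.mul_sum, (L.PU_mem _).2, mul_one, L.PS_mem.2]

end AuxLaw

end PolarCoord

namespace PolarCoord
open scoped Classical BigOperators

/-! ### From the failure probability to the blocks -/

section FailProb

variable {C S X Y T : Type*} [Fintype C] [Fintype S] [Fintype X] [Fintype Y] [Fintype T]

lemma failProb_eq {ι : Type*} [Fintype ι] [DecidableEq ι] (PS : S → ℝ) (W : X → Y → ℝ)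
    (P : S × X × Y × T → ℝ) (ε : ℝ) (enc : (ι → S) → C → (ι → X) → ℝ)
    (dec : (ι → Y) → C → (ι → T) → ℝ) :
    failProb PS W P ε enc dec =
      𝔼 c : C, ∑ s : ι → S, ∑ x : ι → X, ∑ y : ι → Y, ∑ t : ι → T,
        (∏ i, PS (s i)) * enc s c x * (∏ i, W (x i) (y i)) * dec y c t *
        (if ε < varDist (empirical fun i => (s i, x i, y i, t i)) P then 1 else 0) := by
  rw [failProb, Fintype.expect_eq_sum_div_card]
  congr!

variable {k n n' : ℕ}

/-- The expected distance of the type of a block from the target. -/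
noncomputable def blockLoss (PS : S → ℝ) (W : X → Y → ℝ) (P : S × X × Y × T → ℝ)
    (enc : ((Fin k × Fin n) ⊕ Fin n' → S) → C → ((Fin k × Fin n) ⊕ Fin n' → X) → ℝ)
    (dec : ((Fin k × Fin n) ⊕ Fin n' → Y) → C → ((Fin k × Fin n) ⊕ Fin n' → T) → ℝ)
    (c : C) (i : Fin k) : ℝ :=
  ∑ s : (Fin k × Fin n) ⊕ Fin n' → S, ∑ x : (Fin k × Fin n) ⊕ Fin n' → X,
    ∑ y : (Fin k × Fin n) ⊕ Fin n' → Y, ∑ t : (Fin k × Fin n) ⊕ Fin n' → T,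
      (∏ i, PS (s i)) * enc s c x * (∏ i, W (x i) (y i)) * dec y c t *
        varDist (empirical fun j =>
          (s (.inl (i, j)), x (.inl (i, j)), y (.inl (i, j)), t (.inl (i, j)))) P

lemma markov_mixture {Ω ι : Type*} [Fintype Ω] [Fintype ι] {μ : Ω → ℝ} (hμ : ∀ ω, 0 ≤ μ ω)
    (h1 : ∑ ω, μ ω = 1) {ε : ℝ} (hε : 0 < ε) {f : Ω → ℝ} (hf : ∀ ω, 0 ≤ f ω) {g : ι → Ω → ℝ}
    {a b : ℝ} (h : ∀ ω, f ω ≤ a * ∑ i, g i ω + b) :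
    ∑ ω, μ ω * (if ε < f ω then 1 else 0) ≤ (a * ∑ i, ∑ ω, μ ω * g i ω + b) / ε := by
  rw [le_div_iff₀ hε, Finset.sum_mul]
  calc _ ≤ ∑ ω, μ ω * (a * ∑ i, g i ω + b) := by
        refine Finset.sum_le_sum fun ω _ => ?_
        rw [mul_assoc]
        refine mul_le_mul_of_nonneg_left (le_trans ?_ (h ω)) (hμ ω)
        split_ifs with hlt
        · rw [one_mul]
          exact hlt.le
        · rw [zero_mul]
          exact hf ω
    _ = _ := by
        simp only [mul_add, Finset.sum_add_distrib, ← Finset.sum_mul, h1, one_mul]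
        rw [Finset.sum_comm, Finset.mul_sum]
        congr 1
        refine Finset.sum_congr rfl fun ω _ => ?_
        rw [← Finset.mul_sum]
        ring

/-- The type of the whole is a mixture of the types of the blocks, so by Markov's inequality only
the mean loss of each block matters, whatever the dependence between blocks. The extra block is
charged with the maximal distance 2. -/
lemma failProb_le {PS : S → ℝ} {W : X → Y → ℝ} {P : S × X × Y × T → ℝ} {ε : ℝ} (hε : 0 < ε)
    (hPS : PS ∈ stdSimplex ℝ S) (hW : ∀ x, W x ∈ stdSimplex ℝ Y)
    (hP : P ∈ stdSimplex ℝ (S × X × Y × T)) (hn : 0 < n) (hn' : 0 < n')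
    {enc : ((Fin k × Fin n) ⊕ Fin n' → S) → C → ((Fin k × Fin n) ⊕ Fin n' → X) → ℝ}
    {dec : ((Fin k × Fin n) ⊕ Fin n' → Y) → C → ((Fin k × Fin n) ⊕ Fin n' → T) → ℝ}
    (henc : ∀ s c, enc s c ∈ stdSimplex ℝ _) (hdec : ∀ y c, dec y c ∈ stdSimplex ℝ _) [Nonempty C] :
    failProb PS W P ε enc dec ≤
      ((n / (k * n + n' : ℝ)) * ∑ i, 𝔼 c, blockLoss PS W P enc dec c i +
        2 * n' / (k * n + n' : ℝ)) / ε := by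
  have htot : ∀ c, ∑ s : (Fin k × Fin n) ⊕ Fin n' → S, ∑ x : (Fin k × Fin n) ⊕ Fin n' → X,
      ∑ y : (Fin k × Fin n) ⊕ Fin n' → Y, ∑ t : (Fin k × Fin n) ⊕ Fin n' → T,
      (∏ i, PS (s i)) * enc s c x * (∏ i, W (x i) (y i)) * dec y c t = 1 := by
    intro c
    simp only [← Finset.mul_sum, (hdec _ c).2, mul_one, (henc _ c).2,
      sum_pi_eq_one fun _ => hPS.2, sum_pi_eq_one fun i => (hW _).2]
  have hw : ∀ c s x y t, 0 ≤ (∏ i, PS (s i)) * enc s c x * (∏ i, W (x i) (y i)) * dec y c t :=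
    fun c s x y t => mul_nonneg (mul_nonneg (mul_nonneg (Finset.prod_nonneg fun i _ => hPS.1 _)
      ((henc s c).1 x)) (Finset.prod_nonneg fun i _ => (hW _).1 _)) ((hdec y c).1 t)
  have key : ∀ c, ∑ s : (Fin k × Fin n) ⊕ Fin n' → S, ∑ x : (Fin k × Fin n) ⊕ Fin n' → X,
      ∑ y : (Fin k × Fin n) ⊕ Fin n' → Y, ∑ t : (Fin k × Fin n) ⊕ Fin n' → T,
      (∏ i, PS (s i)) * enc s c x * (∏ i, W (x i) (y i)) * dec y c t *
        (if ε < varDist (empirical fun i => (s i, x i, y i, t i)) P then 1 else 0) ≤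
      ((n / (k * n + n' : ℝ)) * ∑ i, blockLoss PS W P enc dec c i +
        2 * n' / (k * n + n' : ℝ)) / ε := by
    intro c
    have h := markov_mixture (Ω := ((Fin k × Fin n) ⊕ Fin n' → S) × ((Fin k × Fin n) ⊕ Fin n' → X) ×
        ((Fin k × Fin n) ⊕ Fin n' → Y) × ((Fin k × Fin n) ⊕ Fin n' → T))
      (μ := fun ω => (∏ i, PS (ω.1 i)) * enc ω.1 c ω.2.1 * (∏ i, W (ω.2.1 i) (ω.2.2.1 i)) *
        dec ω.2.2.1 c ω.2.2.2)
      (fun ω => hw c _ _ _ _) (by simpa only [Fintype.sum_prod_type] using htot c) hε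
      (f := fun ω => varDist (empirical fun i => (ω.1 i, ω.2.1 i, ω.2.2.1 i, ω.2.2.2 i)) P)
      (fun ω => varDist_nonneg _ _)
      (fun ω => varDist_empirical_use_le hn hn' hP fun i => (ω.1 i, ω.2.1 i, ω.2.2.1 i, ω.2.2.2 i))
    simpa only [Fintype.sum_prod_type, blockLoss] using h
  rw [failProb_eq]
  refine (Finset.expect_le_expect fun c _ => key c).trans (le_of_eq ?_)
  rw [← Finset.expect_sum_comm, ← Finset.expect_div, Finset.expect_add_distrib, Finset.mul_expect,
    Fintype.expect_const]

end FailProb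

end PolarCoord

namespace PolarCoord
open scoped Classical BigOperators

/-! ### The encoder and the decoder for fixed common randomness -/

namespace Choice

variable {S X Y T : Type*} [Fintype S] [Fintype X] [Fintype Y] [Fintype T]
  {L : AuxLaw S X Y T} {β : ℝ} {m : ℕ} (κ : Choice L β m) (c : κ.Common)

/-- The law of a channel input given the polarized words. -/
noncomputable def inputLaw (v : Fin κ.k → Word m) (s : κ.Use → S) : κ.Use → X → ℝ
  | .inl (i, j) => L.PX (Matrix.vecMul (v i) (polarMatrix m) j) (s (.inl (i, j)))
  | .inr t => κ.QX (Matrix.vecMul (κ.encExtra c v) (polarMatrix κ.mx) t)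

/-- The law of an output of the decoder given the decoded words. -/
noncomputable def outputLaw (w : Fin κ.k → Word m) (y : κ.Use → Y) : κ.Use → T → ℝ
  | .inl (i, j) => L.PT (Matrix.vecMul (w i) (polarMatrix m) j) (y (.inl (i, j)))
  | .inr _ => fun t => if t = κ.idle then 1 else 0

lemma enc_eq (s : κ.Use → S) (x : κ.Use → X) :
    κ.enc s c x = ∑ v : Fin κ.k → Word m, (∏ i, ∏ j, κ.encStep c (κ.blocks s) v i j) *
      ∏ u, κ.inputLaw c v s u (x u) := by
  rw [enc]
  refine Finset.sum_congr rfl fun v _ => ?_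
  rw [Fintype.prod_sum_type, Fintype.prod_prod_type, mul_assoc]
  rfl

lemma dec_eq (y : κ.Use → Y) (t : κ.Use → T) :
    κ.dec y c t = ∏ u, κ.outputLaw (κ.decChain c y) y u (t u) := by
  rw [dec, Fintype.prod_sum_type, Fintype.prod_prod_type]
  congr 1
  simp only [outputLaw, Finset.prod_boole, Finset.mem_univ, true_imp_iff]
  rfl

lemma sum_inputLaw (v : Fin κ.k → Word m) (s : κ.Use → S) (u : κ.Use) :
    ∑ x, κ.inputLaw c v s u x = 1 := by
  rcases u with ⟨i, j⟩ | t
  · exact (L.PX_mem _ _).2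
  · exact (κ.QX_mem _).2

lemma inputLaw_nonneg (v : Fin κ.k → Word m) (s : κ.Use → S) (u : κ.Use) (x : X) :
    0 ≤ κ.inputLaw c v s u x := by
  rcases u with ⟨i, j⟩ | t
  · exact (L.PX_mem _ _).1 _
  · exact (κ.QX_mem _).1 _

lemma sum_outputLaw (w : Fin κ.k → Word m) (y : κ.Use → Y) (u : κ.Use) :
    ∑ t, κ.outputLaw w y u t = 1 := by
  rcases u with ⟨i, j⟩ | t
  · exact (L.PT_mem _ _).2
  · simp [outputLaw]

lemma outputLaw_nonneg (w : Fin κ.k → Word m) (y : κ.Use → Y) (u : κ.Use) (t : T) :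
    0 ≤ κ.outputLaw w y u t := by
  rcases u with ⟨i, j⟩ | l
  · exact (L.PT_mem _ _).1 _
  · simp only [outputLaw]
    split_ifs <;> norm_num

lemma encStep_nonneg (s : Fin κ.k → Fin (2 ^ m) → S) (v : Fin κ.k → Word m) (i : Fin κ.k)
    (j : Fin (2 ^ m)) : 0 ≤ κ.encStep c s v i j := by
  rw [encStep_eq]
  exact (κ.stepFun_isKernel L.lawUS_isBitLaw _ _ _ _).nonneg _ _

/-- The whole blocks are again the letters of a sequential kernel. -/
lemma encStep_isKernel (s : Fin κ.k → Fin (2 ^ m) → S) :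
    IsKernel fun i v => ∏ j, κ.encStep c s v i j := by
  refine ⟨fun i v => Finset.prod_nonneg fun j _ => κ.encStep_nonneg c s v i j,
    fun i v v' h => ?_, fun i v => ?_⟩
  · refine Finset.prod_congr rfl fun j _ => ?_
    rw [encStep_eq, encStep_eq, h i le_rfl, h ⟨i.val - 1, (Nat.sub_le _ _).trans_lt i.isLt⟩
      (Fin.le_def.2 (Nat.sub_le _ _))]
  · have e : ∀ b j, κ.encStep c s (Function.update v i b) i j = κ.stepFun c.1 c.2.2.1
        (if 0 < i.val then some (v ⟨i.val - 1, (Nat.sub_le _ _).trans_lt i.isLt⟩ +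
        fun l => c.2.1 (κ.padR ⟨i.val - 1, (Nat.sub_le _ _).trans_lt i.isLt⟩ l)) else none)
        (s i) j b := by
      intro b j
      rw [encStep_eq, Function.update_self]
      by_cases hi : 0 < i.val
      · rw [if_pos hi, if_pos hi, Function.update_of_ne]
        intro h
        have := congrArg Fin.val h
        simp only at this
        omega
      · rw [if_neg hi, if_neg hi]
    simp only [e]
    exact (κ.stepFun_isKernel L.lawUS_isBitLaw _ _ _ _).sum_prod

lemma enc_mem (s : κ.Use → S) : κ.enc s c ∈ stdSimplex ℝ (κ.Use → X) := by
  refine ⟨fun x => ?_, ?_⟩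
  · rw [enc_eq]
    exact Finset.sum_nonneg fun v _ => mul_nonneg (Finset.prod_nonneg fun i _ =>
      Finset.prod_nonneg fun j _ => κ.encStep_nonneg c _ _ _ _)
      (Finset.prod_nonneg fun u _ => κ.inputLaw_nonneg c v s u _)
  · simp only [enc_eq]
    rw [Finset.sum_comm]
    simp only [← Finset.mul_sum, sum_pi_eq_one fun u => κ.sum_inputLaw c _ s u, mul_one]
    exact (κ.encStep_isKernel c (κ.blocks s)).sum_prod

lemma dec_mem (y : κ.Use → Y) : κ.dec y c ∈ stdSimplex ℝ (κ.Use → T) := by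
  refine ⟨fun t => ?_, ?_⟩
  · rw [dec_eq]
    exact Finset.prod_nonneg fun u _ => κ.outputLaw_nonneg _ y u _
  · simp only [dec_eq]
    exact sum_pi_eq_one fun u => κ.sum_outputLaw _ y u

/-- The expected distance of the type of a block from the target, when the decoder uses the
polarized word `v`. -/
noncomputable def wordLoss (L : AuxLaw S X Y T) {m : ℕ} (v : Word m) (s : Fin (2 ^ m) → S)
    (x : Fin (2 ^ m) → X) (y : Fin (2 ^ m) → Y) : ℝ :=
  ∑ t : Fin (2 ^ m) → T, (∏ j, L.PT (Matrix.vecMul v (polarMatrix m) j) (y j) (t j)) *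
    varDist (empirical fun j => (s j, x j, y j, t j)) L.target

lemma wordLoss_nonneg (v : Word m) (s : Fin (2 ^ m) → S) (x : Fin (2 ^ m) → X)
    (y : Fin (2 ^ m) → Y) : 0 ≤ wordLoss L v s x y :=
  Finset.sum_nonneg fun _ _ => mul_nonneg (Finset.prod_nonneg fun _ _ => (L.PT_mem _ _).1 _)
    (varDist_nonneg _ _)

lemma wordLoss_le_two (v : Word m) (s : Fin (2 ^ m) → S) (x : Fin (2 ^ m) → X)
    (y : Fin (2 ^ m) → Y) : wordLoss L v s x y ≤ 2 := by
  calc wordLoss L v s x y ≤ ∑ t : Fin (2 ^ m) → T,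
      (∏ j, L.PT (Matrix.vecMul v (polarMatrix m) j) (y j) (t j)) * 2 :=
        Finset.sum_le_sum fun _ _ => mul_le_mul_of_nonneg_left
          (varDist_le_two (empirical_mem_stdSimplex _) L.target_mem)
          (Finset.prod_nonneg fun _ _ => (L.PT_mem _ _).1 _)
    _ = 2 := by
        rw [← Finset.sum_mul, sum_pi_eq_one fun j => (L.PT_mem _ _).2, one_mul]

/-- The expectation over the inputs and outputs of a block. -/
def blockMean (L : AuxLaw S X Y T) {m : ℕ} (v : Word m) (s : Fin (2 ^ m) → S)
    (φ : (Fin (2 ^ m) → X) → (Fin (2 ^ m) → Y) → ℝ) : ℝ :=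
  ∑ x, ∑ y, (∏ j, L.PX (Matrix.vecMul v (polarMatrix m) j) (s j) (x j) * L.W (x j) (y j)) * φ x y

/-- The expectation over the outputs of the extra block. -/
def extraMean (z : Word κ.mx) (φ : (Fin (2 ^ κ.mx) → Y) → ℝ) : ℝ :=
  ∑ x : Fin (2 ^ κ.mx) → X, ∑ y, (∏ t, κ.QX (Matrix.vecMul z (polarMatrix κ.mx) t) (x t) *
    L.W (x t) (y t)) * φ y

lemma sum_dec_mul (i : Fin κ.k) (s : κ.Use → S) (x : κ.Use → X) (y : κ.Use → Y) :
    ∑ t : κ.Use → T, κ.dec y c t * varDist (empirical fun j =>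
      (s (.inl (i, j)), x (.inl (i, j)), y (.inl (i, j)), t (.inl (i, j)))) L.target =
    wordLoss L (κ.decChain c y i) (κ.blocks s i) (κ.blocks x i) (κ.blocks y i) := by
  simp only [dec_eq]
  exact sum_use_block (fun u => κ.sum_outputLaw (κ.decChain c y) y u) i fun t : Fin (2 ^ m) → T =>
    varDist (empirical fun j => (s (.inl (i, j)), x (.inl (i, j)), y (.inl (i, j)), t j)) L.target

lemma sum_arrow_prod {ι A B : Type*} [Fintype ι] [DecidableEq ι] [Fintype A] [Fintype B]
    (F : (ι → A) → (ι → B) → ℝ) :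
    ∑ x, ∑ y, F x y = ∑ z : ι → A × B, F (fun i => (z i).1) (fun i => (z i).2) := by
  rw [← (Equiv.arrowProdEquivProdArrow ι (fun _ => A) fun _ => B).symm.sum_comp,
    Fintype.sum_prod_type]
  rfl

lemma sum_input_block (v : Fin κ.k → Word m) (s : κ.Use → S) (i : Fin κ.k)
    (φ : (Fin (2 ^ m) → X) → (Fin (2 ^ m) → Y) → ℝ) :
    ∑ x : κ.Use → X, ∑ y : κ.Use → Y, (∏ u, κ.inputLaw c v s u (x u)) * (∏ u, L.W (x u) (y u)) *
      φ (κ.blocks x i) (κ.blocks y i) = blockMean L (v i) (κ.blocks s i) φ := by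
  rw [sum_arrow_prod, blockMean, sum_arrow_prod]
  simp only [← Finset.prod_mul_distrib]
  refine sum_use_block (g := fun u (z : X × Y) => κ.inputLaw c v s u z.1 * L.W z.1 z.2) (fun u => ?_) i
    fun z => φ (fun j => (z j).1) fun j => (z j).2
  rw [Fintype.sum_prod_type]
  simp only [← Finset.mul_sum, (L.W_mem _).2, mul_one, κ.sum_inputLaw c v s u]

lemma sum_input_extra (v : Fin κ.k → Word m) (s : κ.Use → S) (φ : (Fin (2 ^ κ.mx) → Y) → ℝ) :
    ∑ x : κ.Use → X, ∑ y : κ.Use → Y, (∏ u, κ.inputLaw c v s u (x u)) * (∏ u, L.W (x u) (y u)) *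
      φ (κ.extra y) = κ.extraMean (κ.encExtra c v) φ := by
  rw [sum_arrow_prod, extraMean, sum_arrow_prod]
  simp only [← Finset.prod_mul_distrib]
  refine sum_use_extra (g := fun u (z : X × Y) => κ.inputLaw c v s u z.1 * L.W z.1 z.2) (fun u => ?_)
    fun z => φ fun j => (z j).2
  rw [Fintype.sum_prod_type]
  simp only [← Finset.mul_sum, (L.W_mem _).2, mul_one, κ.sum_inputLaw c v s u]

/-- The probability of a wrong decision in a block. -/
noncomputable def blockErr (L : AuxLaw S X Y T) (β : ℝ) {m : ℕ} (v : Word m)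
    (s : Fin (2 ^ m) → S) : ℝ :=
  blockMean L v s fun _ y => if blockError L β v y then 1 else 0

/-- The probability of a wrong decision in the extra block. -/
noncomputable def extraErr (z : Word κ.mx) : ℝ :=
  κ.extraMean z fun y => if κ.extraError z y then 1 else 0

/-- Either no decision with the true past is wrong and the decoder has the true words, or an
indicator equals one and 2 bounds any loss. -/
lemma wordLoss_decChain_le (i : Fin κ.k) {s : κ.Use → S} {v : Fin κ.k → Word m} (x : κ.Use → X)
    (y : κ.Use → Y) (hv : ∀ i j, κ.encStep c (κ.blocks s) v i j ≠ 0) :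
    wordLoss L (κ.decChain c y i) (κ.blocks s i) (κ.blocks x i) (κ.blocks y i) ≤
      wordLoss L (v i) (κ.blocks s i) (κ.blocks x i) (κ.blocks y i) +
      2 * (∑ i', (if blockError L β (v i') (κ.blocks y i') then 1 else 0) +
        if κ.extraError (κ.encExtra c v) (κ.extra y) then 1 else 0) := by
  have hsum : ∀ i', (0 : ℝ) ≤ if blockError L β (v i') (κ.blocks y i') then 1 else 0 := fun i' => by
    split_ifs <;> norm_num
  have h2 := wordLoss_le_two (L := L) (κ.decChain c y i) (κ.blocks s i) (κ.blocks x i) (κ.blocks y i)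
  have h0 := wordLoss_nonneg (L := L) (v i) (κ.blocks s i) (κ.blocks x i) (κ.blocks y i)
  have h0' := Finset.sum_nonneg fun i' (_ : i' ∈ Finset.univ) => hsum i'
  by_cases hx : κ.extraError (κ.encExtra c v) (κ.extra y)
  · rw [if_pos hx]
    linarith
  · rw [if_neg hx]
    by_cases hb : ∀ i', ¬blockError L β (v i') (κ.blocks y i')
    · rw [κ.decChain_eq hv hx hb]
      linarith
    · obtain ⟨i', hi'⟩ := not_forall_not.1 hb
      have h1 := Finset.single_le_sum (fun i' _ => hsum i') (Finset.mem_univ i')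
      rw [if_pos hi'] at h1
      linarith

/-- The expected distance of the type of a block from the target is controlled by the words that
the encoder generates. -/
lemma blockLoss_le (i : Fin κ.k) :
    blockLoss L.PS L.W L.target κ.enc κ.dec c i ≤
      ∑ s : κ.Use → S, (∏ u, L.PS (s u)) * ∑ v : Fin κ.k → Word m,
        (∏ i, ∏ j, κ.encStep c (κ.blocks s) v i j) *
        (blockMean L (v i) (κ.blocks s i) (wordLoss L (v i) (κ.blocks s i)) +
          2 * (∑ i', blockErr L β (v i') (κ.blocks s i') + κ.extraErr (κ.encExtra c v))) := by
  have e : blockLoss L.PS L.W L.target κ.enc κ.dec c i = ∑ s : κ.Use → S, (∏ u, L.PS (s u)) *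
      ∑ v : Fin κ.k → Word m, (∏ i, ∏ j, κ.encStep c (κ.blocks s) v i j) *
        ∑ x : κ.Use → X, ∑ y : κ.Use → Y, (∏ u, κ.inputLaw c v s u (x u)) *
          (∏ u, L.W (x u) (y u)) *
          wordLoss L (κ.decChain c y i) (κ.blocks s i) (κ.blocks x i) (κ.blocks y i) := by
    rw [blockLoss]
    refine Finset.sum_congr rfl fun s _ => ?_
    calc _ = ∑ x : κ.Use → X, ∑ y : κ.Use → Y, ∑ v : Fin κ.k → Word m, (∏ u, L.PS (s u)) *
          ((∏ i, ∏ j, κ.encStep c (κ.blocks s) v i j) * ((∏ u, κ.inputLaw c v s u (x u)) *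
          (∏ u, L.W (x u) (y u)) *
          wordLoss L (κ.decChain c y i) (κ.blocks s i) (κ.blocks x i) (κ.blocks y i))) := by
          refine Finset.sum_congr rfl fun x _ => Finset.sum_congr rfl fun y _ => ?_
          simp only [mul_assoc, ← Finset.mul_sum]
          rw [sum_dec_mul, enc_eq, Finset.sum_mul, Finset.mul_sum]
          rw [Finset.mul_sum]
          refine Finset.sum_congr rfl fun v _ => ?_
          ring
      _ = _ := by
          simp only [Finset.mul_sum]
          rw [Finset.sum_congr rfl fun x _ => Finset.sum_comm, Finset.sum_comm]
  rw [e]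
  refine Finset.sum_le_sum fun s _ => mul_le_mul_of_nonneg_left (Finset.sum_le_sum fun v _ => ?_)
    (Finset.prod_nonneg fun u _ => L.PS_mem.1 _)
  -- Positive weight of the words is what `decChain_eq` asks for; the others drop out.
  by_cases hv : (∏ i, ∏ j, κ.encStep c (κ.blocks s) v i j) = 0
  · rw [hv, zero_mul, zero_mul]
  have hv' : ∀ i j, κ.encStep c (κ.blocks s) v i j ≠ 0 := fun i j =>
    Finset.prod_ne_zero_iff.1 (Finset.prod_ne_zero_iff.1 hv i (Finset.mem_univ i)) j
      (Finset.mem_univ j)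
  refine mul_le_mul_of_nonneg_left ?_ (Finset.prod_nonneg fun i _ => Finset.prod_nonneg fun j _ =>
    κ.encStep_nonneg c _ _ _ _)
  calc _ ≤ ∑ x : κ.Use → X, ∑ y : κ.Use → Y, (∏ u, κ.inputLaw c v s u (x u)) *
      (∏ u, L.W (x u) (y u)) * (wordLoss L (v i) (κ.blocks s i) (κ.blocks x i) (κ.blocks y i) +
      2 * (∑ i', (if blockError L β (v i') (κ.blocks y i') then 1 else 0) +
        if κ.extraError (κ.encExtra c v) (κ.extra y) then 1 else 0)) :=
        Finset.sum_le_sum fun x _ => Finset.sum_le_sum fun y _ => mul_le_mul_of_nonneg_left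
          (κ.wordLoss_decChain_le c i x y hv')
          (mul_nonneg (Finset.prod_nonneg fun u _ => κ.inputLaw_nonneg c v s u _)
            (Finset.prod_nonneg fun u _ => (L.W_mem _).1 _))
    _ = _ := by
        have lin : ∀ (w f h : ℝ) (g : Fin κ.k → ℝ),
            w * (f + 2 * (∑ i, g i + h)) = w * f + 2 * (∑ i, w * g i + w * h) := by
          intro w f h g
          rw [← Finset.mul_sum]
          ring
        have hb : ∑ x : κ.Use → X, ∑ y : κ.Use → Y, ∑ i', (∏ u, κ.inputLaw c v s u (x u)) *
            (∏ u, L.W (x u) (y u)) * (if blockError L β (v i') (κ.blocks y i') then 1 else 0) =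
            ∑ i', blockErr L β (v i') (κ.blocks s i') := by
          rw [Finset.sum_congr rfl fun x _ => Finset.sum_comm, Finset.sum_comm]
          exact Finset.sum_congr rfl fun i' _ => κ.sum_input_block c v s i'
            fun _ y => if blockError L β (v i') y then 1 else 0
        have hx := κ.sum_input_extra c v s fun y => if κ.extraError (κ.encExtra c v) y then 1 else 0
        have hw := κ.sum_input_block c v s i (wordLoss L (v i) (κ.blocks s i))
        simp only [lin, Finset.sum_add_distrib]
        rw [hw]
        congr 1
        rw [← hb, extraErr, ← hx, ← Finset.sum_add_distrib, Finset.mul_sum]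
        refine Finset.sum_congr rfl fun x _ => ?_
        rw [← Finset.sum_add_distrib, Finset.mul_sum]

end Choice

end PolarCoord

namespace PolarCoord
open scoped Classical BigOperators

/-! ### The average over the common randomness -/

lemma expect_prod_type {A B : Type*} [Fintype A] [Fintype B] (f : A × B → ℝ) :
    𝔼 z, f z = 𝔼 a, 𝔼 b, f (a, b) := by
  rw [← Finset.univ_product_univ, Finset.expect_product]

namespace Choice

variable {S X Y T : Type*} [Fintype S] [Fintype X] [Fintype Y] [Fintype T]
  {L : AuxLaw S X Y T} {β : ℝ} {m : ℕ} (κ : Choice L β m)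

/-- The one-time pads follow the schedule `keySchedule`, and those of the extra block are fresh. -/
structure Scheduled (p : ℕ) where
  pos : 0 < p
  k_eq : κ.k = p * (p + 1)
  keys : ((Fin p ⊕ Fin p) × Fin (2 ^ m)) ⊕ Fin (2 ^ κ.mx) ≃ Fin κ.q
  padR_eq : ∀ i j, κ.padR i j = keys (.inl (keySchedule p pos i, j))
  padX_eq : ∀ i, κ.padX i = keys (.inr (κ.place i))

/-- The transition weight of the words and sources of successive blocks. -/
noncomputable def blockStep (c₁ : L.A1 β m → ZMod 2) (d : κ.D → Fin (2 ^ κ.b))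
    (w : Option (Word m)) (st : Word m × (Fin (2 ^ m) → S)) : ℝ :=
  (∏ j, L.PS (st.2 j)) * ∏ j, κ.stepFun c₁ d w st.2 j st.1

lemma sum_blockStep (c₁ : L.A1 β m → ZMod 2) (d : κ.D → Fin (2 ^ κ.b)) (w : Option (Word m)) :
    ∑ st, κ.blockStep c₁ d w st = 1 := by
  rw [Fintype.sum_prod_type, Finset.sum_comm]
  simp only [blockStep, ← Finset.mul_sum,
    (κ.stepFun_isKernel L.lawUS_isBitLaw c₁ d w _).sum_prod, mul_one]
  exact sum_pi_eq_one fun _ => L.PS_mem.2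

lemma expect_blockStep_some (c₁ : L.A1 β m → ZMod 2) (d : κ.D → Fin (2 ^ κ.b))
    (st : Word m × (Fin (2 ^ m) → S)) :
    𝔼 w : Word m, κ.blockStep c₁ d (some w) st = κ.blockStep c₁ d none st := by
  simp only [blockStep, ← Finset.mul_expect, expect_stepFun_some]

/-- The law of the polarized word and the source of a block. -/
noncomputable def idealLaw (st : Word m × (Fin (2 ^ m) → S)) : ℝ :=
  (∏ j, L.PS (st.2 j)) * ∏ j, κ.idealStep st.2 j st.1

lemma expect_blockStep_none (st : Word m × (Fin (2 ^ m) → S)) :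
    𝔼 c₁ : L.A1 β m → ZMod 2, 𝔼 d : κ.D → Fin (2 ^ κ.b), κ.blockStep c₁ d none st =
      κ.idealLaw st := by
  simp only [blockStep, ← Finset.mul_expect, expect_stepFun_none, idealLaw]

variable {κ} {p : ℕ} (σ : κ.Scheduled p)
include σ

/-- The keys, as words indexed by the schedule and a word for the extra block. -/
noncomputable def Scheduled.keyEquiv :
    (Fin κ.q → ZMod 2) ≃ ((Fin p ⊕ Fin p) → Word m) × Word κ.mx :=
  ((Equiv.arrowCongr σ.keys (Equiv.refl _)).symm.trans (Equiv.sumArrowEquivProdArrow _ _ _)).trans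
    ((Equiv.curry _ _ _).prodCongr (Equiv.refl _))

lemma Scheduled.key_padR (K : (Fin p ⊕ Fin p) → Word m) (x : Word κ.mx) (i : Fin κ.k)
    (j : Fin (2 ^ m)) : σ.keyEquiv.symm (K, x) (κ.padR i j) = K (keySchedule p σ.pos i) j := by
  rw [σ.padR_eq]
  simp [Scheduled.keyEquiv]

lemma Scheduled.key_padX (K : (Fin p ⊕ Fin p) → Word m) (x : Word κ.mx)
    (i : Fin κ.k × Fin (2 ^ m)) : σ.keyEquiv.symm (K, x) (κ.padX i) = x (κ.place i) := by
  rw [σ.padX_eq]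
  simp [Scheduled.keyEquiv]

/-- The randomness of the extra block is averaged innermost, for fixed words of the chained blocks.
-/
lemma Scheduled.expect_common (F : κ.Common → ℝ) :
    𝔼 c, F c = 𝔼 c₁, 𝔼 d, 𝔼 K, 𝔼 x, 𝔼 g, 𝔼 e, F (c₁, σ.keyEquiv.symm (K, x), d, g, e) := by
  have hk : ∀ f : (Fin κ.q → ZMod 2) → ℝ, 𝔼 k, f k = 𝔼 K, 𝔼 x, f (σ.keyEquiv.symm (K, x)) := by
    intro f
    rw [← expect_prod_type fun z => f (σ.keyEquiv.symm z)]
    exact Fintype.expect_equiv σ.keyEquiv _ _ fun k => by rw [Equiv.symm_apply_apply]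
  rw [expect_prod_type]
  refine Finset.expect_congr rfl fun c₁ _ => ?_
  rw [expect_prod_type, hk]
  simp only [expect_prod_type]
  rw [Finset.expect_congr rfl fun K _ => Finset.expect_comm _ _ _, Finset.expect_comm]

/-- The weight of the words and sources of all blocks. -/
lemma Scheduled.prod_encStep (c₁ : L.A1 β m → ZMod 2) (d : κ.D → Fin (2 ^ κ.b))
    (K : (Fin p ⊕ Fin p) → Word m) (x : Word κ.mx) (g : κ.frozen → ZMod 2)
    (e : κ.drawn → Fin (2 ^ κ.b)) (s : Fin κ.k → Fin (2 ^ m) → S) (v : Fin κ.k → Word m) :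
    (∏ i, ∏ j, L.PS (s i j)) *
      ∏ i, ∏ j, κ.encStep (c₁, σ.keyEquiv.symm (K, x), d, g, e) s v i j =
    ∏ l : Fin κ.k, if 0 < l.val then
      padStep σ.pos (fun st : Word m × (Fin (2 ^ m) → S) => st.1)
        (fun w st => κ.blockStep c₁ d (some w) st) K (l.val - 1)
        (v ⟨l.val - 1, (Nat.sub_le _ _).trans_lt l.isLt⟩,
          s ⟨l.val - 1, (Nat.sub_le _ _).trans_lt l.isLt⟩) (v l, s l)
      else κ.blockStep c₁ d none (v l, s l) := by
  rw [← Finset.prod_mul_distrib]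
  refine Finset.prod_congr rfl fun l _ => ?_
  simp only [encStep_eq, σ.key_padR]
  by_cases hl : 0 < l.val
  · simp only [hl, if_true]
    rfl
  · simp only [hl, if_false]
    rfl

/-- For given shared bits and seeds and on average over the keys, every block has the same law. -/
lemma Scheduled.expect_sum_block (c₁ : L.A1 β m → ZMod 2) (d : κ.D → Fin (2 ^ κ.b)) (i : Fin κ.k)
    (f : Word m → (Fin (2 ^ m) → S) → ℝ) :
    𝔼 K : (Fin p ⊕ Fin p) → Word m, ∑ s : Fin κ.k → Fin (2 ^ m) → S, ∑ v : Fin κ.k → Word m,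
      (∏ l : Fin κ.k, if 0 < l.val then
        padStep σ.pos (fun st : Word m × (Fin (2 ^ m) → S) => st.1)
          (fun w st => κ.blockStep c₁ d (some w) st) K (l.val - 1)
          (v ⟨l.val - 1, (Nat.sub_le _ _).trans_lt l.isLt⟩,
            s ⟨l.val - 1, (Nat.sub_le _ _).trans_lt l.isLt⟩) (v l, s l)
        else κ.blockStep c₁ d none (v l, s l)) * f (v i) (s i) =
    ∑ st, κ.blockStep c₁ d none st * f st.1 st.2 := by
  have h : ∀ K : (Fin p ⊕ Fin p) → Word m, (∑ s : Fin κ.k → Fin (2 ^ m) → S,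
      ∑ v : Fin κ.k → Word m, (∏ l : Fin κ.k, if 0 < l.val then
        padStep σ.pos (fun st : Word m × (Fin (2 ^ m) → S) => st.1)
          (fun w st => κ.blockStep c₁ d (some w) st) K (l.val - 1)
          (v ⟨l.val - 1, (Nat.sub_le _ _).trans_lt l.isLt⟩,
            s ⟨l.val - 1, (Nat.sub_le _ _).trans_lt l.isLt⟩) (v l, s l)
        else κ.blockStep c₁ d none (v l, s l)) * f (v i) (s i)) =
      ∑ st, stateLaw (κ.blockStep c₁ d none)
        (padStep σ.pos (fun st : Word m × (Fin (2 ^ m) → S) => st.1)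
          (fun w st => κ.blockStep c₁ d (some w) st) K) i st * f st.1 st.2 := by
    intro K
    rw [Finset.sum_comm, sum_arrow_prod]
    exact sum_path' (M := padStep σ.pos (fun st : Word m × (Fin (2 ^ m) → S) => st.1)
      (fun w st => κ.blockStep c₁ d (some w) st) K) (fun i st => κ.sum_blockStep c₁ d _) i
      fun st => f st.1 st.2
  simp only [h, Finset.expect_sum_comm, ← Finset.expect_mul]
  refine Finset.sum_congr rfl fun st _ => ?_
  rw [expect_stateLaw σ.pos (κ.expect_blockStep_some c₁ d) (κ.sum_blockStep c₁ d none)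
    (fun w => κ.sum_blockStep c₁ d _) i (by rw [← σ.k_eq]; exact i.isLt)]

omit σ in
lemma sum_source (G : (Fin κ.k → Fin (2 ^ m) → S) → ℝ) :
    ∑ s : κ.Use → S, (∏ u, L.PS (s u)) * G (κ.blocks s) =
      ∑ s : Fin κ.k → Fin (2 ^ m) → S, (∏ i, ∏ j, L.PS (s i j)) * G s := by
  rw [sum_use]
  simp only [Fintype.prod_sum_type, Fintype.prod_prod_type]
  change ∑ sb : Fin κ.k → Fin (2 ^ m) → S, ∑ se : Fin (2 ^ κ.mx) → S,
    ((∏ l, ∏ j, L.PS (sb l j)) * ∏ t, L.PS (se t)) * G sb = _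
  refine Finset.sum_congr rfl fun sb _ => ?_
  rw [← Finset.sum_mul, ← Finset.mul_sum, sum_pi_eq_one fun _ => L.PS_mem.2, mul_one]

/-- On average over the common randomness, every block has the ideal law. -/
theorem Scheduled.expect_block (i : Fin κ.k) (f : Word m → (Fin (2 ^ m) → S) → ℝ) :
    𝔼 c, ∑ s : κ.Use → S, (∏ u, L.PS (s u)) * ∑ v : Fin κ.k → Word m,
      (∏ i, ∏ j, κ.encStep c (κ.blocks s) v i j) * f (v i) (κ.blocks s i) =
    ∑ st, κ.idealLaw st * f st.1 st.2 := by
  rw [Finset.expect_congr rfl fun c _ => sum_source fun s => ∑ v : Fin κ.k → Word m,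
    (∏ i, ∏ j, κ.encStep c s v i j) * f (v i) (s i)]
  simp only [Finset.mul_sum, ← mul_assoc]
  rw [σ.expect_common]
  simp only [σ.prod_encStep, Fintype.expect_const]
  -- C₁ and the seeds for D are common to all blocks; they are averaged last, when each block is
  -- already reduced to the law of the first.
  simp only [σ.expect_sum_block]
  simp only [Finset.expect_sum_comm, ← Finset.expect_mul, expect_blockStep_none]

/-- The word of the extra block, with the fresh keys made explicit. -/
lemma Scheduled.encExtra_eq (c₁ : L.A1 β m → ZMod 2) (d : κ.D → Fin (2 ^ κ.b))
    (K : (Fin p ⊕ Fin p) → Word m) (x : Word κ.mx) (g : κ.frozen → ZMod 2)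
    (e : κ.drawn → Fin (2 ^ κ.b)) (v : Fin κ.k → Word m) :
    κ.encExtra (c₁, σ.keyEquiv.symm (K, x), d, g, e) v =
      κ.channelWord (c₁, 0, d, g, e)
        fun t _ => (∑ p ∈ κ.msg with κ.place p = t, v p.1 p.2) + x t := by
  rw [encExtra, channelWord_eq_iff]
  intro t
  have ht := (κ.channelWord_eq_iff (c₁, 0, d, g, e)
    (f := fun t _ => (∑ p ∈ κ.msg with κ.place p = t, v p.1 p.2) + x t)).1 rfl t
  rw [ht]
  by_cases hs : t ∈ κ.slots
  · rw [if_pos hs, if_pos hs]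
    obtain ⟨q, hq, rfl⟩ := Finset.mem_image.1 hs
    rw [κ.filter_place_eq hq, Finset.sum_singleton, Finset.sum_singleton]
    exact congrArg _ (σ.key_padX K x q).symm
  · rw [if_neg hs, if_neg hs]

/-- On average over the common randomness, the word of the extra block is independent of the other
blocks. -/
theorem Scheduled.expect_extra (F : Word κ.mx → ℝ) :
    𝔼 c, ∑ s : κ.Use → S, (∏ u, L.PS (s u)) * ∑ v : Fin κ.k → Word m,
      (∏ i, ∏ j, κ.encStep c (κ.blocks s) v i j) * F (κ.encExtra c v) =
    ∑ z, (∏ t, κ.extraStep t z) * F z := by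
  rw [Finset.expect_congr rfl fun c _ => sum_source fun s => ∑ v : Fin κ.k → Word m,
    (∏ i, ∏ j, κ.encStep c s v i j) * F (κ.encExtra c v)]
  simp only [Finset.mul_sum, ← mul_assoc]
  rw [σ.expect_common]
  simp only [σ.prod_encStep, σ.encExtra_eq]
  -- The pads of the extra block occur nowhere else, so averaging over them hides the message.
  simp only [Finset.expect_sum_comm, ← Finset.mul_expect, expect_channelWord]
  simp only [← Finset.expect_sum_comm]
  -- The remaining function is constant; block 0 is an arbitrary index that lets the weights sum
  -- out.
  simp only [σ.expect_sum_block _ _ ⟨0, κ.k_pos⟩ fun _ _ => ∑ z, (∏ t, κ.extraStep t z) * F z]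
  simp only [← Finset.sum_mul, sum_blockStep, one_mul, Fintype.expect_const]

end Choice

end PolarCoord

namespace PolarCoord
open scoped Classical BigOperators

/-! ### The failure probability of the scheme -/

lemma sum_mul_le_of_sum_abs_sub_le {A : Type*} [Fintype A] {P Q f : A → ℝ} {C δ : ℝ}
    (h : ∑ a, |P a - Q a| ≤ δ) (h0 : ∀ a, 0 ≤ f a) (hC : ∀ a, f a ≤ C) (hC0 : 0 ≤ C) :
    ∑ a, P a * f a ≤ ∑ a, Q a * f a + C * δ := by
  calc ∑ a, P a * f a ≤ ∑ a, (Q a * f a + C * |P a - Q a|) := by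
        refine Finset.sum_le_sum fun a _ => ?_
        have h1 := mul_le_mul_of_nonneg_right (le_abs_self (P a - Q a)) (h0 a)
        have h2 := mul_le_mul_of_nonneg_left (hC a) (abs_nonneg (P a - Q a))
        nlinarith
    _ ≤ _ := by
        rw [Finset.sum_add_distrib, ← Finset.mul_sum]
        gcongr

/-- The error probability of successive cancellation outside the high entropy positions. -/
lemma IsBitLaw.sum_exists_decide_ne_le {O : Type*} [Fintype O] {p : ZMod 2 → O → ℝ}
    (hp : IsBitLaw p) (β : ℝ) (m : ℕ) :
    ∑ w, polarLaw p m w *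
      (if ∃ j, j ∉ high p β m ∧ decide01 p m j w.1 w.2 ≠ w.1 j then 1 else 0) ≤
      2 ^ m * threshold β m := by
  calc _ ≤ ∑ w, polarLaw p m w * ∑ j ∈ (high p β m)ᶜ,
        (if decide01 p m j w.1 w.2 = w.1 j then 0 else 1) := by
        refine Finset.sum_le_sum fun w _ => mul_le_mul_of_nonneg_left ?_ (hp.polarLaw_nonneg m w)
        have h0 : ∀ j ∈ (high p β m)ᶜ, (0 : ℝ) ≤ if decide01 p m j w.1 w.2 = w.1 j then 0 else 1 :=
          fun j _ => by split_ifs <;> norm_num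
        split_ifs with h
        · obtain ⟨j, hj, hne⟩ := h
          have := Finset.single_le_sum h0 (Finset.mem_compl.2 hj)
          rwa [if_neg hne] at this
        · exact Finset.sum_nonneg h0
    _ = ∑ j ∈ (high p β m)ᶜ, ∑ w, polarLaw p m w *
        (if decide01 p m j w.1 w.2 = w.1 j then 0 else 1) := by
        simp only [Finset.mul_sum]
        exact Finset.sum_comm
    _ ≤ ∑ j ∈ (high p β m)ᶜ, threshold β m := by
        refine Finset.sum_le_sum fun j hj => (hp.sum_decide_ne_le j).trans ?_
        rw [Finset.mem_compl, high, Finset.mem_filter, not_and] at hj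
        exact not_lt.1 (hj (Finset.mem_univ j))
    _ ≤ _ := by
        rw [Finset.sum_const, nsmul_eq_mul]
        refine mul_le_mul_of_nonneg_right ?_ (threshold_pos β m).le
        have := Finset.card_le_univ (high p β m)ᶜ
        rw [Fintype.card_fin] at this
        exact_mod_cast this

namespace Choice

variable {S X Y T : Type*} [Fintype S] [Fintype X] [Fintype Y] [Fintype T]
  {L : AuxLaw S X Y T} {β : ℝ} {m : ℕ}

lemma blockMean_nonneg (v : Word m) (s : Fin (2 ^ m) → S)
    {φ : (Fin (2 ^ m) → X) → (Fin (2 ^ m) → Y) → ℝ} (hφ : ∀ x y, 0 ≤ φ x y) :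
    0 ≤ blockMean L v s φ :=
  Finset.sum_nonneg fun _ _ => Finset.sum_nonneg fun _ _ => mul_nonneg (Finset.prod_nonneg
    fun _ _ => mul_nonneg ((L.PX_mem _ _).1 _) ((L.W_mem _).1 _)) (hφ _ _)

lemma blockMean_le (v : Word m) (s : Fin (2 ^ m) → S)
    {φ : (Fin (2 ^ m) → X) → (Fin (2 ^ m) → Y) → ℝ} {C : ℝ} (hφ : ∀ x y, φ x y ≤ C) :
    blockMean L v s φ ≤ C := by
  calc blockMean L v s φ ≤ ∑ x : Fin (2 ^ m) → X, ∑ y : Fin (2 ^ m) → Y,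
        (∏ j, L.PX (Matrix.vecMul v (polarMatrix m) j) (s j) (x j) * L.W (x j) (y j)) * C :=
        Finset.sum_le_sum fun _ _ => Finset.sum_le_sum fun _ _ =>
          mul_le_mul_of_nonneg_left (hφ _ _) (Finset.prod_nonneg fun _ _ =>
            mul_nonneg ((L.PX_mem _ _).1 _) ((L.W_mem _).1 _))
    _ = C := by
        simp only [← Finset.sum_mul, Finset.prod_mul_distrib, ← Finset.mul_sum,
          sum_pi_eq_one fun j => (L.W_mem _).2, mul_one, sum_pi_eq_one fun j => (L.PX_mem _ _).2,
          one_mul]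

/-- X and Y are produced letter by letter, so summing out S and X turns the law of (V, S) into that
of (V, Y), for which wrong decisions are rare. -/
lemma sum_polarLaw_blockErr (L : AuxLaw S X Y T) (β : ℝ) (m : ℕ) :
    ∑ st, polarLaw L.lawUS m st * blockErr L β st.1 st.2 ≤ 2 ^ m * threshold β m := by
  refine le_trans (le_of_eq ?_) (L.lawUY_isBitLaw.sum_exists_decide_ne_le β m)
  rw [Fintype.sum_prod_type, Fintype.sum_prod_type]
  refine Finset.sum_congr rfl fun v _ => ?_
  simp only [blockErr, blockMean, Finset.mul_sum]
  rw [Finset.sum_congr rfl fun s _ => Finset.sum_comm, Finset.sum_comm]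
  refine Finset.sum_congr rfl fun y _ => ?_
  suffices e : ∑ s : Fin (2 ^ m) → S, ∑ x : Fin (2 ^ m) → X, polarLaw L.lawUS m (v, s) *
      ∏ j, L.PX (Matrix.vecMul v (polarMatrix m) j) (s j) (x j) * L.W (x j) (y j) =
      polarLaw L.lawUY m (v, y) by
    rw [← e, Finset.sum_mul]
    refine Finset.sum_congr rfl fun s _ => ?_
    rw [Finset.sum_mul]
    refine Finset.sum_congr rfl fun x _ => ?_
    rw [← mul_assoc]
    exact congrArg₂ _ rfl (if_congr Iff.rfl rfl rfl)
  simp only [polarLaw, ← Finset.prod_mul_distrib]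
  rw [sum_arrow_prod, sum_pi_prod fun i (z : S × X) =>
    L.lawUS (Matrix.vecMul v (polarMatrix m) i) z.1 *
      (L.PX (Matrix.vecMul v (polarMatrix m) i) z.1 z.2 * L.W z.2 (y i))]
  refine Finset.prod_congr rfl fun i _ => ?_
  rw [AuxLaw.lawUY_eq, Fintype.sum_prod_type]
  simp only [mul_assoc]

/-- Under the i.i.d. law, the expected distance of the type from the target is small. -/
lemma sum_polarLaw_wordLoss (L : AuxLaw S X Y T) (m : ℕ) :
    ∑ st, polarLaw L.lawUS m st * blockMean L st.1 st.2 (wordLoss L st.1 st.2) ≤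
      Fintype.card (S × X × Y × T) / √(2 ^ m) := by
  have h := sum_prod_mul_varDist_le L.target_mem (n := 2 ^ m) (by positivity)
  push_cast at h
  refine le_trans (le_of_eq ?_) h
  -- In the coordinates u = vG all five sequences are jointly i.i.d., and summing out u letter by
  -- letter leaves the target.
  rw [Fintype.sum_prod_type, ← (polarEquiv m).sum_comp]
  have e : ∀ u : Word m, Matrix.vecMul (polarEquiv m u) (polarMatrix m) = u :=
    (polarEquiv m).left_inv
  simp only [blockMean, wordLoss, polarLaw, e, Finset.mul_sum]
  calc _ = ∑ u : Word m, ∑ w : Fin (2 ^ m) → S × X × Y × T,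
        (∏ i, L.lawUS (u i) (w i).1 * (L.PX (u i) (w i).1 (w i).2.1 *
          L.W (w i).2.1 (w i).2.2.1 * L.PT (u i) (w i).2.2.1 (w i).2.2.2)) *
        varDist (empirical w) L.target := by
        refine Finset.sum_congr rfl fun u _ => ?_
        rw [← sum_arrow_prod fun (s : Fin (2 ^ m) → S) (w : Fin (2 ^ m) → X × Y × T) =>
          (∏ i, L.lawUS (u i) (s i) * (L.PX (u i) (s i) (w i).1 *
          L.W (w i).1 (w i).2.1 * L.PT (u i) (w i).2.1 (w i).2.2)) *
          varDist (empirical fun i => (s i, w i)) L.target]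
        refine Finset.sum_congr rfl fun s _ => ?_
        rw [← sum_arrow_prod fun (x : Fin (2 ^ m) → X) (w : Fin (2 ^ m) → Y × T) =>
          (∏ i, L.lawUS (u i) (s i) * (L.PX (u i) (s i) (x i) *
          L.W (x i) (w i).1 * L.PT (u i) (w i).1 (w i).2)) *
          varDist (empirical fun i => (s i, x i, w i)) L.target]
        refine Finset.sum_congr rfl fun x _ => ?_
        rw [← sum_arrow_prod fun (y : Fin (2 ^ m) → Y) (t : Fin (2 ^ m) → T) =>
          (∏ i, L.lawUS (u i) (s i) * (L.PX (u i) (s i) (x i) *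
          L.W (x i) (y i) * L.PT (u i) (y i) (t i))) *
          varDist (empirical fun i => (s i, x i, y i, t i)) L.target]
        refine Finset.sum_congr rfl fun y _ => Finset.sum_congr rfl fun t _ => ?_
        simp only [Finset.prod_mul_distrib]
        ring
    _ = _ := by
        rw [Finset.sum_comm]
        refine Finset.sum_congr rfl fun w _ => ?_
        rw [← Finset.sum_mul, sum_pi_prod fun i u => L.lawUS u (w i).1 *
          (L.PX u (w i).1 (w i).2.1 * L.W (w i).2.1 (w i).2.2.1 * L.PT u (w i).2.2.1 (w i).2.2.2)]
        congr 1
        refine Finset.prod_congr rfl fun i _ => ?_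
        rw [AuxLaw.target_eq]
        simp only [mul_assoc]

variable (κ : Choice L β m)

/-- The accuracy of the law of a block. -/
lemma sum_abs_idealLaw_sub_le
    (hD : ∀ j ∈ κ.D, ∀ b v s, ∏ i, L.PS (s i) ≠ 0 →
      condBit L.lawU m j b v (fun _ => ()) = condBit L.lawUS m j b v s) :
    ∑ st, |κ.idealLaw st - polarLaw L.lawUS m st| ≤
      2 ^ m * (2 * √(threshold β m) + 2 * (1 / 2 ^ κ.b)) := by
  have h := L.lawUS_isBitLaw.sum_abs_sub_polarLaw_le (β := β) (η := 1 / 2 ^ κ.b) (by positivity)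
    (f := fun j v s => κ.idealStep s j v) (fun s => κ.idealStep_isKernel L.lawUS_isBitLaw s)
    (fun j => ?_)
  · simpa only [AuxLaw.obsLaw_lawUS, idealLaw] using h
  · by_cases h1 : j ∈ veryHigh L.lawUS β m
    · exact .inl ⟨h1, fun v s => if_pos h1⟩
    refine .inr fun v s hs => ?_
    rw [idealStep, if_neg h1]
    split_ifs with h2
    · rw [AuxLaw.obsLaw_lawUS] at hs
      -- Ignoring the source is exact here by `hD`, so only the quantization error 2^(-b) remains.
      rw [← hD j h2 _ v s hs]
      exact abs_seedProb_sub_le (q := fun b => condBit L.lawU m j b v fun _ => ())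
        (fun b => L.lawU_isBitLaw.condBit_nonneg j b v _) (IsBitLaw.condBit_add j v _) (v j)
    · rw [sub_self, abs_zero]
      positivity

lemma lawB_isBitLaw : IsBitLaw κ.lawB where
  nonneg u _ := κ.QB_mem.1 u
  sum_eq_one := by
    rw [Fintype.sum_unique, ← κ.QB_mem.2, sum_zmod_two]
    rfl

lemma lawBY_isBitLaw : IsBitLaw κ.lawBY where
  nonneg u y := mul_nonneg (κ.QB_mem.1 u) (Finset.sum_nonneg fun x _ =>
    mul_nonneg ((κ.QX_mem u).1 x) ((L.W_mem x).1 y))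
  sum_eq_one := by
    have h : ∀ u, ∑ y, κ.lawBY u y = κ.QB u := by
      intro u
      simp only [lawBY, ← Finset.mul_sum]
      rw [Finset.sum_comm]
      simp only [← Finset.mul_sum, (L.W_mem _).2, mul_one, (κ.QX_mem u).2]
    rw [Finset.sum_add_distrib, h, h, ← sum_zmod_two, κ.QB_mem.2]

/-- The accuracy of the law of the extra block. -/
lemma sum_abs_extraStep_sub_le :
    ∑ z : Word κ.mx, |∏ t, κ.extraStep t z - polarLaw κ.lawB κ.mx (z, fun _ => ())| ≤
      2 ^ κ.mx * (2 * √(threshold β κ.mx) + 2 * (1 / 2 ^ κ.b)) := by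
  have h := κ.lawB_isBitLaw.sum_abs_sub_polarLaw_le (β := β) (m := κ.mx) (η := 1 / 2 ^ κ.b)
    (by positivity) (f := fun t z _ => κ.extraStep t z) (fun _ => κ.extraStep_isKernel)
    (fun t => ?_)
  · have ho : obsLaw κ.lawB = fun _ => 1 := by
      funext o
      rw [obsLaw, lawB, lawB, ← sum_zmod_two, κ.QB_mem.2]
    rw [Fintype.sum_prod_type] at h
    simp only [ho, Finset.prod_const_one, one_mul, Fintype.sum_unique] at h
    exact h
  · by_cases h1 : t ∈ veryHigh κ.lawB β κ.mx
    · exact .inl ⟨h1, fun v s => if_pos h1⟩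
    refine .inr fun z o _ => ?_
    rw [extraStep, if_neg h1, show o = fun _ => () from rfl]
    exact abs_seedProb_sub_le (q := fun b => condBit κ.lawB κ.mx t b z fun _ => ())
      (fun b => κ.lawB_isBitLaw.condBit_nonneg t b z _) (IsBitLaw.condBit_add t z _) (z t)

lemma sum_polarLaw_extraErr :
    ∑ z : Word κ.mx, polarLaw κ.lawB κ.mx (z, fun _ => ()) * κ.extraErr z ≤
      2 ^ κ.mx * threshold β κ.mx := by
  refine le_trans (le_of_eq ?_) (κ.lawBY_isBitLaw.sum_exists_decide_ne_le β κ.mx)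
  rw [Fintype.sum_prod_type]
  refine Finset.sum_congr rfl fun z _ => ?_
  simp only [extraErr, extraMean, Finset.mul_sum]
  rw [Finset.sum_comm]
  refine Finset.sum_congr rfl fun y _ => ?_
  simp only [← mul_assoc, ← Finset.sum_mul]
  refine congrArg₂ _ ?_ (if_congr Iff.rfl rfl rfl)
  simp only [polarLaw, ← Finset.prod_mul_distrib]
  rw [sum_pi_prod fun i (x : X) => κ.lawB (Matrix.vecMul z (polarMatrix κ.mx) i) () *
      (κ.QX (Matrix.vecMul z (polarMatrix κ.mx) i) x * L.W x (y i))]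
  refine Finset.prod_congr rfl fun i _ => ?_
  rw [← Finset.mul_sum]
  rfl

lemma extraErr_nonneg (z : Word κ.mx) : 0 ≤ κ.extraErr z :=
  Finset.sum_nonneg fun _ _ => Finset.sum_nonneg fun _ _ => mul_nonneg (Finset.prod_nonneg
    fun _ _ => mul_nonneg ((κ.QX_mem _).1 _) ((L.W_mem _).1 _)) (by beta_reduce; split_ifs <;> norm_num)

lemma extraErr_le_one (z : Word κ.mx) : κ.extraErr z ≤ 1 := by
  calc κ.extraErr z ≤ ∑ x : Fin (2 ^ κ.mx) → X, ∑ y : Fin (2 ^ κ.mx) → Y,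
        (∏ j, κ.QX (Matrix.vecMul z (polarMatrix κ.mx) j) (x j) * L.W (x j) (y j)) * 1 :=
        Finset.sum_le_sum fun _ _ => Finset.sum_le_sum fun _ _ =>
          mul_le_mul_of_nonneg_left (by beta_reduce; split_ifs <;> norm_num) (Finset.prod_nonneg fun _ _ =>
            mul_nonneg ((κ.QX_mem _).1 _) ((L.W_mem _).1 _))
    _ = 1 := by
        simp only [mul_one, Finset.prod_mul_distrib, ← Finset.mul_sum,
          sum_pi_eq_one fun j => (L.W_mem _).2, sum_pi_eq_one fun j => (κ.QX_mem _).2]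

variable {κ} {p : ℕ}

/-- The expected distance of the type of a block from the target. -/
theorem Scheduled.expect_blockLoss_le (σ : κ.Scheduled p)
    (hD : ∀ j ∈ κ.D, ∀ b v s, ∏ i, L.PS (s i) ≠ 0 →
      condBit L.lawU m j b v (fun _ => ()) = condBit L.lawUS m j b v s) (i : Fin κ.k) :
    𝔼 c, blockLoss L.PS L.W L.target κ.enc κ.dec c i ≤
      Fintype.card (S × X × Y × T) / √(2 ^ m) +
      2 * (2 ^ m * (2 * √(threshold β m) + 2 * (1 / 2 ^ κ.b))) +
      2 * (κ.k * (2 ^ m * threshold β m + 2 ^ m * (2 * √(threshold β m) + 2 * (1 / 2 ^ κ.b))) +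
        (2 ^ κ.mx * threshold β κ.mx +
          2 ^ κ.mx * (2 * √(threshold β κ.mx) + 2 * (1 / 2 ^ κ.b)))) := by
  have hTV := κ.sum_abs_idealLaw_sub_le hD
  have h1 := sum_mul_le_of_sum_abs_sub_le hTV
    (f := fun st => blockMean L st.1 st.2 (wordLoss L st.1 st.2)) (C := 2)
    (fun st => blockMean_nonneg _ _ fun _ _ => wordLoss_nonneg _ _ _ _)
    (fun st => blockMean_le _ _ fun _ _ => wordLoss_le_two _ _ _ _) zero_le_two
  have h2 := sum_mul_le_of_sum_abs_sub_le hTV (f := fun st => blockErr L β st.1 st.2) (C := 1)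
    (fun st => blockMean_nonneg _ _ fun _ _ => by split_ifs <;> norm_num)
    (fun st => blockMean_le _ _ fun _ _ => by split_ifs <;> norm_num) zero_le_one
  have h3 := sum_mul_le_of_sum_abs_sub_le κ.sum_abs_extraStep_sub_le (f := κ.extraErr) (C := 1)
    κ.extraErr_nonneg κ.extraErr_le_one zero_le_one
  have h4 := sum_polarLaw_wordLoss L m
  have h5 := sum_polarLaw_blockErr L β m
  have h6 := κ.sum_polarLaw_extraErr
  -- By linearity, all expectations reduce to the ideal law of a single block or of the extra block.
  -- Passing to the i.i.d. law costs the variational distance times the maximum of the function.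
  calc 𝔼 c, blockLoss L.PS L.W L.target κ.enc κ.dec c i ≤ _ :=
        Finset.expect_le_expect fun c _ => κ.blockLoss_le c i
    _ = ∑ st, κ.idealLaw st * blockMean L st.1 st.2 (wordLoss L st.1 st.2) +
        2 * (∑ _i' : Fin κ.k, ∑ st, κ.idealLaw st * blockErr L β st.1 st.2 +
          ∑ z, (∏ t, κ.extraStep t z) * κ.extraErr z) := by
        rw [← σ.expect_block i fun v s => blockMean L v s (wordLoss L v s), ← σ.expect_extra,
          ← Finset.sum_congr rfl fun i' _ => σ.expect_block i' fun v s => blockErr L β v s]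
        simp only [← Finset.expect_sum_comm, ← Finset.expect_add_distrib, Finset.mul_expect]
        refine Finset.expect_congr rfl fun c _ => ?_
        have lin : ∀ (w f h : ℝ) (g : Fin κ.k → ℝ),
            w * (f + 2 * (∑ i, g i + h)) = w * f + 2 * (∑ i, w * g i + w * h) := by
          intro w f h g
          rw [← Finset.mul_sum]
          ring
        have hb : ∑ i', ∑ s : κ.Use → S, (∏ u, L.PS (s u)) * ∑ v : Fin κ.k → Word m,
            (∏ i, ∏ j, κ.encStep c (κ.blocks s) v i j) * blockErr L β (v i') (κ.blocks s i') =
            ∑ s : κ.Use → S, (∏ u, L.PS (s u)) * ∑ v : Fin κ.k → Word m, ∑ i',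
            (∏ i, ∏ j, κ.encStep c (κ.blocks s) v i j) * blockErr L β (v i') (κ.blocks s i') := by
          rw [Finset.sum_comm]
          refine Finset.sum_congr rfl fun s _ => ?_
          rw [← Finset.mul_sum, Finset.sum_comm]
        have lin' : ∀ w f h g : ℝ, w * (f + 2 * (g + h)) = w * f + 2 * (w * g + w * h) := by
          intros
          ring
        rw [hb]
        simp only [lin, lin', Finset.sum_add_distrib, ← Finset.mul_sum]
    _ ≤ _ := by
        rw [Finset.sum_const, Finset.card_univ, Fintype.card_fin, nsmul_eq_mul]
        have h7 := mul_le_mul_of_nonneg_left (h2.trans (add_le_add_left h5 _))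
          (Nat.cast_nonneg (α := ℝ) κ.k)
        linarith

end Choice

end PolarCoord

namespace PolarCoord
open scoped Classical BigOperators

/-! ### Mutual information -/

section MutualInfo

variable {Ω α β : Type*} [Fintype Ω] {μ : Ω → ℝ}

lemma prob_pos (hμ : ∀ ω, 0 ≤ μ ω) {E : Ω → Prop} {ω : Ω} (hω : 0 < μ ω) (hE : E ω) :
    0 < prob μ E :=
  hω.trans_le (Finset.single_le_sum (f := μ) (fun ω _ => hμ ω)
    (Finset.mem_filter.2 ⟨Finset.mem_univ ω, hE⟩))

lemma mutualInfo_eq_sub (hμ : ∀ ω, 0 ≤ μ ω) (h1 : ∑ ω, μ ω = 1) (A : Ω → α) (B : Ω → β) :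
    mutualInfo μ A B = condEntropy μ A (fun _ => ()) - condEntropy μ A B := by
  rw [mutualInfo, condEntropy, condEntropy, ← Finset.sum_sub_distrib]
  refine Finset.sum_congr rfl fun ω _ => ?_
  rcases (hμ ω).eq_or_lt with h | h
  · simp [← h]
  rw [← mul_sub]
  congr 1
  have e1 : prob μ (fun _ => () = ()) = 1 := by
    rw [prob_eq_sum_ite, ← h1]
    simp
  have e2 : prob μ (fun ω' => A ω' = A ω ∧ () = ()) = prob μ (fun ω' => A ω' = A ω) :=
    prob_congr fun ω' => by simp
  rw [e1, e2]
  have hA := prob_pos hμ (E := fun ω' => A ω' = A ω) h rfl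
  have hB := prob_pos hμ (E := fun ω' => B ω' = B ω) h rfl
  have hAB := prob_pos hμ (E := fun ω' => A ω' = A ω ∧ B ω' = B ω) h ⟨rfl, rfl⟩
  rw [Real.logb_div hAB.ne' (mul_pos hA hB).ne', Real.logb_mul hA.ne' hB.ne',
    Real.logb_div one_ne_zero hA.ne', Real.logb_div hB.ne' hAB.ne', Real.logb_one]
  ring

/-- Equality in Gibbs' inequality. -/
lemma eq_of_sum_mul_logb_le {I : Type*} [Fintype I] {P Q : I → ℝ} (hP : ∀ i, 0 ≤ P i)
    (hQ : ∀ i, 0 ≤ Q i) (hP1 : ∑ i, P i = 1) (hQ1 : ∑ i, Q i = 1) (h0 : ∀ i, Q i = 0 → P i = 0)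
    (h : ∑ i, P i * Real.logb 2 (P i / Q i) ≤ 0) : P = Q := by
  -- These terms are nonnegative and, both masses being one, sum to the divergence up to the factor
  -- log 2. So all vanish, and 1 is the only zero of `klFun`.
  have key : ∀ i, Q i * InformationTheory.klFun (P i / Q i) =
      Real.log 2 * (P i * Real.logb 2 (P i / Q i)) + Q i - P i := by
    intro i
    have hl : Real.log 2 ≠ 0 := (Real.log_pos one_lt_two).ne'
    by_cases hq : Q i = 0
    · simp [hq, h0 i hq]
    · rw [InformationTheory.klFun_apply, Real.logb]
      field_simp
      try ring
  have hs : ∑ i, Q i * InformationTheory.klFun (P i / Q i) ≤ 0 := by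
    simp only [key, Finset.sum_sub_distrib, Finset.sum_add_distrib, ← Finset.mul_sum, hP1, hQ1]
    nlinarith [Real.log_pos one_lt_two]
  have hn : ∀ i, 0 ≤ Q i * InformationTheory.klFun (P i / Q i) := fun i =>
    mul_nonneg (hQ i) (InformationTheory.klFun_nonneg (div_nonneg (hP i) (hQ i)))
  have hz := (Finset.sum_eq_zero_iff_of_nonneg fun i _ => hn i).1
    (le_antisymm hs (Finset.sum_nonneg fun i _ => hn i))
  funext i
  rcases mul_eq_zero.1 (hz i (Finset.mem_univ i)) with hq | hk
  · rw [hq, h0 i hq]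
  · rw [InformationTheory.klFun_eq_zero_iff (div_nonneg (hP i) (hQ i))] at hk
    by_cases hq : Q i = 0
    · rw [hq, div_zero] at hk
      exact absurd hk zero_ne_one
    · exact (div_eq_one_iff_eq hq).1 hk

/-- Mutual information is the divergence of the joint law from the product of its marginals;
absolute continuity holds since each marginal dominates the joint law. -/
lemma jointBit_eq_mul_of_mutualInfo_le [Fintype β] (hμ : ∀ ω, 0 ≤ μ ω) (h1 : ∑ ω, μ ω = 1)
    (A : Ω → ZMod 2) (B : Ω → β) (h : mutualInfo μ A B ≤ 0) (b : ZMod 2) (z : β) :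
    jointBit μ A B b z = prob μ (fun ω => A ω = b) * prob μ (fun ω => B ω = z) := by
  have hone : ∑ z, ∑ b, jointBit μ A B b z = 1 := by
    have := sum_mul_comp μ A B fun _ _ => 1
    simp only [mul_one] at this
    rw [← this, h1]
  have hA : ∀ b, prob μ (fun ω => A ω = b) = ∑ z, jointBit μ A B b z := by
    intro b
    simp only [jointBit, prob_eq_sum_ite]
    rw [Finset.sum_comm]
    refine Finset.sum_congr rfl fun ω _ => ?_
    by_cases hb : A ω = b <;> simp [hb]
  have hB : ∀ z, prob μ (fun ω => B ω = z) = ∑ b, jointBit μ A B b z := fun z => by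
    rw [prob_eq_jointBit_add μ A, sum_zmod_two]
  have hPQ := eq_of_sum_mul_logb_le (P := fun i : β × ZMod 2 => jointBit μ A B i.2 i.1)
    (Q := fun i => prob μ (fun ω => A ω = i.2) * prob μ (fun ω => B ω = i.1))
    (fun i => prob_nonneg hμ _) (fun i => mul_nonneg (prob_nonneg hμ _) (prob_nonneg hμ _))
    (by rw [Fintype.sum_prod_type, hone])
    (by
      simp only [Fintype.sum_prod_type]
      rw [Finset.sum_comm, ← Finset.sum_mul_sum]
      simp only [hA, hB]
      rw [hone, Finset.sum_comm, hone, one_mul])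
    (fun i hi => ?_) ?_
  · exact congrFun hPQ (z, b)
  · have hle : ∀ E : Ω → Prop, (∀ ω, A ω = i.2 ∧ B ω = i.1 → E ω) → prob μ E = 0 →
        jointBit μ A B i.2 i.1 = 0 := by
      intro E hE h0
      refine le_antisymm ?_ (prob_nonneg hμ _)
      rw [← h0]
      rw [jointBit, prob_eq_sum_ite, prob_eq_sum_ite]
      refine Finset.sum_le_sum fun ω _ => ?_
      by_cases hω : A ω = i.2 ∧ B ω = i.1
      · rw [if_pos hω, if_pos (hE ω hω)]
      · rw [if_neg hω]
        split_ifs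
        exacts [hμ ω, le_rfl]
    rcases mul_eq_zero.1 hi with h0 | h0
    · exact hle _ (fun ω h => h.1) h0
    · exact hle _ (fun ω h => h.2) h0
  · rw [Fintype.sum_prod_type]
    refine le_trans (le_of_eq ?_) h
    rw [mutualInfo]
    exact (sum_mul_comp μ A B fun b z => Real.logb 2 (prob μ (fun ω => A ω = b ∧ B ω = z) /
      (prob μ (fun ω => A ω = b) * prob μ (fun ω => B ω = z)))).symm

end MutualInfo

namespace AuxLaw

variable {S X Y T : Type*} [Fintype S] [Fintype X] [Fintype Y] [Fintype T] (L : AuxLaw S X Y T)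

lemma sum_joint : ∑ a, L.joint a = 1 := by
  have h := L.lawUS_isBitLaw.sum_eq_one
  have h2 := sum_mul_comp L.joint (fun a => a.2.1) (fun a => a.1) fun _ _ => 1
  simp only [mul_one] at h2
  rw [h2, ← h]
  exact Finset.sum_congr rfl fun s _ => sum_zmod_two _

lemma condEntropy_const : condEntropy L.joint (fun a => a.2.1) (fun _ => ()) = lawEntropy L.lawU := by
  rw [condEntropy_eq_bitSum L.joint_nonneg, bitSum, lawEntropy]
  refine Finset.sum_congr rfl fun o _ => ?_
  have e : ∀ b, jointBit L.joint (fun a => a.2.1) (fun _ => ()) b o = L.lawU b o := fun b =>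
    prob_congr fun a => by simp
  rw [e, e]

lemma infoUS_eq : L.infoUS = lawEntropy L.lawU - lawEntropy L.lawUS := by
  rw [infoUS, mutualInfo_eq_sub L.joint_nonneg L.sum_joint, condEntropy_const,
    condEntropy_eq_bitSum L.joint_nonneg (fun a => a.2.1) fun a => a.1]
  rfl

lemma infoUY_eq : L.infoUY = lawEntropy L.lawU - lawEntropy L.lawUY := by
  rw [infoUY, mutualInfo_eq_sub L.joint_nonneg L.sum_joint, condEntropy_const,
    condEntropy_eq_bitSum L.joint_nonneg (fun a => a.2.1) fun a => a.2.2.2.1]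
  rfl

lemma lawUS_eq_mul (h : L.infoUS ≤ 0) (b : ZMod 2) (s : S) :
    L.lawUS b s = L.lawU b () * L.PS s := by
  have h1 := jointBit_eq_mul_of_mutualInfo_le L.joint_nonneg L.sum_joint (fun a => a.2.1)
    (fun a => a.1) h b s
  have h2 : prob L.joint (fun a => a.1 = s) = L.PS s := by
    rw [prob_eq_jointBit_add L.joint (fun a => a.2.1), ← L.obsLaw_lawUS]
    rfl
  rw [h2] at h1
  exact h1

/-- Under independence the probability of s is a common factor of numerator and denominator, and
cancels when positive. -/
lemma condBit_eq_of_indep (h : L.infoUS ≤ 0) {m : ℕ} (j : Fin (2 ^ m)) (b : ZMod 2) (v : Word m)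
    {s : Fin (2 ^ m) → S} (hs : ∏ i, L.PS (s i) ≠ 0) :
    condBit L.lawU m j b v (fun _ => ()) = condBit L.lawUS m j b v s := by
  rw [condBit_eq, condBit_eq]
  simp only [bitLaw_indep (L.lawUS_eq_mul h)]
  rw [← mul_add, mul_div_mul_left _ _ hs]
  simp only [mul_eq_zero, hs, false_or]

lemma veryHigh_lawUS_subset (β : ℝ) (m : ℕ) : veryHigh L.lawUS β m ⊆ veryHigh L.lawU β m := by
  intro j hj
  simp only [veryHigh, Finset.mem_filter, Finset.mem_univ, true_and] at hj ⊢
  exact hj.trans_le (L.lawUS_isBitLaw.bitEntropy_le_forget (fun b => L.lawU_eq b ()) j)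

lemma high_lawUY_subset (β : ℝ) (m : ℕ) : high L.lawUY β m ⊆ high L.lawU β m := by
  intro j hj
  simp only [high, Finset.mem_filter, Finset.mem_univ, true_and] at hj ⊢
  exact hj.trans_le (L.lawUY_isBitLaw.bitEntropy_le_forget (fun b => (L.sum_lawUY b).symm) j)

/-- When U and S are independent, 𝒱_{V|S} is the very high set of V alone, so A₃ consists of
positions at which V itself is not polarized. -/
lemma card_A3_le_of_indep (h : L.infoUS ≤ 0) (m : ℕ) :
    ((L.A3 (1 / 100) m).card : ℝ) ≤ polarGap m * 2 ^ m := by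
  have hv : veryHigh L.lawUS (1 / 100) m = veryHigh L.lawU (1 / 100) m := by
    refine Finset.filter_congr fun j _ => ?_
    rw [bitEntropy_indep L.lawUS_isBitLaw L.lawU_isBitLaw L.PS_mem.2 (L.lawUS_eq_mul h)]
  have h1 : (L.A3 (1 / 100) m).card ≤
      (high L.lawU (1 / 100) m \ veryHigh L.lawU (1 / 100) m).card := by
    rw [A3, hv]
    exact Finset.card_le_card (Finset.sdiff_subset_sdiff (L.high_lawUY_subset _ m) le_rfl)
  have h2 := L.lawU_isBitLaw.card_high_sdiff_veryHigh_le (m := m)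
  have h3 : ((L.A3 (1 / 100) m).card : ℝ) ≤
      ((high L.lawU (1 / 100) m \ veryHigh L.lawU (1 / 100) m).card : ℝ) := by exact_mod_cast h1
  have h4 := threshold_pos (1 / 100) m
  rw [polarGap, add_mul]
  have h5 : 0 < threshold (1 / 100) m * 2 ^ m := by positivity
  linarith

/-- The comparison of the number of bits that need to be relayed with the room available. -/
lemma card_A3_le (m : ℕ) : ((L.A3 (1 / 100) m).card : ℝ) ≤
    (L.A2 (1 / 100) m).card + (L.infoUS - L.infoUY + 2 * polarGap m) * 2 ^ m := by
  -- A₁ belongs to both sets, hence |A₃| − |A₂| = |ℋ_{V|Y}| − |𝒱_{V|S}|, about n(H(U|Y) − H(U|S)).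
  have h1 : (L.A1 (1 / 100) m).card + (L.A2 (1 / 100) m).card =
      (veryHigh L.lawUS (1 / 100) m).card := Finset.card_inter_add_card_sdiff _ _
  have h2 : (L.A1 (1 / 100) m).card + (L.A3 (1 / 100) m).card =
      (high L.lawUY (1 / 100) m).card := by
    rw [A1, A3, Finset.inter_comm]
    exact Finset.card_inter_add_card_sdiff _ _
  have h3 := L.lawUY_isBitLaw.card_high_le (m := m)
  have h4 := L.lawUS_isBitLaw.le_card_veryHigh (m := m)
  have h1' : ((L.A1 (1 / 100) m).card : ℝ) + (L.A2 (1 / 100) m).card =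
      (veryHigh L.lawUS (1 / 100) m).card := by exact_mod_cast h1
  have h2' : ((L.A1 (1 / 100) m).card : ℝ) + (L.A3 (1 / 100) m).card =
      (high L.lawUY (1 / 100) m).card := by exact_mod_cast h2
  rw [infoUS_eq, infoUY_eq]
  linarith

/-- 𝒱_V has about nH(U) elements and ℋ_{V|Y} about nH(U|Y). -/
lemma le_card_slots (m : ℕ) : (L.infoUY - 2 * polarGap m) * 2 ^ m ≤
    ((veryHigh L.lawU (1 / 100) m \ high L.lawUY (1 / 100) m).card : ℝ) := by
  have h1 := Finset.le_card_sdiff (high L.lawUY (1 / 100) m) (veryHigh L.lawU (1 / 100) m)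
  have h2 : ((veryHigh L.lawU (1 / 100) m).card : ℝ) ≤
      (veryHigh L.lawU (1 / 100) m \ high L.lawUY (1 / 100) m).card +
      (high L.lawUY (1 / 100) m).card := by
    exact_mod_cast Nat.sub_le_iff_le_add.1 h1
  have h3 := L.lawUY_isBitLaw.card_high_le (m := m)
  have h4 := L.lawU_isBitLaw.le_card_veryHigh (m := m)
  rw [infoUY_eq]
  linarith

/-- Relayed bits that fit into A₂ thus also fit into an extra block of the same length. -/
lemma card_A2_le_slots (β : ℝ) (m : ℕ) :
    (L.A2 β m).card ≤ (veryHigh L.lawU β m \ high L.lawUY β m).card :=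
  Finset.card_le_card (Finset.sdiff_subset_sdiff (L.veryHigh_lawUS_subset β m) le_rfl)

end AuxLaw

end PolarCoord

namespace PolarCoord
open scoped Classical BigOperators

/-! ### Instances of the scheme -/

namespace AuxLaw

variable {S X Y T : Type*} [Fintype S] [Fintype X] [Fintype Y] [Fintype T] (L : AuxLaw S X Y T)

lemma nonempty_of_mem_stdSimplex {A : Type*} [Fintype A] {p : A → ℝ} (h : p ∈ stdSimplex ℝ A) :
    Nonempty A := by
  by_contra hA
  rw [not_nonempty_iff] at hA
  have := h.2
  simp at this

/-- The channel from `U` to `Y` is the composition of a channel from `U` to `X` with `W`. -/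
lemma exists_input_law : ∃ QX : ZMod 2 → X → ℝ, (∀ u, QX u ∈ stdSimplex ℝ X) ∧
    ∀ u y, L.lawU u () * ∑ x, QX u x * L.W x y = L.lawUY u y := by
  obtain ⟨s₀⟩ := nonempty_of_mem_stdSimplex L.PS_mem
  have hnn : ∀ u s x, 0 ≤ L.lawUS u s * L.PX u s x := fun u s x =>
    mul_nonneg (L.lawUS_isBitLaw.nonneg u s) ((L.PX_mem u s).1 x)
  have hU : ∀ u, 0 ≤ L.lawU u () := fun u => L.lawU_isBitLaw.nonneg u ()
  have hY : ∀ u y, L.lawUY u y = ∑ x, (∑ s, L.lawUS u s * L.PX u s x) * L.W x y := by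
    intro u y
    rw [lawUY_eq, Finset.sum_comm]
    simp only [Finset.sum_mul]
  -- The witness is P_{X|U}; for a value u of probability zero any law serves.
  refine ⟨fun u x => if L.lawU u () = 0 then L.PX u s₀ x else
    (∑ s, L.lawUS u s * L.PX u s x) / L.lawU u (), fun u => ?_, fun u y => ?_⟩
  · by_cases h : L.lawU u () = 0
    · simpa only [h, if_true] using L.PX_mem u s₀
    · simp only [h, if_false]
      refine ⟨fun x => div_nonneg (Finset.sum_nonneg fun s _ => hnn u s x) (hU u), ?_⟩
      rw [← Finset.sum_div, Finset.sum_comm]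
      simp only [← Finset.mul_sum, (L.PX_mem u _).2, mul_one]
      rw [← lawU_eq, div_self h]
  · by_cases h : L.lawU u () = 0
    · rw [h, zero_mul]
      have := L.sum_lawUY u
      rw [h, Finset.sum_eq_zero_iff_of_nonneg fun y _ => L.lawUY_isBitLaw.nonneg u y] at this
      exact (this y (Finset.mem_univ y)).symm
    · simp only [h, if_false]
      rw [hY, Finset.mul_sum]
      refine Finset.sum_congr rfl fun x _ => ?_
      field_simp

end AuxLaw

lemma exists_injOn_of_card_le {A B : Type*} [Nonempty B] {s : Finset A} {t : Finset B}
    (h : s.card ≤ t.card) : ∃ f : A → B, (∀ a ∈ s, f a ∈ t) ∧ Set.InjOn f s := by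
  obtain ⟨f, h1, h2⟩ := (Finset.finite_toSet s).exists_injOn_of_encard_le
    (t := (t : Set B)) (by simpa [Set.encard_coe_eq_coe_finsetCard] using h)
  exact ⟨f, fun a ha => h1 ha, h2⟩

section Choices

variable {S X Y T : Type*} [Fintype S] [Fintype X] [Fintype Y] [Fintype T] (L : AuxLaw S X Y T)
  {β : ℝ} {m : ℕ}

/-- A split of `A₃` with enough room for the relayed bits gives an instance of the scheme. -/
lemma exists_choice {p : ℕ} (mx b : ℕ) (hp : 0 < p) {R E D : Finset (Fin (2 ^ m))}
    (cover : R ∪ E ∪ D = L.A3 β m) (hRE : Disjoint R E) (hRD : Disjoint R D) (hED : Disjoint E D)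
    (hR : R.card ≤ (L.A2 β m).card)
    (hE : p * (p + 1) * E.card + R.card ≤
      (veryHigh L.lawU β mx \ high L.lawUY β mx).card) :
    ∃ κ : Choice L β m, κ.mx = mx ∧ κ.b = b ∧ κ.R = R ∧ κ.E = E ∧ κ.D = D ∧
      Nonempty (κ.Scheduled p) := by
  obtain ⟨QX, hQX, hQXY⟩ := L.exists_input_law
  obtain ⟨s₀⟩ := AuxLaw.nonempty_of_mem_stdSimplex L.PS_mem
  obtain ⟨x₀⟩ := AuxLaw.nonempty_of_mem_stdSimplex (L.PX_mem 0 s₀)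
  obtain ⟨y₀⟩ := AuxLaw.nonempty_of_mem_stdSimplex (L.W_mem x₀)
  obtain ⟨t₀⟩ := AuxLaw.nonempty_of_mem_stdSimplex (L.PT_mem 0 y₀)
  obtain ⟨τ, hτ, hτi⟩ := exists_injOn_of_card_le hR
  let M : Finset (Fin (p * (p + 1)) × Fin (2 ^ m)) :=
    Finset.univ.filter fun q => q.2 ∈ E ∨ (q.1.val + 1 = p * (p + 1) ∧ q.2 ∈ R)
  have hk : 0 < p * (p + 1) := by positivity
  have hM : M.card ≤ (veryHigh L.lawU β mx \ high L.lawUY β mx).card := by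
    refine le_trans ?_ hE
    -- E is sent for each of the p(p + 1) blocks, R for the last one only.
    have hsub : M ⊆ (Finset.univ ×ˢ E) ∪
        ({⟨p * (p + 1) - 1, Nat.sub_lt hk one_pos⟩} ×ˢ R) := by
      rintro ⟨i, j⟩ hq
      rcases (Finset.mem_filter.1 hq).2 with h | ⟨h1, h2⟩
      · exact Finset.mem_union_left _ (Finset.mem_product.2 ⟨Finset.mem_univ _, h⟩)
      · refine Finset.mem_union_right _ (Finset.mem_product.2 ⟨Finset.mem_singleton.2 ?_, h2⟩)
        exact Fin.ext (by simp only at h1 ⊢; omega)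
    refine (Finset.card_le_card hsub).trans ((Finset.card_union_le _ _).trans ?_)
    rw [Finset.card_product, Finset.card_product, Finset.card_univ, Fintype.card_fin,
      Finset.card_singleton, one_mul]
  obtain ⟨place, hpl, hpli⟩ := exists_injOn_of_card_le hM
  -- One key word of block length for each of the 2p scheduled keys, and one for the extra block.
  let A := ((Fin p ⊕ Fin p) × Fin (2 ^ m)) ⊕ Fin (2 ^ mx)
  let e : A ≃ Fin (Fintype.card A) := Fintype.equivFin A
  let κ : Choice L β m :=
    { k := p * (p + 1)
      k_pos := hk
      mx := mx
      q := Fintype.card A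
      b := b
      R := R
      E := E
      D := D
      cover := cover
      disjoint_RE := hRE
      disjoint_RD := hRD
      disjoint_ED := hED
      τ := τ
      τ_maps := hτ
      τ_inj := hτi
      padR := fun i j => e (.inl (keySchedule p hp i, j))
      padX := fun q => e (.inr (place q))
      -- With P_U and P_{X|U}, input and output of the extra channel code have the law `lawUY` of
      -- the chained blocks.
      QB := fun u => L.lawU u ()
      QB_mem := ⟨fun u => L.lawU_isBitLaw.nonneg u (), by
        rw [sum_zmod_two, ← L.lawU_isBitLaw.sum_eq_one, Fintype.sum_unique]⟩
      QX := QX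
      QX_mem := hQX
      place := place
      place_maps := fun i j h => by
        simp only [hQXY]
        exact hpl (i, j) (Finset.mem_filter.2 ⟨Finset.mem_univ _, h⟩)
      place_inj := by
        convert hpli using 1
        ext q
        simp [M]
      idle := t₀ }
  exact ⟨κ, rfl, rfl, rfl, rfl, rfl, ⟨hp, rfl, e, fun _ _ => rfl, fun _ => rfl⟩⟩

variable {L}

/-- The p(p + 1) blocks share 2p key words, and C₁ and the seeds for D are counted once. -/
lemma Choice.commonRate_le {κ : Choice L β m} {p : ℕ} (σ : κ.Scheduled p) :
    κ.commonRate ≤ (2 ^ m * (1 + 2 * p + κ.b) + 2 ^ κ.mx * (2 + κ.b)) / (p * (p + 1) * 2 ^ m) := by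
  have hq : κ.q = 2 * p * 2 ^ m + 2 ^ κ.mx := by
    have := Fintype.card_congr σ.keys
    simp only [Fintype.card_sum, Fintype.card_prod, Fintype.card_fin] at this
    rw [← this]
    ring
  have hcard : (Fintype.card κ.Common : ℝ) = 2 ^ ((L.A1 β m).card + (κ.q + (κ.b * κ.D.card +
      (κ.frozen.card + κ.b * κ.drawn.card)))) := by
    simp only [Choice.Common, Fintype.card_prod, Fintype.card_fun, Fintype.card_coe, ZMod.card,
      Fintype.card_fin, pow_add, pow_mul]
    push_cast
    ring
  have huse : (Fintype.card κ.Use : ℝ) = p * (p + 1) * 2 ^ m + 2 ^ κ.mx := by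
    simp only [Choice.Use, Fintype.card_sum, Fintype.card_prod, Fintype.card_fin, σ.k_eq]
    push_cast
    ring
  have hle : ∀ {l : ℕ} (A : Finset (Fin (2 ^ l))), (A.card : ℝ) ≤ 2 ^ l := fun A => by
    have := A.card_le_univ
    rw [Fintype.card_fin] at this
    exact_mod_cast this
  have hp : (0 : ℝ) < p := by exact_mod_cast σ.pos
  rw [Choice.commonRate, hcard, huse, Real.logb_pow, Real.logb_self_eq_one one_lt_two, mul_one, hq]
  push_cast
  have h1 := hle (L.A1 β m)
  have h2 := mul_le_mul_of_nonneg_left (hle κ.D) (Nat.cast_nonneg (α := ℝ) κ.b)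
  have h3 := hle κ.frozen
  have h4 := mul_le_mul_of_nonneg_left (hle κ.drawn) (Nat.cast_nonneg (α := ℝ) κ.b)
  refine div_le_div₀ (by positivity) (by linarith) (by positivity) ?_
  have : (0 : ℝ) < 2 ^ κ.mx := by positivity
  linarith

lemma Choice.commonRate_nonneg (κ : Choice L β m) : 0 ≤ κ.commonRate :=
  div_nonneg (Real.logb_nonneg one_lt_two (by exact_mod_cast Fintype.card_pos)) (Nat.cast_nonneg _)

end Choices

end PolarCoord

namespace PolarCoord
open scoped Classical BigOperators
open Filter Topology

/-! ### Asymptotics -/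

/-- In x = 2^(m/100) the expression is x^300 exp(−x log 2 / 2). -/
lemma tendsto_pow_mul_sqrt_threshold :
    Tendsto (fun m : ℕ => (8 : ℝ) ^ m * √(threshold (1 / 100) m)) atTop (𝓝 0) := by
  have hx : Tendsto (fun m : ℕ => (2 : ℝ) ^ ((m : ℝ) / 100)) atTop atTop :=
    (tendsto_rpow_atTop_of_base_gt_one 2 one_lt_two).comp
      (tendsto_natCast_atTop_atTop.atTop_div_const (by norm_num))
  have h := (tendsto_rpow_mul_exp_neg_mul_atTop_nhds_zero 300 (Real.log 2 / 2)
    (half_pos (Real.log_pos one_lt_two))).comp hx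
  refine h.congr fun m => ?_
  simp only [Function.comp_apply]
  congr 1
  · rw [← Real.rpow_mul two_pos.le, show (8 : ℝ) = 2 ^ 3 by norm_num, ← pow_mul,
      ← Real.rpow_natCast]
    congr 1
    push_cast
    ring
  · rw [threshold_eq, Real.sqrt_eq_rpow, ← Real.rpow_mul two_pos.le,
      Real.rpow_def_of_pos two_pos (-(2 : ℝ) ^ ((m : ℝ) / 100) * (1 / 2))]
    congr 1
    ring

lemma sqrt_threshold_le_one (m : ℕ) : √(threshold (1 / 100) m) ≤ 1 := by
  refine Real.sqrt_le_iff.2 ⟨zero_le_one, ?_⟩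
  exact (threshold_le_half (by norm_num) m).trans (by norm_num)

lemma threshold_le_sqrt (m : ℕ) : threshold (1 / 100) m ≤ √(threshold (1 / 100) m) := by
  have h := Real.mul_self_sqrt (threshold_pos (1 / 100) m).le
  have h0 := Real.sqrt_nonneg (threshold (1 / 100) m)
  have h1 := sqrt_threshold_le_one m
  nlinarith

lemma blocks_le (m : ℕ) : ((m : ℝ) + 1) * (m + 1 + 1) ≤ 2 * 4 ^ m := by
  have h : (m : ℝ) + 1 ≤ 2 ^ m := by exact_mod_cast (Nat.lt_two_pow_self : m < 2 ^ m)
  have h1 : (1 : ℝ) ≤ 2 ^ m := one_le_pow₀ one_le_two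
  have h4 : (4 : ℝ) ^ m = 2 ^ m * 2 ^ m := by
    rw [← mul_pow]
    norm_num
  have h0 : (0 : ℝ) ≤ m := Nat.cast_nonneg m
  rw [h4]
  nlinarith

lemma polarGap_pos (m : ℕ) : 0 < polarGap m := add_pos (by positivity) (threshold_pos _ m)

/-- The sets E of all k blocks must fit into one extra block, so the unpolarized fraction has to
vanish faster than 1/k. -/
lemma tendsto_blocks_mul_polarGap :
    Tendsto (fun m : ℕ => ((m : ℝ) + 1) * (m + 1 + 1) * polarGap m) atTop (𝓝 0) := by
  have h1 : Tendsto (fun m : ℕ => (((m / 20 + 1 : ℕ) : ℝ) ^ 2 * (93 / 100) ^ (m / 20 + 1)))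
      atTop (𝓝 0) :=
    (tendsto_pow_const_mul_const_pow_of_lt_one 2 (by norm_num : (0 : ℝ) ≤ 93 / 100)
      (by norm_num)).comp ((tendsto_add_atTop_nat 1).comp (Nat.tendsto_div_const_atTop (by norm_num)))
  have h := (h1.const_mul (6 * 441 * (100 / 93))).add (tendsto_pow_mul_sqrt_threshold.const_mul 2)
  rw [mul_zero, mul_zero, add_zero] at h
  refine squeeze_zero (fun m => mul_nonneg (by positivity) (polarGap_pos m).le) (fun m => ?_) h
  have h2 : (m : ℝ) + 1 + 1 ≤ 21 * (m / 20 + 1 : ℕ) := by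
    have : m + 1 + 1 ≤ 21 * (m / 20 + 1) := by omega
    exact_mod_cast this
  have h3 := blocks_le m
  have h4 : (4 : ℝ) ^ m ≤ 8 ^ m := pow_le_pow_left₀ (by norm_num) (by norm_num) m
  have h5 : ((m : ℝ) + 1) * (m + 1 + 1) ≤ 441 * ((m / 20 + 1 : ℕ) : ℝ) ^ 2 := by
    have h0 : (0 : ℝ) ≤ m := Nat.cast_nonneg m
    nlinarith
  rw [polarGap, mul_add]
  refine add_le_add ?_ ?_
  · rw [pow_succ (93 / 100 : ℝ)]
    calc _ ≤ 441 * ((m / 20 + 1 : ℕ) : ℝ) ^ 2 * (6 * (93 / 100 : ℝ) ^ (m / 20)) := by gcongr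
      _ = _ := by ring
  · calc _ ≤ 2 * 4 ^ m * √(threshold (1 / 100) m) :=
          mul_le_mul h3 (threshold_le_sqrt m) (threshold_pos _ m).le (by positivity)
      _ ≤ 2 * (8 ^ m * √(threshold (1 / 100) m)) := by
          rw [mul_assoc]
          gcongr

lemma tendsto_polarGap : Tendsto polarGap atTop (𝓝 0) := by
  refine squeeze_zero (fun m => (polarGap_pos m).le) (fun m => ?_) tendsto_blocks_mul_polarGap
  have h0 : (0 : ℝ) ≤ m := Nat.cast_nonneg m
  have h1 : (1 : ℝ) ≤ ((m : ℝ) + 1) * (m + 1 + 1) := by nlinarith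
  exact le_mul_of_one_le_left (polarGap_pos m).le h1

/-! ### The split of A₃ in the different regimes of I(U;S) and I(U;Y) -/

section Schemes

variable {S X Y T : Type*} [Fintype S] [Fintype X] [Fintype Y] [Fintype T]

/-- The seeds for `D` generate the bits with the right law, whatever the source. -/
def Choice.DrawsCorrectly {L : AuxLaw S X Y T} {β : ℝ} {m : ℕ} (κ : Choice L β m) : Prop :=
  ∀ j ∈ κ.D, ∀ b v s, ∏ i, L.PS (s i) ≠ 0 →
    condBit L.lawU m j b v (fun _ => ()) = condBit L.lawUS m j b v s

variable (L : AuxLaw S X Y T)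

/-- The finitely many remaining m receive the instance with D = A₃ and R = E = ∅, which always
exists and of which Q is not required. -/
lemma exists_choice_seq_of_eventually {C : ℕ} {Q : ∀ m, Choice L (1 / 100) m → Prop}
    (h : ∀ᶠ m in atTop, ∃ κ : Choice L (1 / 100) m, κ.mx = m + C ∧ κ.b = 4 * m ∧
      Nonempty (κ.Scheduled (m + 1)) ∧ Q m κ) :
    ∃ κ : ∀ m, Choice L (1 / 100) m, (∀ m, (κ m).mx = m + C ∧ (κ m).b = 4 * m ∧
      Nonempty ((κ m).Scheduled (m + 1))) ∧ ∀ᶠ m in atTop, Q m (κ m) := by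
  have key : ∀ m, ∃ κ : Choice L (1 / 100) m, (κ.mx = m + C ∧ κ.b = 4 * m ∧
      Nonempty (κ.Scheduled (m + 1))) ∧ ((∃ κ : Choice L (1 / 100) m, κ.mx = m + C ∧
      κ.b = 4 * m ∧ Nonempty (κ.Scheduled (m + 1)) ∧ Q m κ) → Q m κ) := by
    intro m
    by_cases hm : ∃ κ : Choice L (1 / 100) m, κ.mx = m + C ∧ κ.b = 4 * m ∧
      Nonempty (κ.Scheduled (m + 1)) ∧ Q m κ
    · obtain ⟨κ, h1, h2, h3, h4⟩ := hm
      exact ⟨κ, ⟨h1, h2, h3⟩, fun _ => h4⟩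
    · obtain ⟨κ, h1, h2, -, -, -, h3⟩ := exists_choice L (β := 1 / 100) (m := m) (p := m + 1) (m + C) (4 * m)
        (Nat.succ_pos m) (R := ∅) (E := ∅) (D := L.A3 (1 / 100) m)
        (by rw [Finset.empty_union, Finset.empty_union]) (by simp) (by simp)
        (by simp) (by simp) (by simp)
      exact ⟨κ, ⟨h1, h2, h3⟩, fun h => absurd h hm⟩
  choose κ h1 h2 using key
  exact ⟨κ, h1, h.mono fun m hm => h2 m hm⟩

/-- If I(U;S) < I(U;Y), A₃ eventually fits into A₂ and is relayed entirely. If both informations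
vanish, A₃ is a negligible set of bits independent of the source, which both nodes can draw. If they
are equal and positive, the small part of A₃ that does not fit is sent in an extra block of length
2^C n. -/
lemma exists_choice_seq (hI : L.infoUS ≤ L.infoUY) :
    ∃ (C : ℕ) (κ : ∀ m, Choice L (1 / 100) m),
      (∀ m, (κ m).mx = m + C ∧ (κ m).b = 4 * m ∧ Nonempty ((κ m).Scheduled (m + 1))) ∧
      ∀ᶠ m in atTop, (κ m).DrawsCorrectly ∧
        ((((κ m).E ∪ (κ m).D).card : ℝ) ≤ 2 * polarGap m * 2 ^ m) ∧
        (L.infoUS < L.infoUY → (κ m).E = ∅ ∧ (κ m).D = ∅ ∧ (κ m).mx = m) := by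
  have hgap : ∀ ε : ℝ, 0 < ε → ∀ᶠ m in atTop, polarGap m < ε := fun ε hε =>
    tendsto_polarGap.eventually_lt_const hε
  rcases hI.lt_or_eq with hlt | heq
  · refine ⟨0, exists_choice_seq_of_eventually L (Q := fun m κ => κ.DrawsCorrectly ∧
      (((κ.E ∪ κ.D).card : ℝ) ≤ 2 * polarGap m * 2 ^ m) ∧
      (L.infoUS < L.infoUY → κ.E = ∅ ∧ κ.D = ∅ ∧ κ.mx = m)) ?_⟩
    filter_upwards [hgap ((L.infoUY - L.infoUS) / 2) (by linarith)] with m hm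
    have hcard : (L.A3 (1 / 100) m).card ≤ (L.A2 (1 / 100) m).card := by
      have h := L.card_A3_le m
      have h2 : (L.infoUS - L.infoUY + 2 * polarGap m) * 2 ^ m ≤ 0 :=
        mul_nonpos_of_nonpos_of_nonneg (by linarith) (by positivity)
      exact_mod_cast h.trans (by linarith : _ ≤ ((L.A2 (1 / 100) m).card : ℝ))
    obtain ⟨κ, h1, h2, h3, h4, h5, h6⟩ := exists_choice L (β := 1 / 100) (m := m) (p := m + 1) m (4 * m)
      (Nat.succ_pos m) (R := L.A3 (1 / 100) m) (E := ∅) (D := ∅)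
      (by rw [Finset.union_empty, Finset.union_empty]) (by simp) (by simp) (by simp) hcard (by
        rw [Finset.card_empty, mul_zero, zero_add]
        exact hcard.trans (L.card_A2_le_slots _ m))
    refine ⟨κ, h1, h2, h6, fun j hj => ?_, ?_, fun _ => ⟨h4, h5, h1⟩⟩
    · rw [h5] at hj
      exact absurd hj (Finset.notMem_empty j)
    · rw [h4, h5, Finset.union_empty, Finset.card_empty, Nat.cast_zero]
      have := polarGap_pos m
      positivity
  -- Here I(U;Y) ≤ 0 as well: the extra code need not have room for any message, so nothing is left
  -- to send.
  by_cases hpos : L.infoUS ≤ 0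
  · refine ⟨0, exists_choice_seq_of_eventually L (Q := fun m κ => κ.DrawsCorrectly ∧
      (((κ.E ∪ κ.D).card : ℝ) ≤ 2 * polarGap m * 2 ^ m) ∧
      (L.infoUS < L.infoUY → κ.E = ∅ ∧ κ.D = ∅ ∧ κ.mx = m)) (Eventually.of_forall fun m => ?_)⟩
    obtain ⟨κ, h1, h2, h3, h4, h5, h6⟩ := exists_choice L (β := 1 / 100) (m := m) (p := m + 1) m (4 * m)
      (Nat.succ_pos m) (R := ∅) (E := ∅) (D := L.A3 (1 / 100) m)
        (by rw [Finset.empty_union, Finset.empty_union]) (by simp) (by simp)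
      (by simp) (by simp) (by simp)
    refine ⟨κ, h1, h2, h6, fun j _ b v s hs => L.condBit_eq_of_indep hpos j b v hs, ?_,
      fun h => absurd heq h.ne⟩
    rw [h4, h5, Finset.empty_union]
    have := polarGap_pos m
    have h7 := L.card_A3_le_of_indep hpos m
    have : 0 < polarGap m * 2 ^ m := by positivity
    linarith
  · have hI0 : 0 < L.infoUY := by linarith
    -- Room for 2n bits is needed, n for R and n for the sets E of all blocks; eventually more than
    -- 2^C n I(U;Y)/2 is available.
    obtain ⟨C, hC⟩ := pow_unbounded_of_one_lt (4 / L.infoUY) (one_lt_two (α := ℝ))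
    refine ⟨C, exists_choice_seq_of_eventually L (Q := fun m κ => κ.DrawsCorrectly ∧
      (((κ.E ∪ κ.D).card : ℝ) ≤ 2 * polarGap m * 2 ^ m) ∧
      (L.infoUS < L.infoUY → κ.E = ∅ ∧ κ.D = ∅ ∧ κ.mx = m)) ?_⟩
    filter_upwards [(tendsto_add_atTop_nat C).eventually (hgap (L.infoUY / 4) (by linarith)),
      tendsto_blocks_mul_polarGap.eventually_lt_const (by norm_num : (0 : ℝ) < 1 / 2)] with m hm hk
    -- As much of A₃ is relayed as A₂ can hold; `card_A3_le` bounds the rest.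
    obtain ⟨R, hRA, hRc⟩ := Finset.exists_subset_card_eq
      (min_le_right (L.A2 (1 / 100) m).card (L.A3 (1 / 100) m).card)
    have hEc : (((L.A3 (1 / 100) m) \ R).card : ℝ) ≤ 2 * polarGap m * 2 ^ m := by
      have hg : 0 < 2 * polarGap m * 2 ^ m := by
        have := polarGap_pos m
        positivity
      have h := L.card_A3_le m
      rw [heq, sub_self, zero_add] at h
      rw [Finset.card_sdiff_of_subset hRA, Nat.cast_sub (Finset.card_le_card hRA), hRc, Nat.cast_min]
      rcases min_cases ((L.A2 (1 / 100) m).card : ℝ) (L.A3 (1 / 100) m).card with h2 | h2 <;>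
        rw [h2.1] <;> linarith
    have hslots : (m + 1) * (m + 1 + 1) * (L.A3 (1 / 100) m \ R).card + R.card ≤
        (veryHigh L.lawU (1 / 100) (m + C) \ high L.lawUY (1 / 100) (m + C)).card := by
      have h1 := L.le_card_slots (m + C)
      have h2 : (R.card : ℝ) ≤ 2 ^ m := by
        have := R.card_le_univ
        rw [Fintype.card_fin] at this
        exact_mod_cast this
      have h3 : ((m : ℝ) + 1) * (m + 1 + 1) * (L.A3 (1 / 100) m \ R).card ≤ 2 ^ m := by
        calc _ ≤ ((m : ℝ) + 1) * (m + 1 + 1) * (2 * polarGap m * 2 ^ m) := by gcongr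
          _ = (((m : ℝ) + 1) * (m + 1 + 1) * polarGap m) * (2 * 2 ^ m) := by ring
          _ ≤ 1 / 2 * (2 * 2 ^ m) := by gcongr
          _ = _ := by ring
      have h4 : (2 : ℝ) * 2 ^ m ≤ (L.infoUY - 2 * polarGap (m + C)) * 2 ^ (m + C) := by
        rw [div_lt_iff₀ hI0] at hC
        have h5 : (2 : ℝ) ≤ (L.infoUY - 2 * polarGap (m + C)) * 2 ^ C := by
          have : (0 : ℝ) < 2 ^ C := by positivity
          nlinarith
        calc (2 : ℝ) * 2 ^ m ≤ (L.infoUY - 2 * polarGap (m + C)) * 2 ^ C * 2 ^ m := by gcongr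
          _ = _ := by rw [pow_add]; ring
      have h6 : ((m : ℝ) + 1) * (m + 1 + 1) * (L.A3 (1 / 100) m \ R).card + R.card ≤
          ((veryHigh L.lawU (1 / 100) (m + C) \ high L.lawUY (1 / 100) (m + C)).card : ℝ) := by
        linarith
      exact_mod_cast h6
    obtain ⟨κ, h1, h2, h3, h4, h5, h6⟩ := exists_choice L (β := 1 / 100) (m := m) (p := m + 1) (m + C) (4 * m)
      (Nat.succ_pos m) (R := R) (E := L.A3 (1 / 100) m \ R) (D := ∅) (by
        rw [Finset.union_empty, Finset.union_sdiff_of_subset hRA]) Finset.disjoint_sdiff (by simp)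
      (by simp) (hRc ▸ min_le_left _ _) hslots
    refine ⟨κ, h1, h2, h6, fun j hj => ?_, ?_, fun h => absurd heq h.ne⟩
    · rw [h5] at hj
      exact absurd hj (Finset.notMem_empty j)
    · rw [h4, h5, Finset.union_empty]
      exact hEc

end Schemes

end PolarCoord

namespace PolarCoord
open scoped Classical BigOperators
open Filter Topology

/-! ### Limits of failure probability and common randomness, and derandomization -/

section Limits

variable {S X Y T : Type*} [Fintype S] [Fintype X] [Fintype Y] [Fintype T] {L : AuxLaw S X Y T}

/-- All parameters are inserted: k = (m+1)(m+2) ≤ 2 · 4^m, n' = 2^C n, and seeds of 4m bits, so that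
kn quantization errors amount to at most 2 · 8^m · 16^(-m). The last summand is due to the share of
the extra block in the channel uses. -/
lemma coordination_error_le (a C : ℕ) (m : ℕ) :
    a / √(2 ^ m : ℝ) +
      2 * (2 ^ m * (2 * √(threshold (1 / 100) m) + 2 * (1 / 2 ^ (4 * m)))) +
      2 * (((m + 1 : ℝ) * (m + 1 + 1)) * (2 ^ m * threshold (1 / 100) m +
          2 ^ m * (2 * √(threshold (1 / 100) m) + 2 * (1 / 2 ^ (4 * m)))) +
        (2 ^ (m + C) * threshold (1 / 100) (m + C) +
          2 ^ (m + C) * (2 * √(threshold (1 / 100) (m + C)) + 2 * (1 / 2 ^ (4 * m))))) +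
      2 * 2 ^ (m + C) / (((m + 1 : ℝ) * (m + 1 + 1)) * 2 ^ m) ≤
    a * √(1 / 2) ^ m + 16 * (8 ^ m * √(threshold (1 / 100) m)) +
      6 * (8 ^ (m + C) * √(threshold (1 / 100) (m + C))) + (12 + 4 * 2 ^ C) * (1 / 2) ^ m +
      2 * 2 ^ C * (1 / (m + 1)) := by
  have hm0 : (0 : ℝ) ≤ m := Nat.cast_nonneg m
  have ha : (a : ℝ) / √(2 ^ m : ℝ) = a * √(1 / 2) ^ m := by
    rw [Real.sqrt_div zero_le_one, Real.sqrt_one, one_div, inv_pow, ← div_eq_mul_inv,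
      Real.sqrt_eq_rpow, Real.sqrt_eq_rpow, ← Real.rpow_natCast, ← Real.rpow_natCast,
      ← Real.rpow_mul two_pos.le, ← Real.rpow_mul two_pos.le, mul_comm (m : ℝ)]
  have hlast : 2 * 2 ^ (m + C) / (((m + 1 : ℝ) * (m + 1 + 1)) * 2 ^ m) ≤
      2 * 2 ^ C * (1 / (m + 1)) := by
    rw [mul_one_div, pow_add, div_le_div_iff₀ (by positivity) (by positivity)]
    have h1 : (m + 1 : ℝ) ≤ (m + 1) * (m + 1 + 1) := by nlinarith
    calc 2 * (2 ^ m * 2 ^ C) * (m + 1 : ℝ) = 2 * 2 ^ C * ((m + 1) * 2 ^ m) := by ring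
      _ ≤ 2 * 2 ^ C * ((m + 1) * (m + 1 + 1) * 2 ^ m) := by gcongr
  have ht := threshold_le_sqrt m
  have ht' := threshold_le_sqrt (m + C)
  have hs := Real.sqrt_nonneg (threshold (1 / 100) m)
  have hs' := Real.sqrt_nonneg (threshold (1 / 100) (m + C))
  have hb := blocks_le m
  have h2 : (0 : ℝ) < 2 ^ m := by positivity
  have h24 : (2 : ℝ) ^ m ≤ 8 ^ m := pow_le_pow_left₀ (by norm_num) (by norm_num) m
  have h24' : (2 : ℝ) ^ (m + C) ≤ 8 ^ (m + C) := pow_le_pow_left₀ (by norm_num) (by norm_num) _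
  have h8 : (8 : ℝ) ^ m = 2 ^ m * 4 ^ m := by
    rw [← mul_pow]
    norm_num
  have hk8 : ((m + 1 : ℝ) * (m + 1 + 1)) * 2 ^ m ≤ 2 * 8 ^ m := by
    rw [h8]
    nlinarith
  have h16 : (1 : ℝ) / 2 ^ (4 * m) * 8 ^ m = (1 / 2) ^ m := by
    rw [pow_mul, one_div, ← inv_pow, ← mul_pow]
    norm_num
  have he : (0 : ℝ) < 1 / 2 ^ (4 * m) := by positivity
  rw [ha]
  generalize √(threshold (1 / 100) m) = r at *
  generalize √(threshold (1 / 100) (m + C)) = r' at *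
  generalize (1 : ℝ) / 2 ^ (4 * m) = e at *
  have e1 : (2 : ℝ) ^ m * r ≤ 8 ^ m * r := by gcongr
  have e2 : (2 : ℝ) ^ (m + C) * r' ≤ 8 ^ (m + C) * r' := by gcongr
  have e3 : (2 : ℝ) ^ m * e ≤ (1 / 2) ^ m := by
    rw [← h16, mul_comm]
    gcongr
  have e4 : (2 : ℝ) ^ (m + C) * e ≤ 2 ^ C * (1 / 2) ^ m := by
    rw [pow_add]
    nlinarith [mul_le_mul_of_nonneg_left e3 (by positivity : (0 : ℝ) ≤ 2 ^ C)]
  have e5 : ((m + 1 : ℝ) * (m + 1 + 1)) * 2 ^ m * r ≤ 2 * (8 ^ m * r) := by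
    rw [← mul_assoc]
    gcongr
  have e6 : ((m + 1 : ℝ) * (m + 1 + 1)) * 2 ^ m * e ≤ 2 * (1 / 2) ^ m := by
    rw [← h16]
    nlinarith
  have e7 : ((m + 1 : ℝ) * (m + 1 + 1)) * 2 ^ m * threshold (1 / 100) m ≤ 2 * (8 ^ m * r) :=
    (mul_le_mul_of_nonneg_left ht (by positivity)).trans e5
  have e8 : (2 : ℝ) ^ (m + C) * threshold (1 / 100) (m + C) ≤ 8 ^ (m + C) * r' :=
    (mul_le_mul_of_nonneg_left ht' (by positivity)).trans e2
  linarith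

lemma tendsto_coordination_error (a C : ℕ) :
    Tendsto (fun m : ℕ => a * √(1 / 2 : ℝ) ^ m + 16 * (8 ^ m * √(threshold (1 / 100) m)) +
      6 * (8 ^ (m + C) * √(threshold (1 / 100) (m + C))) + (12 + 4 * 2 ^ C) * (1 / 2) ^ m +
      2 * 2 ^ C * (1 / (m + 1))) atTop (𝓝 0) := by
  have h1 : Tendsto (fun m : ℕ => √(1 / 2 : ℝ) ^ m) atTop (𝓝 0) :=
    tendsto_pow_atTop_nhds_zero_of_lt_one (Real.sqrt_nonneg _)
      ((Real.sqrt_lt' one_pos).2 (by norm_num))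
  have h2 : Tendsto (fun m : ℕ => (1 / 2 : ℝ) ^ m) atTop (𝓝 0) :=
    tendsto_pow_atTop_nhds_zero_of_lt_one (by norm_num) (by norm_num)
  have h3 := tendsto_pow_mul_sqrt_threshold
  have h4 := h3.comp (tendsto_add_atTop_nat C)
  have h5 : Tendsto (fun m : ℕ => (1 : ℝ) / (m + 1)) atTop (𝓝 0) := tendsto_one_div_add_atTop_nhds_zero_nat
  have h := ((((h1.const_mul (a : ℝ)).add (h3.const_mul 16)).add (h4.const_mul 6)).add
    (h2.const_mul (12 + 4 * 2 ^ C))).add (h5.const_mul (2 * 2 ^ C))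
  simpa only [mul_zero, add_zero, Function.comp_apply] using h

lemma blockLoss_nonneg {k n n' : ℕ} {C : Type*} {PS : S → ℝ} {W : X → Y → ℝ}
    {P : S × X × Y × T → ℝ} (hPS : ∀ s, 0 ≤ PS s) (hW : ∀ x y, 0 ≤ W x y)
    {enc : ((Fin k × Fin n) ⊕ Fin n' → S) → C → ((Fin k × Fin n) ⊕ Fin n' → X) → ℝ}
    {dec : ((Fin k × Fin n) ⊕ Fin n' → Y) → C → ((Fin k × Fin n) ⊕ Fin n' → T) → ℝ}
    (henc : ∀ s c x, 0 ≤ enc s c x) (hdec : ∀ y c t, 0 ≤ dec y c t) (c : C) (i : Fin k) :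
    0 ≤ blockLoss PS W P enc dec c i := by
  refine Finset.sum_nonneg fun s _ => Finset.sum_nonneg fun x _ => Finset.sum_nonneg fun y _ =>
    Finset.sum_nonneg fun t _ => mul_nonneg (mul_nonneg (mul_nonneg (mul_nonneg ?_ (henc s c x)) ?_)
      (hdec y c t)) (Finset.sum_nonneg fun _ _ => abs_nonneg _)
  · exact Finset.prod_nonneg fun i _ => hPS _
  · exact Finset.prod_nonneg fun i _ => hW _ _

lemma Choice.failProb_le {m : ℕ} {β : ℝ} (κ : Choice L β m) {ε B : ℝ}
    (hε : 0 < ε) (hB : ∀ i, 𝔼 c, blockLoss L.PS L.W L.target κ.enc κ.dec c i ≤ B) :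
    failProb L.PS L.W L.target ε κ.enc κ.dec ≤ (B + 2 * 2 ^ κ.mx / (κ.k * 2 ^ m)) / ε := by
  have h := PolarCoord.failProb_le hε L.PS_mem L.W_mem L.target_mem (Nat.two_pow_pos m) (Nat.two_pow_pos κ.mx)
    (enc := κ.enc) (dec := κ.dec) (fun s c => κ.enc_mem c s) (fun y c => κ.dec_mem c y)
  refine h.trans ?_
  have hk : (0 : ℝ) < κ.k := by exact_mod_cast κ.k_pos
  have hsum := Finset.sum_le_sum fun i (_ : i ∈ Finset.univ) => hB i
  rw [Finset.sum_const, Finset.card_univ, Fintype.card_fin, nsmul_eq_mul] at hsum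
  have hBnn : 0 ≤ B := (Finset.expect_nonneg fun c _ => blockLoss_nonneg (fun s => L.PS_mem.1 s)
    (fun x => (L.W_mem x).1) (fun s c => ((κ.enc_mem c s).1)) (fun y c => (κ.dec_mem c y).1)
    c _).trans (hB ⟨0, κ.k_pos⟩)
  push_cast
  have hM : (0 : ℝ) < 2 ^ m := by positivity
  have hM' : (0 : ℝ) < 2 ^ κ.mx := by positivity
  gcongr
  · calc _ ≤ ((2 : ℝ) ^ m / (κ.k * 2 ^ m + 2 ^ κ.mx)) * (κ.k * B) := by gcongr
      _ ≤ ((2 : ℝ) ^ m / (κ.k * 2 ^ m)) * (κ.k * B) := by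
        gcongr
        linarith
      _ = B := by field_simp
  · linarith

lemma Choice.tendsto_failProb {C : ℕ} {κ : ∀ m, Choice L (1 / 100) m}
    (hκ : ∀ m, (κ m).mx = m + C ∧ (κ m).b = 4 * m ∧ Nonempty ((κ m).Scheduled (m + 1)))
    (hD : ∀ᶠ m in atTop, (κ m).DrawsCorrectly) {ε : ℝ} (hε : 0 < ε) :
    Tendsto (fun m => failProb L.PS L.W L.target ε (κ m).enc (κ m).dec) atTop (𝓝 0) := by
  have h := (tendsto_coordination_error (Fintype.card (S × X × Y × T)) C).div_const ε
  rw [zero_div] at h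
  refine squeeze_zero' (Eventually.of_forall fun m => failProb_nonneg L.PS_mem.1
    (fun x => (L.W_mem x).1) _ _ (fun s c => ((κ m).enc_mem c s).1)
    fun y c => ((κ m).dec_mem c y).1) ?_ h
  filter_upwards [hD] with m hm
  obtain ⟨h1, h2, ⟨σ⟩⟩ := hκ m
  have h3 := (κ m).failProb_le hε (σ.expect_blockLoss_le hm)
  refine h3.trans (div_le_div_of_nonneg_right ?_ hε.le)
  have h4 : ((κ m).k : ℝ) = (m + 1) * (m + 1 + 1) := by
    rw [σ.k_eq]
    push_cast
    ring
  rw [h1, h2, h4]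
  exact coordination_error_le _ C m

/-- Keys and seeds take O(mn) bits, while the number of channel uses is at least of order m²n. -/
lemma Choice.tendsto_commonRate {C : ℕ} {κ : ∀ m, Choice L (1 / 100) m}
    (hκ : ∀ m, (κ m).mx = m + C ∧ (κ m).b = 4 * m ∧ Nonempty ((κ m).Scheduled (m + 1))) :
    Tendsto (fun m => (κ m).commonRate) atTop (𝓝 0) := by
  have h := (tendsto_one_div_add_atTop_nhds_zero_nat (𝕜 := ℝ)).const_mul (7 + 4 * 2 ^ C : ℝ)
  rw [mul_zero] at h
  refine squeeze_zero (fun m => (κ m).commonRate_nonneg) (fun m => ?_) h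
  obtain ⟨h1, h2, ⟨σ⟩⟩ := hκ m
  refine (Choice.commonRate_le σ).trans ?_
  have hm0 : (0 : ℝ) ≤ m := Nat.cast_nonneg m
  rw [h1, h2, mul_one_div, div_le_div_iff₀ (by positivity) (by positivity), pow_add]
  push_cast
  have h3 : (1 + 2 * (m + 1) + 4 * m : ℝ) + 2 ^ C * (2 + 4 * m) ≤
      (7 + 4 * 2 ^ C) * (m + 1 + 1) := by
    have : (0 : ℝ) < 2 ^ C := by positivity
    nlinarith
  calc _ = ((1 + 2 * (m + 1) + 4 * m : ℝ) + 2 ^ C * (2 + 4 * m)) * ((m + 1) * 2 ^ m) := by ring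
    _ ≤ (7 + 4 * 2 ^ C) * (m + 1 + 1) * ((m + 1) * 2 ^ m) := by gcongr
    _ = _ := by ring

lemma Choice.tendsto_k {C : ℕ} {κ : ∀ m, Choice L (1 / 100) m}
    (hκ : ∀ m, (κ m).mx = m + C ∧ (κ m).b = 4 * m ∧ Nonempty ((κ m).Scheduled (m + 1))) :
    Tendsto (fun m => (κ m).k) atTop atTop := by
  refine tendsto_atTop_mono (fun m => ?_) tendsto_id
  obtain ⟨-, -, ⟨σ⟩⟩ := hκ m
  rw [σ.k_eq, id]
  nlinarith

/-- The codes depend on ε, as their values are the best atoms for that ε. The encoder is replaced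
first, then the decoder against the new encoder. -/
lemma Choice.exists_detKernel_pair {m : ℕ} {β : ℝ} (κ : Choice L β m) (ε : ℝ) :
    ∃ (f : (κ.Use → S) → κ.Common → (κ.Use → X)) (g : (κ.Use → Y) → κ.Common → (κ.Use → T)),
      (∀ s c, 0 < κ.enc s c (f s c)) ∧ (∀ y c, 0 < κ.dec y c (g y c)) ∧
      failProb L.PS L.W L.target ε (detKernel f) (detKernel g) ≤
        failProb L.PS L.W L.target ε κ.enc κ.dec := by
  obtain ⟨f, hf, hf'⟩ := exists_detKernel_enc (W := L.W) (enc := κ.enc) L.target ε κ.dec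
    L.PS_mem.1 fun s c => by convert κ.enc_mem c s
  obtain ⟨g, hg, hg'⟩ := exists_detKernel_dec (PS := L.PS) (W := L.W) (dec := κ.dec) L.target ε
    (detKernel f) fun y c => by convert κ.dec_mem c y
  exact ⟨f, g, hf, hg, hg'.trans hf'⟩

lemma Choice.exists_detKernel {β : ℝ} {κ : ∀ m, Choice L β m} {ε : ℝ}
    (h : Tendsto (fun m => failProb L.PS L.W L.target ε (κ m).enc (κ m).dec) atTop (𝓝 0)) :
    ∃ (f : (m : ℕ) → ((κ m).Use → S) → (κ m).Common → ((κ m).Use → X))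
      (g : (m : ℕ) → ((κ m).Use → Y) → (κ m).Common → ((κ m).Use → T)),
      (∀ m s c, 0 < (κ m).enc s c (f m s c)) ∧ (∀ m y c, 0 < (κ m).dec y c (g m y c)) ∧
      Tendsto (fun m => failProb L.PS L.W L.target ε (detKernel (f m)) (detKernel (g m)))
        atTop (𝓝 0) := by
  choose f g hf hg hfg using fun m => (κ m).exists_detKernel_pair ε
  refine ⟨f, g, hf, hg, squeeze_zero (fun m => failProb_nonneg L.PS_mem.1
    (fun x => (L.W_mem x).1) _ _ (fun s c x => ?_) fun y c t => ?_) hfg h⟩ <;>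
  · unfold detKernel
    split_ifs <;> norm_num

end Limits

end PolarCoord


theorem theorem2 {S X Y T : Type*} [Fintype S] [Fintype X] [Fintype Y] [Fintype T]
    (L : PolarCoord.AuxLaw S X Y T) (hI : L.infoUS ≤ L.infoUY) :
    ∃ β : ℝ, 0 < β ∧ β < 1 / 2 ∧ ∃ κ : (m : ℕ) → PolarCoord.Choice L β m,
      -- the number of chained blocks grows
      Filter.Tendsto (fun m => (κ m).k) Filter.atTop Filter.atTop ∧
      -- the chaining construction proper, up to a vanishing fraction of positions if
      -- `I(U;S) = I(U;Y)`
      (L.infoUS < L.infoUY →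
        ∀ᶠ m in Filter.atTop, (κ m).E = ∅ ∧ (κ m).D = ∅ ∧ (κ m).mx = m) ∧
      Filter.Tendsto (fun m => (((κ m).E ∪ (κ m).D).card : ℝ) / 2 ^ m) Filter.atTop (nhds 0) ∧
      -- the rate of common randomness vanishes
      Filter.Tendsto (fun m => (κ m).commonRate) Filter.atTop (nhds 0) ∧
      -- the scheme achieves empirical coordination
      (∀ ε : ℝ, 0 < ε → Filter.Tendsto
        (fun m => PolarCoord.failProb L.PS L.W L.target ε (κ m).enc (κ m).dec)
        Filter.atTop (nhds 0)) ∧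
      -- and so do suitable outcomes of its local randomness, which are deterministic codes
      (∀ ε : ℝ, 0 < ε →
        ∃ (f : (m : ℕ) → ((κ m).Use → S) → (κ m).Common → ((κ m).Use → X))
          (g : (m : ℕ) → ((κ m).Use → Y) → (κ m).Common → ((κ m).Use → T)),
          (∀ m s c, 0 < (κ m).enc s c (f m s c)) ∧
          (∀ m y c, 0 < (κ m).dec y c (g m y c)) ∧
          Filter.Tendsto
            (fun m => PolarCoord.failProb L.PS L.W L.target ε
              (PolarCoord.detKernel (f m)) (PolarCoord.detKernel (g m)))
            Filter.atTop (nhds 0)) := by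
  obtain ⟨C, κ, hκ, hev⟩ := PolarCoord.exists_choice_seq L hI
  -- The exponent 1/100 is the one for which `PolarTree.count_le` is proved.
  refine ⟨1 / 100, by norm_num, by norm_num, κ, PolarCoord.Choice.tendsto_k hκ,
    fun h => hev.mono fun m hm => hm.2.2 h, ?_, PolarCoord.Choice.tendsto_commonRate hκ,
    fun ε hε => PolarCoord.Choice.tendsto_failProb hκ (hev.mono fun m hm => hm.1) hε,
    fun ε hε => PolarCoord.Choice.exists_detKernel
      (PolarCoord.Choice.tendsto_failProb hκ (hev.mono fun m hm => hm.1) hε)⟩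
  have h := PolarCoord.tendsto_polarGap.const_mul 2
  rw [mul_zero] at h
  refine squeeze_zero' (Filter.Eventually.of_forall fun m => by positivity) ?_ h
  filter_upwards [hev] with m hm
  rw [div_le_iff₀ (by positivity)]
  exact hm.2.1
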